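/- \textbf{CTP-FOR-DEP.} An instance consists of a nonempty finite list of undirected paths $p_1,\dots,p_k$ from a start vertex $s$ to a target vertex $t \neq s$, pairwise disjoint except for $s$ and $t$, where $p_i$ has edges $e_{i,1},\dots,e_{i,n_i}$ ($n_i\ge 1$), numbered from $s$ to $t$; a nonnegative rational weight $w(e)$ for each edge $e$; and a Bayes network over the edges, whose variable for $e$ says whether $e$ is \emph{blocked} or \emph{open}. Every arc of the network is a forward arc, i.e. goes from some $e_{i,j}$ to some $e_{i,l}$ on the same path with $j<l$. The network is given by full conditional probability tables with rational entries in $[0,1]$, all numbers being written in binary. The statuses of the edges are drawn once from the joint distribution of the network and then stay fixed. An agent starts at $s$. Whenever it is at a vertex it sees the statuses of the edges incident to that vertex, and it can move along an incident open edge $e$ at cost $w(e)$; its task is to reach $t$. A belief state consists of the location of the agent and, for each edge, the information \emph{open}, \emph{blocked} or \emph{unknown}. A policy maps belief states to moves. Its cost for given statuses is the total weight of the moves made until $t$ is first reached ($\infty$ if $t$ is never reached), its expected cost is the expectation of this over the statuses, and a policy is optimal if no policy has smaller expected cost. \textbf{Theorem.} CTP-FOR-DEP is solvable in polynomial time. That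 is: (1) There are optimal policies $\pi_I$, one for each instance $I$, and an algorithm that computes the move $\pi_I(b)$ from an instance $I$ and a belief state $b$ of $I$ in time polynomial in the size of the input $(I,b)$. (2) There is an algorithm that computes the optimal expected cost of an instance $I$ (a fraction, or $\infty$) in time polynomial in the size of $I$. Time is measured on a random access machine with logarithmic cost, i.e. each operation is charged the number of bits of the numbers and addresses that it handles. -/

import Mathlib

open scoped NNReal ENNReal

noncomputable section

/-! ### The Canadian traveller problem with dependent edges

The status of an edge is a `Bool`: `true` means blocked, `false` means open. -/

/-- An instance of CTP-DEP: an undirected weighted (multi)graph with vertices `V` and edges `E`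
(the edge `e` joins `fst e` and `snd e`), a start and a target vertex, and a Bayes network on the
edges: a directed acyclic set of arcs (`arc f e` is the arc from `f` to `e`) and conditional
probabilities, `blockProb e x` being the probability that `e` is blocked when its parents have the
statuses given by `x`. -/
structure CTPDep (V E : Type) where
  fst : E → V
  snd : E → V
  weight : E → ℝ≥0
  arc : E → E → Prop
  acyclic : ∀ e, ¬ Relation.TransGen arc e e
  blockProb : E → (E → Bool) → unitInterval
  blockProb_congr : ∀ e x y, (∀ f, arc f e → x f = y f) → blockProb e x = blockProb e y
  source : V
  target : V

/-- What the agent knows about an edge. -/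
inductive EdgeKnowledge where
  | unknown
  | isOpen
  | isBlocked

/-- The (form of a) belief state: the location of the agent and, for every edge, whether it has
been observed and with what result. -/
structure BeliefForm (V E : Type) where
  loc : V
  status : E → EdgeKnowledge

/-- A policy maps belief states to actions; the action `e` is "move along `e`". -/
abbrev CTPPolicy (V E : Type) : Type := BeliefForm V E → E

namespace CTPDep

variable {V E : Type} (I : CTPDep V E)

/-- `e` is incident to `v`. -/
def Incident (e : E) (v : V) : Prop := v = I.fst e ∨ v = I.snd e

open Classical in
/-- The end of `e` other than `v`, for `e` incident to `v`. -/
def otherEnd (e : E) (v : V) : V := if v = I.fst e then I.snd e else I.fst e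

open Classical in
/-- The belief state of an agent that has just arrived at `v` with knowledge `st`, the true
statuses being `x`: the edges incident to `v` are revealed. -/
def arrive (x : E → Bool) (v : V) (st : E → EdgeKnowledge) : BeliefForm V E where
  loc := v
  status e :=
    if I.Incident e v then (if x e then EdgeKnowledge.isBlocked else EdgeKnowledge.isOpen)
    else st e

/-- The belief state in which the agent starts, the true statuses being `x`. -/
def initial (x : E → Bool) : BeliefForm V E := I.arrive x I.source fun _ => EdgeKnowledge.unknown

/-- Moving along `e` can be performed in `b`. -/
def CanMove (b : BeliefForm V E) (e : E) : Prop :=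
  I.Incident e b.loc ∧ b.status e = EdgeKnowledge.isOpen

open Classical in
/-- One step of the policy `π`. An agent whose policy names an impossible move stays where it is,
and hence stays there forever. -/
def step (π : CTPPolicy V E) (x : E → Bool) (b : BeliefForm V E) : BeliefForm V E :=
  if I.CanMove b (π b) then I.arrive x (I.otherEnd (π b) b.loc) b.status else b

open Classical in
/-- The cost of one step of the policy `π` in the belief state `b`. -/
def stepCost (π : CTPPolicy V E) (b : BeliefForm V E) : ℝ≥0∞ :=
  if I.CanMove b (π b) then (I.weight (π b) : ℝ≥0∞) else 0

/-- The belief state after `n` steps of the policy `π`, the true statuses being `x`. -/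
def trace (π : CTPPolicy V E) (x : E → Bool) (n : ℕ) : BeliefForm V E :=
  (I.step π x)^[n] (I.initial x)

/-- The travel cost of the policy `π` up to the first arrival at the target, the true statuses
being `x`; it is `⊤` if the target is never reached. (Costs are nonnegative, so that the infimum
over all visits to the target is the cost of the first one.) -/
def travelCost (π : CTPPolicy V E) (x : E → Bool) : ℝ≥0∞ :=
  ⨅ (n : ℕ) (_ : (I.trace π x n).loc = I.target),
    ∑ k ∈ Finset.range n, I.stepCost π (I.trace π x k)

variable [Fintype E] [DecidableEq E]

/-- The probability which the Bayes network gives to the status assignment `x`. -/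
def jointProb (x : E → Bool) : ℝ≥0∞ :=
  ∏ e, ENNReal.ofReal (if x e then (I.blockProb e x : ℝ) else 1 - (I.blockProb e x : ℝ))

/-- The expected travel cost of a policy. -/
def expectedCost (π : CTPPolicy V E) : ℝ≥0∞ := ∑ x : E → Bool, I.jointProb x * I.travelCost π x

/-- `π` is an optimal policy: its expected travel cost is minimal. -/
def IsOptimal (π : CTPPolicy V E) : Prop := ∀ π' : CTPPolicy V E, I.expectedCost π ≤ I.expectedCost π'

/-- The optimal expected travel cost. -/
def optimalCost : ℝ≥0∞ := ⨅ π : CTPPolicy V E, I.expectedCost π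

end CTPDep

/-! ### CTP-FOR-DEP -/

/-- The row number of a conditional probability table that belongs to the given parent statuses
(little-endian binary, blocked is 1). -/
def tableIndex : List Bool → ℕ
  | [] => 0
  | b :: l => (if b then 1 else 0) + 2 * tableIndex l

/-- The data of one edge of a path: its weight, the positions (on the same path, counted from 0 at
the start vertex) of its parents in the Bayes network, and its conditional probability table, whose
entry number `tableIndex l` is the probability that the edge is blocked when the list of statuses
of its parents is `l`. -/
structure EdgeSpec where
  weight : ℚ≥0
  parents : List ℕ
  table : List ℚ≥0

/-- The data are those of an edge at position `j` all of whose incoming arcs are forward arcs. -/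
structure EdgeSpec.Valid (d : EdgeSpec) (j : ℕ) : Prop where
  nodup : d.parents.Nodup
  forward : ∀ p ∈ d.parents, p < j
  table_length : d.table.length = 2 ^ d.parents.length
  table_le_one : ∀ q ∈ d.table, q ≤ 1

/-- An instance of CTP-FOR-DEP: a nonempty list of paths from the start to the target, disjoint
apart from their ends; a path is the nonempty list of its edges, from the start to the target. -/
structure CTPForDep where
  paths : List (List EdgeSpec)
  paths_ne_nil : paths ≠ []
  path_ne_nil : ∀ p ∈ paths, p ≠ []
  valid : ∀ p ∈ paths, ∀ (j : ℕ) (h : j < p.length), (p[j]).Valid j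

namespace CTPForDep

variable (I : CTPForDep)

/-- The number of paths. -/
abbrev numPaths : ℕ := I.paths.length

/-- The number of edges of path `i`. -/
abbrev pathLength (i : Fin I.numPaths) : ℕ := (I.paths[i]).length

/-- The edges: `⟨i, j⟩` is the edge number `j` of path `i`, both counted from 0. -/
abbrev Edge : Type := Σ i : Fin I.numPaths, Fin (I.pathLength i)

/-- The vertices: start, target, and the inner vertices of the paths; path `i` passes through
`s, inner i 0, inner i 1, …, inner i (pathLength i - 2), t`. -/
inductive Vertex where
  | s : Vertex
  | t : Vertex
  | inner (i : Fin I.numPaths) (j : Fin (I.pathLength i - 1)) : Vertex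

/-- The vertex number `j` of path `i`, where `0 ≤ j ≤ pathLength i`. -/
def pathVertex (i : Fin I.numPaths) : ℕ → I.Vertex
  | 0 => Vertex.s
  | j + 1 => if h : j < I.pathLength i - 1 then Vertex.inner i ⟨j, h⟩ else Vertex.t

/-- The data of an edge. -/
def spec (e : I.Edge) : EdgeSpec := (I.paths[e.1])[e.2]

theorem spec_valid (e : I.Edge) : (I.spec e).Valid e.2 :=
  I.valid _ (List.getElem_mem _) _ e.2.isLt

/-- The statuses under `x` of the parents of `e`, in the order of the list of parents. -/
def parentStatus (e : I.Edge) (x : I.Edge → Bool) : List Bool :=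
  (I.spec e).parents.map fun p => if h : p < I.pathLength e.1 then x ⟨e.1, ⟨p, h⟩⟩ else false

theorem tableIndex_lt (l : List Bool) : tableIndex l < 2 ^ l.length := by
  induction l with
  | nil => simp [tableIndex]
  | cons b l ih =>
    simp only [tableIndex, List.length_cons, pow_succ]
    split <;> omega

theorem tableIndex_lt_length (e : I.Edge) (x : I.Edge → Bool) :
    tableIndex (I.parentStatus e x) < (I.spec e).table.length := by
  have h := tableIndex_lt (I.parentStatus e x)
  rw [(I.spec_valid e).table_length]
  simpa [parentStatus] using h

/-- The entry of the conditional probability table of `e` for the parent statuses under `x`. -/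
def entry (e : I.Edge) (x : I.Edge → Bool) : ℚ≥0 :=
  (I.spec e).table[tableIndex (I.parentStatus e x)]'(I.tableIndex_lt_length e x)

/-- The arcs of the Bayes network. -/
def Arc (f e : I.Edge) : Prop := f.1 = e.1 ∧ (f.2 : ℕ) ∈ (I.spec e).parents

theorem Arc.lt {I : CTPForDep} {f e : I.Edge} (h : I.Arc f e) : (f.2 : ℕ) < e.2 :=
  (I.spec_valid e).forward _ h.2

/-- The CTP-DEP instance given by the data. -/
def toCTPDep : CTPDep I.Vertex I.Edge where
  fst e := I.pathVertex e.1 e.2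
  snd e := I.pathVertex e.1 (e.2 + 1)
  weight e := ((I.spec e).weight : ℝ≥0)
  arc := I.Arc
  acyclic e h := by
    have key : ∀ f g : I.Edge, Relation.TransGen I.Arc f g → (f.2 : ℕ) < g.2 := by
      intro f g hfg
      induction hfg with
      | single h => exact h.lt
      | tail _ h ih => exact ih.trans h.lt
    exact lt_irrefl _ (key e e h)
  blockProb e x := ⟨((I.entry e x : ℚ≥0) : ℝ), by
    refine ⟨by positivity, ?_⟩
    have h := (I.spec_valid e).table_le_one _ (List.getElem_mem (I.tableIndex_lt_length e x))
    exact_mod_cast h⟩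
  blockProb_congr e x y hxy := by
    have : I.parentStatus e x = I.parentStatus e y := by
      refine List.map_congr_left fun p hp => ?_
      split
      · exact hxy _ ⟨rfl, hp⟩
      · rfl
    simp only [entry, this]
  source := Vertex.s
  target := Vertex.t

end CTPForDep

/-! ### Encodings as lists of natural numbers -/

/-- A list, preceded by its length. -/
def encodeList {α : Type} (f : α → List ℕ) (l : List α) : List ℕ := l.length :: l.flatMap f

/-- A nonnegative rational: numerator, denominator. -/
def encodeRat (q : ℚ≥0) : List ℕ := [q.num, q.den]

def EdgeSpec.encode (d : EdgeSpec) : List ℕ :=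
  encodeRat d.weight ++ encodeList (fun p => [p]) d.parents ++ encodeList encodeRat d.table

def CTPForDep.encode (I : CTPForDep) : List ℕ := encodeList (encodeList EdgeSpec.encode) I.paths

def CTPForDep.encodeVertex (I : CTPForDep) : I.Vertex → List ℕ
  | CTPForDep.Vertex.s => [0, 0, 0]
  | CTPForDep.Vertex.t => [1, 0, 0]
  | CTPForDep.Vertex.inner i j => [2, i, j]

def EdgeKnowledge.encode : EdgeKnowledge → ℕ
  | EdgeKnowledge.unknown => 0
  | EdgeKnowledge.isOpen => 1
  | EdgeKnowledge.isBlocked => 2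

/-- A belief state: the location, then what is known about the edges, path by path. -/
def CTPForDep.encodeBelief (I : CTPForDep) (b : BeliefForm I.Vertex I.Edge) : List ℕ :=
  I.encodeVertex b.loc ++
    (List.finRange I.numPaths).flatMap fun i =>
      (List.finRange (I.pathLength i)).map fun j => (b.status ⟨i, j⟩).encode

/-- An edge: the number of its path, its position on the path. -/
def CTPForDep.encodeEdge (I : CTPForDep) (e : I.Edge) : List ℕ := [e.1, e.2]

/-- The value of the fraction `a / b`, a denominator 0 standing for infinity. -/
def fractionValue (r : ℕ × ℕ) : ℝ≥0∞ := if r.2 = 0 then ⊤ else (r.1 : ℝ≥0∞) / (r.2 : ℝ≥0∞)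

/-! ### Polynomial time

Programs for a random access machine with structured control flow; every operation is charged the
number of bits of the numbers and addresses it handles (logarithmic cost). -/

namespace RAM

/-- The memory: one natural number in each cell. -/
abbrev Memory : Type := ℕ → ℕ

/-- Expressions: constants, the content of the cell with a computed address, and arithmetic on the
natural numbers (with truncated subtraction, and division rounded down). -/
inductive Expr where
  | lit (n : ℕ) : Expr
  | cell (a : Expr) : Expr
  | add (a b : Expr) : Expr
  | sub (a b : Expr) : Expr
  | mul (a b : Expr) : Expr
  | div (a b : Expr) : Expr

def Expr.eval (m : Memory) : Expr → ℕ
  | lit n => n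
  | cell a => m (a.eval m)
  | add a b => a.eval m + b.eval m
  | sub a b => a.eval m - b.eval m
  | mul a b => a.eval m * b.eval m
  | div a b => a.eval m / b.eval m

/-- The cost of evaluating an expression (`Nat.size` is the number of binary digits). -/
def Expr.cost (m : Memory) : Expr → ℕ
  | lit n => 1 + n.size
  | cell a => a.cost m + 1 + (a.eval m).size + (m (a.eval m)).size
  | add a b => a.cost m + b.cost m + 1 + (a.eval m).size + (b.eval m).size
  | sub a b => a.cost m + b.cost m + 1 + (a.eval m).size + (b.eval m).size
  | mul a b => a.cost m + b.cost m + 1 + (a.eval m).size + (b.eval m).size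
  | div a b => a.cost m + b.cost m + 1 + (a.eval m).size + (b.eval m).size

/-- Programs; `store a e` writes the value of `e` into the cell whose address is the value of `a`,
and a test succeeds if the value of its expression is not 0. -/
inductive Prog where
  | skip : Prog
  | store (a e : Expr) : Prog
  | seq (p q : Prog) : Prog
  | ifNonzero (e : Expr) (p q : Prog) : Prog
  | whileNonzero (e : Expr) (p : Prog) : Prog

/-- `Exec p m k m'`: started on the memory `m`, the program `p` halts after time `k` with the
memory `m'`. -/
inductive Exec : Prog → Memory → ℕ → Memory → Prop where
  | skip (m : Memory) : Exec Prog.skip m 1 m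
  | store (a e : Expr) (m : Memory) :
      Exec (Prog.store a e) m
        (a.cost m + e.cost m + 1 + (a.eval m).size + (e.eval m).size)
        (Function.update m (a.eval m) (e.eval m))
  | seq {p q : Prog} {m m₁ m₂ : Memory} {k l : ℕ} :
      Exec p m k m₁ → Exec q m₁ l m₂ → Exec (Prog.seq p q) m (k + l) m₂
  | if_true {e : Expr} {p q : Prog} {m m₁ : Memory} {k : ℕ} :
      e.eval m ≠ 0 → Exec p m k m₁ → Exec (Prog.ifNonzero e p q) m (e.cost m + 1 + k) m₁
  | if_false {e : Expr} {p q : Prog} {m m₁ : Memory} {k : ℕ} :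
      e.eval m = 0 → Exec q m k m₁ → Exec (Prog.ifNonzero e p q) m (e.cost m + 1 + k) m₁
  | while_true {e : Expr} {p : Prog} {m m₁ m₂ : Memory} {k l : ℕ} :
      e.eval m ≠ 0 → Exec p m k m₁ → Exec (Prog.whileNonzero e p) m₁ l m₂ →
        Exec (Prog.whileNonzero e p) m (e.cost m + 1 + k + l) m₂
  | while_false {e : Expr} {p : Prog} {m : Memory} :
      e.eval m = 0 → Exec (Prog.whileNonzero e p) m (e.cost m + 1) m

/-- The memory that holds the list `l` and nothing else: its length in cell 0, its entries in the
cells from 1 on. -/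
def load (l : List ℕ) : Memory
  | 0 => l.length
  | i + 1 => l.getD i 0

/-- The memory holds the list `l` (whatever the cells behind the list contain). -/
def Holds (m : Memory) (l : List ℕ) : Prop :=
  m 0 = l.length ∧ ∀ (i : ℕ) (h : i < l.length), m (i + 1) = l[i]

/-- The size of an input: the total number of bits, plus the number of entries. -/
def inputSize (l : List ℕ) : ℕ := (l.map fun n => n.size + 1).sum

/-- One program computes, for every `a`, the output `out a` from the input `inp a`, in time bounded
by a polynomial in the size of the input. -/
def PolyTime {α : Type} (inp out : α → List ℕ) : Prop :=
  ∃ (prog : Prog) (bound : Polynomial ℕ), ∀ a : α, ∃ (k : ℕ) (m : Memory),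
    Exec prog (load (inp a)) k m ∧ k ≤ bound.eval (inputSize (inp a)) ∧ Holds m (out a)

end RAM

end

/-!
The statuses of different paths are independent, as all arcs of the network stay on one path. On a
path the agent meets the edges in order, and it learns about an edge only while all previous edges
are open; since the arcs are forward arcs, the parents of the next edge are then all open, so that
only the first entry of each conditional probability table matters. Hence trying path `i`, that is,
walking along it until `t` is reached or a blocked edge forces the agent back to `s`, has a fixed
success probability `openProb i` and a fixed expected cost. The quotient of the expected cost by the
success probability is the `index` of the path.

*Optimal policies.* If all paths may turn out to be blocked, every policy has infinite expected cost
(`expectedCost_eq_top`). Otherwise the optimal expected cost is `value`, the expected index of the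
first open path in the order of indices. For the lower bound `value_le_expectedCost`, count each
edge that is crossed before `t` is reached: a walk from `s` to `t` that finishes on path `i` pays
twice for all of them, except that it need not pay twice for the edges of path `i`
(`exists_finish`). Given that an edge is crossed, the rest of its path is open with the
conditional probability, whatever the policy (`pr_crosses_last_le`; it rests on the independence
statement `pr_and_open`). Therefore a policy pays on path `i`, in expectation, at least the index of
`i` times the probability of finishing there (`pr_mul_index_le`), and it can only finish on an open
path. A policy that tries the paths in the order of indices, leaving out those that are known to be
blocked, attains the bound (`Committing.expectedCost_le`).

*Algorithms.* The index of a path is a fraction of integers that are computed by one pass over its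
edges (`pathData`), and whose numbers of bits are bounded by the size of the input, as they are
bounded by the product of the numbers in the encoding (`small_pathData`, `pathCap_le`). To find the
move at `s`, a program compares the indices of the paths (`bestUpTo`). To find `value`, it takes the
paths in the order of indices, and updates the probability that all of them are blocked and the part
of the expected index due to them (`tryPaths`).

*Running time.* In the Hoare-style predicate `Runs`, all numbers in the memory have at most `B`
bits, so that each elementary operation costs at most `B + 1`, and it remains to count operations.
Both programs need a quadratic number of operations on numbers with a linear number of bits
(`polyTime_of_runs`).
-/

noncomputable section

namespace CTPForDep

variable (I : CTPForDep)

/-! ### Probabilities -/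

/-- The conditional probability of the status which `x` gives to `e`. -/
def factor (e : I.Edge) (x : I.Edge → Bool) : ℝ :=
  if x e then (I.toCTPDep.blockProb e x : ℝ) else 1 - (I.toCTPDep.blockProb e x : ℝ)

/-- The probability of the status assignment `x`, as a real number. -/
def prob (x : I.Edge → Bool) : ℝ := ∏ e, I.factor e x

open Classical in
/-- The probability of an event. -/
def pr (A : (I.Edge → Bool) → Prop) : ℝ := ∑ x, if A x then I.prob x else 0

/-- The probability that edge `j` of path `i` is open if all previous edges of the path are open:
this is read off the first entry of its table. -/
def clear (i : Fin I.numPaths) (j : ℕ) : ℝ :=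
  if h : j < I.pathLength i then 1 - (((I.spec ⟨i, ⟨j, h⟩⟩).table.headD 0 : ℚ≥0) : ℝ) else 1

/-- The probability that the first `c` edges of path `i` are open. -/
def pathProb (i : Fin I.numPaths) (c : ℕ) : ℝ := ∏ j ∈ Finset.range c, I.clear i j

theorem factor_nonneg (e : I.Edge) (x : I.Edge → Bool) : 0 ≤ I.factor e x := by
  unfold factor
  split
  · exact (I.toCTPDep.blockProb e x).2.1
  · exact sub_nonneg.2 (I.toCTPDep.blockProb e x).2.2

theorem prob_nonneg (x : I.Edge → Bool) : 0 ≤ I.prob x :=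
  Finset.prod_nonneg fun e _ => I.factor_nonneg e x

theorem jointProb_eq (x : I.Edge → Bool) : I.toCTPDep.jointProb x = ENNReal.ofReal (I.prob x) := by
  rw [prob, ENNReal.ofReal_prod_of_nonneg fun e _ => I.factor_nonneg e x]
  rfl

/-- Edge `e` with the other status, everything else unchanged. -/
def flip (e : I.Edge) (x : I.Edge → Bool) : I.Edge → Bool := Function.update x e (!x e)

theorem flip_self (e : I.Edge) (x : I.Edge → Bool) : I.flip e x e = !x e := by simp [flip]

theorem flip_of_ne {e f : I.Edge} (h : f ≠ e) (x : I.Edge → Bool) : I.flip e x f = x f := by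
  simp [flip, h]

theorem flip_involutive (e : I.Edge) : Function.Involutive (I.flip e) := by
  intro x
  funext f
  by_cases h : f = e
  · subst h; simp [flip_self]
  · simp [flip_of_ne _ h]

theorem sum_flip (e : I.Edge) (F : (I.Edge → Bool) → ℝ) : ∑ x, F (I.flip e x) = ∑ x, F x :=
  Equiv.sum_comp (I.flip_involutive e).toPerm F

/-- The function `G` does not depend on the statuses of the edges in `T`. -/
def FreeOf {β : Type} (T : Finset I.Edge) (G : (I.Edge → Bool) → β) : Prop :=
  ∀ x y, (∀ e, e ∉ T → x e = y e) → G x = G y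

theorem FreeOf.mono {I : CTPForDep} {β : Type} {T T' : Finset I.Edge} {G : (I.Edge → Bool) → β}
    (hG : I.FreeOf T G) (h : T' ⊆ T) : I.FreeOf T' G := fun x y hxy =>
  hG x y fun e he => hxy e fun h' => he (h h')

theorem FreeOf.flip {I : CTPForDep} {β : Type} {T : Finset I.Edge}
    {G : (I.Edge → Bool) → β} (hG : I.FreeOf T G) {e : I.Edge} (he : e ∈ T)
    (x : I.Edge → Bool) : G (I.flip e x) = G x :=
  hG _ _ fun _ hf => I.flip_of_ne (fun h => hf (by rwa [h])) x

/-- With every edge, `T` contains all later edges of the same path. -/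
def UpClosed (T : Finset I.Edge) : Prop :=
  ∀ e ∈ T, ∀ f : I.Edge, f.1 = e.1 → (e.2 : ℕ) ≤ f.2 → f ∈ T

/-- The edges of path `i` from number `c` on. -/
def tail (i : Fin I.numPaths) (c : ℕ) : Finset I.Edge :=
  Finset.univ.filter fun e => e.1 = i ∧ c ≤ (e.2 : ℕ)

theorem mem_tail {i : Fin I.numPaths} {c : ℕ} {e : I.Edge} :
    e ∈ I.tail i c ↔ e.1 = i ∧ c ≤ (e.2 : ℕ) := by simp [tail]

theorem tail_anti (i : Fin I.numPaths) {c d : ℕ} (h : c ≤ d) : I.tail i d ⊆ I.tail i c :=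
  fun _ he => I.mem_tail.2 ⟨(I.mem_tail.1 he).1, h.trans (I.mem_tail.1 he).2⟩

theorem upClosed_tail (i : Fin I.numPaths) (c : ℕ) : I.UpClosed (I.tail i c) :=
  fun _ he _ hf h => I.mem_tail.2 ⟨hf.trans (I.mem_tail.1 he).1, (I.mem_tail.1 he).2.trans h⟩

theorem UpClosed.erase {I : CTPForDep} {T : Finset I.Edge} (hT : I.UpClosed T) {e : I.Edge}
    (he : ∀ f ∈ T, f.1 = e.1 → (e.2 : ℕ) ≤ f.2) : I.UpClosed (T.erase e) := by
  intro f hf g hg hfg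
  obtain ⟨hfe, hfT⟩ := Finset.mem_erase.1 hf
  refine Finset.mem_erase.2 ⟨?_, hT f hfT g hg hfg⟩
  rintro rfl
  obtain ⟨g1, g2⟩ := g
  obtain ⟨f1, f2⟩ := f
  obtain rfl : g1 = f1 := hg
  have := he _ hfT rfl
  exact hfe (congrArg (Sigma.mk g1) (Fin.ext (le_antisymm hfg this)))

/-- A factor depends on the status of its edge and of the previous edges of the path only. -/
theorem factor_congr (e : I.Edge) {x y : I.Edge → Bool} (he : x e = y e)
    (h : ∀ f : I.Edge, f.1 = e.1 → (f.2 : ℕ) < e.2 → x f = y f) : I.factor e x = I.factor e y := by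
  have := I.toCTPDep.blockProb_congr e x y fun f hf => h f hf.1 (Arc.lt hf)
  simp only [factor, he, this]

/-- The product of the factors of the edges outside `T`. -/
def partialProb (T : Finset I.Edge) (x : I.Edge → Bool) : ℝ := ∏ e ∈ Tᶜ, I.factor e x

theorem freeOf_partialProb {T : Finset I.Edge} (hT : I.UpClosed T) :
    I.FreeOf T (I.partialProb T) := by
  intro x y h
  refine Finset.prod_congr rfl fun e he => ?_
  have he' : e ∉ T := Finset.mem_compl.1 he
  exact I.factor_congr e (h e he') fun f hf hlt => h f fun hf' => he' (hT f hf' e hf.symm hlt.le)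

theorem partialProb_empty (x : I.Edge → Bool) : I.partialProb ∅ x = I.prob x := by
  simp [partialProb, prob]

theorem partialProb_erase {T : Finset I.Edge} {e : I.Edge} (he : e ∈ T) (x : I.Edge → Bool) :
    I.partialProb (T.erase e) x = I.factor e x * I.partialProb T x := by
  unfold partialProb
  rw [Finset.compl_erase, Finset.prod_insert (by simpa using he)]

/-- Summation over the two statuses of an edge. -/
theorem two_mul_sum_partialProb {T : Finset I.Edge} (hT : I.UpClosed T) {e : I.Edge} (he : e ∈ T)
    (G : (I.Edge → Bool) → ℝ) :
    2 * ∑ x, I.partialProb (T.erase e) x * G x =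
      ∑ x, (I.factor e x * G x + I.factor e (I.flip e x) * G (I.flip e x)) *
        I.partialProb T x := by
  have h : ∀ x, I.partialProb T (I.flip e x) = I.partialProb T x :=
    (I.freeOf_partialProb hT).flip he
  rw [two_mul]
  nth_rw 2 [← I.sum_flip e]
  rw [← Finset.sum_add_distrib]
  refine Finset.sum_congr rfl fun x _ => ?_
  simp only [I.partialProb_erase he, h]
  ring

theorem blockProb_flip (e : I.Edge) (x : I.Edge → Bool) :
    I.toCTPDep.blockProb e (I.flip e x) = I.toCTPDep.blockProb e x :=
  I.toCTPDep.blockProb_congr _ _ _ fun f hf => I.flip_of_ne (fun h => by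
    subst h; exact lt_irrefl _ (Arc.lt hf)) x

theorem factor_add_factor_flip (e : I.Edge) (x : I.Edge → Bool) :
    I.factor e x + I.factor e (I.flip e x) = 1 := by
  unfold factor
  rw [flip_self, blockProb_flip]
  cases x e <;> simp

/-- Summing out edges which the integrand does not depend on. Every edge counts twice as the sum
on the right-hand side still runs over all statuses. -/
theorem two_pow_mul_sum (d : ℕ) : ∀ {T : Finset I.Edge}, T.card = d → I.UpClosed T →
    ∀ G : (I.Edge → Bool) → ℝ, I.FreeOf T G →
      2 ^ d * ∑ x, I.prob x * G x = ∑ x, I.partialProb T x * G x := by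
  induction d with
  | zero =>
    intro T hd _ G _
    obtain rfl : T = ∅ := Finset.card_eq_zero.1 hd
    simp [I.partialProb_empty]
  | succ d ih =>
    intro T hd hT G hG
    -- The first edge of `T` is the last one to be summed out.
    obtain ⟨e, he, hmin⟩ := T.exists_min_image (fun e => (e.2 : ℕ))
      (Finset.card_pos.1 (by omega))
    rw [pow_succ', mul_assoc, ih (T := T.erase e) (by rw [Finset.card_erase_of_mem he]; omega)
      (hT.erase fun f hf _ => hmin f hf) G (hG.mono (T.erase_subset e)),
      I.two_mul_sum_partialProb hT he]
    refine Finset.sum_congr rfl fun x _ => ?_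
    rw [hG.flip he, ← add_mul, factor_add_factor_flip, one_mul, mul_comm]

/-- The probabilities of the status assignments add up to 1. -/
theorem pr_true : I.pr (fun _ => True) = 1 := by
  have h := I.two_pow_mul_sum _ (T := Finset.univ) rfl (fun _ _ _ _ _ => Finset.mem_univ _)
    (fun _ => 1) (fun _ _ _ => rfl)
  have h2 : (2 : ℝ) ^ (Finset.univ : Finset I.Edge).card ≠ 0 := by positivity
  simp only [partialProb, Finset.compl_univ, Finset.prod_empty, mul_one, Finset.sum_const,
    Finset.card_univ, Fintype.card_fun, Fintype.card_bool, nsmul_eq_mul, Nat.cast_pow,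
    Nat.cast_ofNat] at h
  simpa [pr] using mul_left_cancel₀ (by positivity) (h.trans (mul_one _).symm)

theorem tableIndex_eq_zero : ∀ {l : List Bool}, (∀ b ∈ l, b = false) → tableIndex l = 0
  | [], _ => rfl
  | b :: l, h => by
    have hb : b = false := h b (by simp)
    have hl := tableIndex_eq_zero (l := l) fun c hc => h c (by simp [hc])
    simp [tableIndex, hb, hl]

/-- If all previous edges of the path are open, so are all parents of edge `c`, and the first entry
of the table applies. -/
theorem blockProb_of_open (i : Fin I.numPaths) {c : ℕ} (hc : c < I.pathLength i)
    (x : I.Edge → Bool) (hx : ∀ j (h : j < I.pathLength i), j < c → x ⟨i, ⟨j, h⟩⟩ = false) :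
    1 - (I.toCTPDep.blockProb ⟨i, ⟨c, hc⟩⟩ x : ℝ) = I.clear i c := by
  have h0 : tableIndex (I.parentStatus ⟨i, ⟨c, hc⟩⟩ x) = 0 := by
    refine tableIndex_eq_zero fun b hb => ?_
    obtain ⟨p, hp, rfl⟩ := List.mem_map.1 hb
    have := (I.spec_valid ⟨i, ⟨c, hc⟩⟩).forward p hp
    dsimp only
    split
    · exact hx _ _ this
    · rfl
  rw [clear, dif_pos hc]
  have : I.entry ⟨i, ⟨c, hc⟩⟩ x = (I.spec ⟨i, ⟨c, hc⟩⟩).table.headD 0 := by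
    unfold entry
    simp only [h0]
    rw [← List.head_eq_getElem_zero (List.ne_nil_of_length_pos
      (h0 ▸ I.tableIndex_lt_length ⟨i, ⟨c, hc⟩⟩ x)), List.headD_eq_head?_getD,
      List.head?_eq_some_head]
    rfl
  rw [← this]
  rfl

/-- An event that implies that the edges of path `i` before number `c` are open, and that does not
depend on the others, is followed by an open edge number `c` with the probability `clear i c`. -/
theorem pr_and_open (i : Fin I.numPaths) {c : ℕ} (hc : c < I.pathLength i)
    {A : (I.Edge → Bool) → Prop} (hA : I.FreeOf (I.tail i c) A)
    (hopen : ∀ x, A x → ∀ j (h : j < I.pathLength i), j < c → x ⟨i, ⟨j, h⟩⟩ = false) :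
    I.pr (fun x => A x ∧ x ⟨i, ⟨c, hc⟩⟩ = false) = I.clear i c * I.pr A := by
  classical
  set e : I.Edge := ⟨i, ⟨c, hc⟩⟩ with he
  set T := I.tail i c with hTdef
  have het : e ∈ T := I.mem_tail.2 ⟨rfl, le_rfl⟩
  have hT : I.UpClosed T := I.upClosed_tail i c
  have hT' : I.UpClosed (T.erase e) := hT.erase fun f hf _ => (I.mem_tail.1 hf).2
  set G : (I.Edge → Bool) → ℝ := fun x => if A x ∧ x e = false then 1 else 0 with hGdef
  set H : (I.Edge → Bool) → ℝ := fun x => if A x then 1 else 0 with hHdef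
  have hG : I.FreeOf (T.erase e) G := by
    intro x y hxy
    have h1 : A x = A y := hA.mono (T.erase_subset e) x y hxy
    have h2 : x e = y e := hxy e (by simp)
    simp only [hGdef, h1, h2]
  have hH : I.FreeOf T H := by
    intro x y hxy
    simp only [hHdef, hA x y hxy]
  -- All later edges of the path are summed out, on both sides; then `e` is summed out.
  obtain ⟨d, hd⟩ : ∃ d, T.card = d + 1 :=
    ⟨T.card - 1, by have := Finset.card_pos.2 ⟨e, het⟩; omega⟩
  have key := I.two_pow_mul_sum d (T := T.erase e)
    (by rw [Finset.card_erase_of_mem het]; omega) hT' G hG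
  have key2 := I.two_pow_mul_sum (d + 1) hd hT H hH
  have key3 := I.two_mul_sum_partialProb hT het G
  have key4 : ∑ x, (I.factor e x * G x + I.factor e (I.flip e x) * G (I.flip e x)) *
      I.partialProb T x = I.clear i c * ∑ x, I.partialProb T x * H x := by
    rw [Finset.mul_sum]
    refine Finset.sum_congr rfl fun x _ => ?_
    by_cases hx : A x
    · have hfx : A (I.flip e x) := (hA.flip het x).symm ▸ hx
      have := I.blockProb_of_open i hc x (hopen x hx)
      have hb := I.blockProb_flip e x
      rw [← this]
      simp only [hGdef, hHdef, hx, hfx, true_and, flip_self, factor, hb]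
      cases hxe : x e <;> simp [he]
    · have hfx : ¬ A (I.flip e x) := (hA.flip het x).symm ▸ hx
      simp [hGdef, hHdef, hx, hfx]
  have h2 : (2 : ℝ) ^ (d + 1) ≠ 0 := by positivity
  have hGsum : I.pr (fun x => A x ∧ x e = false) = ∑ x, I.prob x * G x :=
    Finset.sum_congr rfl fun x _ => by by_cases h : A x ∧ x e = false <;> simp [hGdef, h]
  have hHsum : I.pr A = ∑ x, I.prob x * H x :=
    Finset.sum_congr rfl fun x _ => by by_cases h : A x <;> simp [hHdef, h]
  rw [hGsum, hHsum]
  apply mul_left_cancel₀ h2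
  calc (2 : ℝ) ^ (d + 1) * ∑ x, I.prob x * G x = 2 * (2 ^ d * ∑ x, I.prob x * G x) := by ring
    _ = I.clear i c * ∑ x, I.partialProb T x * H x := by rw [key, key3, key4]
    _ = I.clear i c * (2 ^ (d + 1) * ∑ x, I.prob x * H x) := by rw [key2]
    _ = _ := by ring

theorem clear_nonneg (i : Fin I.numPaths) (j : ℕ) : 0 ≤ I.clear i j := by
  unfold clear
  split
  · rename_i h
    rw [sub_nonneg]
    have := I.spec_valid ⟨i, ⟨j, h⟩⟩
    cases ht : (I.spec ⟨i, ⟨j, h⟩⟩).table with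
    | nil => simp
    | cons q l => simpa [ht] using this.table_le_one q (by simp [ht])
  · exact zero_le_one

theorem pathProb_nonneg (i : Fin I.numPaths) (c : ℕ) : 0 ≤ I.pathProb i c :=
  Finset.prod_nonneg fun j _ => I.clear_nonneg i j

theorem pathProb_succ (i : Fin I.numPaths) (c : ℕ) :
    I.pathProb i (c + 1) = I.pathProb i c * I.clear i c := Finset.prod_range_succ _ _

/-- The first `c` edges of path `i` are open. -/
def PrefixOpen (i : Fin I.numPaths) (c : ℕ) (x : I.Edge → Bool) : Prop :=
  ∀ j (h : j < I.pathLength i), j < c → x ⟨i, ⟨j, h⟩⟩ = false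

/-- All edges of path `i` are open. -/
def PathOpen (i : Fin I.numPaths) (x : I.Edge → Bool) : Prop :=
  I.PrefixOpen i (I.pathLength i) x

theorem freeOf_prefixOpen (i : Fin I.numPaths) (c : ℕ) :
    I.FreeOf (I.tail i c) (I.PrefixOpen i c) := by
  intro x y hxy
  refine propext (forall_congr' fun j => forall_congr' fun h => imp_congr_right fun hj => ?_)
  rw [hxy _ fun h' => absurd (I.mem_tail.1 h').2 (not_le.2 hj)]

/-- An event that does not depend on path `i` is independent of the statuses on this path. -/
theorem pr_and_prefixOpen (i : Fin I.numPaths) {A : (I.Edge → Bool) → Prop}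
    (hA : I.FreeOf (I.tail i 0) A) : ∀ {c : ℕ}, c ≤ I.pathLength i →
      I.pr (fun x => A x ∧ I.PrefixOpen i c x) = I.pathProb i c * I.pr A := by
  intro c
  induction c with
  | zero => intro _; simp [pathProb, PrefixOpen]
  | succ c ih =>
    intro hc
    have h := I.pr_and_open i (c := c) hc (A := fun x => A x ∧ I.PrefixOpen i c x)
      (fun x y hxy => congrArg₂ And (hA.mono (I.tail_anti i (Nat.zero_le c)) x y hxy)
        (I.freeOf_prefixOpen i c x y hxy))
      (fun x hx => hx.2)
    rw [ih (by omega)] at h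
    rw [pathProb_succ, mul_right_comm, mul_comm _ (I.clear i c), ← h]
    congr 1
    funext x
    refine propext ⟨fun hx => ⟨⟨hx.1, fun j h hj => hx.2 j h (by omega)⟩, hx.2 c hc (by omega)⟩,
      fun hx => ⟨hx.1.1, fun j h hj => ?_⟩⟩
    rcases Nat.lt_succ_iff_lt_or_eq.1 hj with h' | h'
    · exact hx.1.2 j h h'
    · subst h'; exact hx.2

theorem pr_nonneg (A : (I.Edge → Bool) → Prop) : 0 ≤ I.pr A := by
  classical
  exact Finset.sum_nonneg fun x _ => by split <;> [exact I.prob_nonneg x; exact le_rfl]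

theorem pr_mono {A B : (I.Edge → Bool) → Prop} (h : ∀ x, 0 < I.prob x → A x → B x) :
    I.pr A ≤ I.pr B := by
  classical
  refine Finset.sum_le_sum fun x _ => ?_
  by_cases hx : 0 < I.prob x
  · by_cases hA : A x
    · simp [hA, h x hx hA]
    · simp only [hA, if_false]
      split <;> [exact I.prob_nonneg x; exact le_rfl]
  · have : I.prob x = 0 := le_antisymm (not_lt.1 hx) (I.prob_nonneg x)
    simp [this]

theorem pr_and_add_pr_and_not (A B : (I.Edge → Bool) → Prop) :
    I.pr (fun x => A x ∧ B x) + I.pr (fun x => A x ∧ ¬ B x) = I.pr A := by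
  classical
  unfold pr
  rw [← Finset.sum_add_distrib]
  refine Finset.sum_congr rfl fun x _ => ?_
  by_cases hA : A x <;> by_cases hB : B x <;> simp [hA, hB]

end CTPForDep

namespace CTPForDep

variable (I : CTPForDep)

/-! ### Walking on the paths -/

theorem pathLength_pos (i : Fin I.numPaths) : 0 < I.pathLength i :=
  List.length_pos_of_ne_nil (I.path_ne_nil _ (List.getElem_mem _))

theorem pathVertex_eq_t_iff {i : Fin I.numPaths} {m : ℕ} (hm : m ≤ I.pathLength i) :
    I.pathVertex i m = Vertex.t ↔ m = I.pathLength i := by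
  have := I.pathLength_pos i
  cases m with
  | zero => simp only [pathVertex, reduceCtorEq, false_iff]; omega
  | succ m =>
    simp only [pathVertex]
    split
    · simp only [reduceCtorEq, false_iff]; omega
    · simp only [true_iff]; omega

theorem pathVertex_length (i : Fin I.numPaths) : I.pathVertex i (I.pathLength i) = Vertex.t :=
  (I.pathVertex_eq_t_iff le_rfl).2 rfl

/-- The paths are disjoint except for `s` and `t`. -/
theorem pathVertex_inj {i i' : Fin I.numPaths} {m m' : ℕ} (hm : m < I.pathLength i)
    (hm' : m' ≤ I.pathLength i') (h : I.pathVertex i m = I.pathVertex i' m') :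
    (m = 0 ∧ m' = 0) ∨ (i = i' ∧ m = m') := by
  rcases m with _ | m <;> rcases m' with _ | m'
  · simp
  · simp only [pathVertex] at h
    split at h <;> cases h
  · simp only [pathVertex] at h
    split at h <;> cases h
  · simp only [pathVertex] at h
    rw [dif_pos (by omega)] at h
    split at h
    · injection h with h1 h2
      subst h1
      simp only [heq_eq_eq, Fin.mk.injEq] at h2
      simp [h2]
    · cases h

theorem pathVertex_ne_succ (i : Fin I.numPaths) {m : ℕ} (hm : m < I.pathLength i) :
    I.pathVertex i m ≠ I.pathVertex i (m + 1) := fun h => by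
  rcases I.pathVertex_inj hm hm h with h | h <;> omega

/-- The weight of an edge as a real number. -/
def weight (e : I.Edge) : ℝ := ((I.spec e).weight : ℝ)

/-- The weight of edge `j` of path `i`. -/
def weightAt (i : Fin I.numPaths) (j : ℕ) : ℝ :=
  if h : j < I.pathLength i then I.weight ⟨i, ⟨j, h⟩⟩ else 0

/-- The weight of the first `c` edges of path `i`. -/
def prefixWeight (i : Fin I.numPaths) (c : ℕ) : ℝ := ∑ j ∈ Finset.range c, I.weightAt i j

theorem weight_nonneg (e : I.Edge) : 0 ≤ I.weight e := NNRat.cast_nonneg _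

theorem prefixWeight_succ (i : Fin I.numPaths) {m : ℕ} (hm : m < I.pathLength i) :
    I.prefixWeight i (m + 1) = I.prefixWeight i m + I.weight ⟨i, ⟨m, hm⟩⟩ := by
  rw [prefixWeight, Finset.sum_range_succ, ← prefixWeight, weightAt, dif_pos hm]

theorem stepCost_toReal (π : CTPPolicy I.Vertex I.Edge) {b : BeliefForm I.Vertex I.Edge}
    (h : I.toCTPDep.CanMove b (π b)) : (I.toCTPDep.stepCost π b).toReal = I.weight (π b) := by
  rw [CTPDep.stepCost, if_pos h]
  simp only [toCTPDep, weight, ENNReal.coe_toReal]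
  rfl

open Classical in
/-- A move from a vertex before `t` is a move forwards or backwards on some path. -/
theorem move_cases {i : Fin I.numPaths} {m : ℕ} (hm : m < I.pathLength i) {e : I.Edge}
    (he : I.toCTPDep.Incident e (I.pathVertex i m)) :
    ∃ (i' : Fin I.numPaths) (m' : ℕ), ((i' = i ∧ m' = m) ∨ (m = 0 ∧ m' = 0)) ∧
      ((∃ h : m' < I.pathLength i', e = ⟨i', ⟨m', h⟩⟩ ∧
          I.toCTPDep.otherEnd e (I.pathVertex i m) = I.pathVertex i' (m' + 1)) ∨
        (∃ (j : ℕ) (h : j < I.pathLength i'), j + 1 = m' ∧ e = ⟨i', ⟨j, h⟩⟩ ∧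
          I.toCTPDep.otherEnd e (I.pathVertex i m) = I.pathVertex i' j)) := by
  obtain ⟨i', ⟨j, hj⟩⟩ := e
  have hoe : I.toCTPDep.otherEnd ⟨i', ⟨j, hj⟩⟩ (I.pathVertex i m) =
      if I.pathVertex i m = I.pathVertex i' j then I.pathVertex i' (j + 1)
      else I.pathVertex i' j := rfl
  by_cases h1 : I.pathVertex i m = I.pathVertex i' j
  · refine ⟨i', j, ?_, Or.inl ⟨hj, rfl, ?_⟩⟩
    · rcases I.pathVertex_inj hm hj.le h1 with h | ⟨rfl, rfl⟩
      · exact Or.inr h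
      · exact Or.inl ⟨rfl, rfl⟩
    · rw [hoe, if_pos h1]
  · have h2 : I.pathVertex i m = I.pathVertex i' (j + 1) := he.resolve_left h1
    refine ⟨i', j + 1, ?_, Or.inr ⟨j, hj, rfl, rfl, ?_⟩⟩
    · rcases I.pathVertex_inj hm hj h2 with h | ⟨rfl, rfl⟩
      · exact Or.inr h
      · exact Or.inl ⟨rfl, rfl⟩
    · rw [hoe, if_neg h1]

/-- A record of the walk: the agent is at vertex `m` of path `i`, it has crossed the edges `R`
(among them all those of path `i` up to its location), and it has paid `c`. Every crossed edge,
apart from those between `s` and the location, has been crossed in both directions. -/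
structure Track (loc : I.Vertex) (R : Finset I.Edge) (c : ℝ) (i : Fin I.numPaths) (m : ℕ) :
    Prop where
  le_length : m ≤ I.pathLength i
  loc_eq : loc = I.pathVertex i m
  mem : ∀ j (h : j < I.pathLength i), j < m → (⟨i, ⟨j, h⟩⟩ : I.Edge) ∈ R
  le_cost : 2 * ∑ e ∈ R, I.weight e ≤ c + I.prefixWeight i m

/-- At `s` the agent may be regarded as being at the start of any path. -/
theorem Track.change {I : CTPForDep} {loc : I.Vertex} {R : Finset I.Edge} {c : ℝ}
    {i i' : Fin I.numPaths} {m m' : ℕ} (h : I.Track loc R c i m)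
    (hi : (i' = i ∧ m' = m) ∨ (m = 0 ∧ m' = 0)) : I.Track loc R c i' m' := by
  rcases hi with ⟨rfl, rfl⟩ | ⟨rfl, rfl⟩
  · exact h
  · exact ⟨Nat.zero_le _, h.loc_eq, fun j _ hj => absurd hj (Nat.not_lt_zero j),
      by simpa [prefixWeight] using h.le_cost⟩

theorem Track.lt_length {I : CTPForDep} {loc : I.Vertex} {R : Finset I.Edge} {c : ℝ}
    {i : Fin I.numPaths} {m : ℕ} (h : I.Track loc R c i m) (hloc : loc ≠ Vertex.t) :
    m < I.pathLength i :=
  lt_of_le_of_ne h.le_length fun hm => hloc (h.loc_eq.trans (hm ▸ I.pathVertex_length i))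

theorem Track.step {I : CTPForDep} {loc : I.Vertex} {R : Finset I.Edge} {c : ℝ}
    {i : Fin I.numPaths} {m : ℕ} (h : I.Track loc R c i m) (hloc : loc ≠ Vertex.t)
    {e : I.Edge} (he : I.toCTPDep.Incident e loc) :
    ∃ i' m', I.Track (I.toCTPDep.otherEnd e loc) (insert e R) (c + I.weight e) i' m' := by
  have hm := h.lt_length hloc
  have hl := h.loc_eq
  subst hl
  obtain ⟨i', m', hi, ⟨h', rfl, hoe⟩ | ⟨j, h', rfl, rfl, hoe⟩⟩ := I.move_cases hm he
  · have h := h.change hi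
    refine ⟨i', m' + 1, h', hoe, fun j hj hjm => ?_, ?_⟩
    · rcases Nat.lt_succ_iff_lt_or_eq.1 hjm with hjm | rfl
      · exact Finset.mem_insert_of_mem (h.mem j hj hjm)
      · exact Finset.mem_insert_self _ _
    · rw [I.prefixWeight_succ i' h']
      have h1 := h.le_cost
      have h2 : ∑ e ∈ insert (⟨i', ⟨m', h'⟩⟩ : I.Edge) R, I.weight e ≤
          I.weight ⟨i', ⟨m', h'⟩⟩ + ∑ e ∈ R, I.weight e := by
        by_cases hR : (⟨i', ⟨m', h'⟩⟩ : I.Edge) ∈ R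
        · rw [Finset.insert_eq_of_mem hR]
          linarith [I.weight_nonneg ⟨i', ⟨m', h'⟩⟩]
        · rw [Finset.sum_insert hR]
      linarith
  · have h := h.change hi
    have hR := h.mem j h' (Nat.lt_succ_self j)
    refine ⟨i', j, h'.le, hoe, fun l hl hlj => ?_, ?_⟩
    · exact Finset.mem_insert_of_mem (h.mem l hl (by omega))
    · rw [Finset.insert_eq_of_mem hR]
      have h1 := h.le_cost
      rw [I.prefixWeight_succ i' h'] at h1
      linarith

variable (π : CTPPolicy I.Vertex I.Edge) (x : I.Edge → Bool)

/-- Under the policy `π` the agent crosses `e` in step `n`. -/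
def CrossesAt (n : ℕ) (e : I.Edge) : Prop :=
  I.toCTPDep.CanMove (I.toCTPDep.trace π x n) (π (I.toCTPDep.trace π x n)) ∧
    π (I.toCTPDep.trace π x n) = e

/-- The target has not been visited up to time `n`. -/
def NotYet (n : ℕ) : Prop := ∀ k ≤ n, (I.toCTPDep.trace π x k).loc ≠ Vertex.t

/-- The agent crosses `e` before it visits the target. -/
def Crosses (e : I.Edge) : Prop := ∃ n, I.NotYet π x n ∧ I.CrossesAt π x n e

open Classical in
/-- The edges crossed in the first `n` steps. -/
def crossedEdges (n : ℕ) : Finset I.Edge :=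
  Finset.univ.filter fun e => ∃ k < n, I.CrossesAt π x k e

/-- The cost of the first `n` steps. -/
def costUpTo (n : ℕ) : ℝ :=
  ∑ k ∈ Finset.range n, (I.toCTPDep.stepCost π (I.toCTPDep.trace π x k)).toReal

variable {π x}

theorem trace_succ (n : ℕ) : I.toCTPDep.trace π x (n + 1) =
    I.toCTPDep.step π x (I.toCTPDep.trace π x n) := Function.iterate_succ_apply' _ _ _

theorem mem_crossedEdges {n : ℕ} {e : I.Edge} :
    e ∈ I.crossedEdges π x n ↔ ∃ k < n, I.CrossesAt π x k e := by
  simp [crossedEdges]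

theorem crossedEdges_succ_of_move {n : ℕ}
    (h : I.toCTPDep.CanMove (I.toCTPDep.trace π x n) (π (I.toCTPDep.trace π x n))) :
    I.crossedEdges π x (n + 1) =
      insert (π (I.toCTPDep.trace π x n)) (I.crossedEdges π x n) := by
  ext e
  simp only [mem_crossedEdges, Finset.mem_insert, Nat.lt_succ_iff_lt_or_eq, or_and_right,
    exists_or, exists_eq_left]
  rw [or_comm]
  refine or_congr_left ⟨fun h' => h'.2.symm, fun h' => ⟨h, h'.symm⟩⟩

theorem crossedEdges_succ_of_not_move {n : ℕ}
    (h : ¬ I.toCTPDep.CanMove (I.toCTPDep.trace π x n) (π (I.toCTPDep.trace π x n))) :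
    I.crossedEdges π x (n + 1) = I.crossedEdges π x n := by
  ext e
  simp only [mem_crossedEdges, Nat.lt_succ_iff_lt_or_eq, or_and_right,
    exists_or, exists_eq_left]
  refine or_iff_left fun h' => h h'.1

theorem exists_track (n : ℕ) (hn : ∀ k < n, (I.toCTPDep.trace π x k).loc ≠ Vertex.t) :
    ∃ i m, I.Track (I.toCTPDep.trace π x n).loc (I.crossedEdges π x n) (I.costUpTo π x n) i m := by
  induction n with
  | zero =>
    refine ⟨⟨0, List.length_pos_of_ne_nil I.paths_ne_nil⟩, 0, Nat.zero_le _, rfl,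
      fun j _ hj => absurd hj (Nat.not_lt_zero j), ?_⟩
    simp [crossedEdges, costUpTo, prefixWeight]
  | succ n ih =>
    obtain ⟨i, m, h⟩ := ih fun k hk => hn k (by omega)
    have hcost : I.costUpTo π x (n + 1) = I.costUpTo π x n +
        (I.toCTPDep.stepCost π (I.toCTPDep.trace π x n)).toReal := Finset.sum_range_succ _ _
    by_cases hmove : I.toCTPDep.CanMove (I.toCTPDep.trace π x n) (π (I.toCTPDep.trace π x n))
    · rw [I.crossedEdges_succ_of_move hmove, hcost, I.stepCost_toReal π hmove, trace_succ,
        CTPDep.step, if_pos hmove]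
      exact h.step (hn n (Nat.lt_succ_self n)) hmove.1
    · rw [I.crossedEdges_succ_of_not_move hmove, hcost, trace_succ, CTPDep.step, if_neg hmove,
        CTPDep.stepCost, if_neg hmove]
      exact ⟨i, m, by simpa using h⟩

theorem NotYet.mono {I : CTPForDep} {π : CTPPolicy I.Vertex I.Edge} {x : I.Edge → Bool}
    {n k : ℕ} (h : I.NotYet π x n) (hk : k ≤ n) : I.NotYet π x k := fun l hl => h l (hl.trans hk)

theorem crosses_of_mem {n : ℕ} (hn : ∀ k < n, (I.toCTPDep.trace π x k).loc ≠ Vertex.t)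
    {e : I.Edge} (he : e ∈ I.crossedEdges π x n) : I.Crosses π x e := by
  obtain ⟨k, hk, h⟩ := I.mem_crossedEdges.1 he
  exact ⟨k, fun l hl => hn l (by omega), h⟩

/-- What the agent knows is true. -/
theorem status_trace (n : ℕ) (e : I.Edge) :
    ((I.toCTPDep.trace π x n).status e = EdgeKnowledge.isOpen → x e = false) ∧
      ((I.toCTPDep.trace π x n).status e = EdgeKnowledge.isBlocked → x e = true) := by
  have harr : ∀ v (st : I.Edge → EdgeKnowledge),
      ((st e = EdgeKnowledge.isOpen → x e = false) ∧
        (st e = EdgeKnowledge.isBlocked → x e = true)) →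
      (((I.toCTPDep.arrive x v st).status e = EdgeKnowledge.isOpen → x e = false) ∧
        ((I.toCTPDep.arrive x v st).status e = EdgeKnowledge.isBlocked → x e = true)) := by
    intro v st h
    simp only [CTPDep.arrive]
    by_cases h1 : I.toCTPDep.Incident e v
    · cases hx : x e <;> simp [h1]
    · simpa only [h1, if_false] using h
  induction n with
  | zero => exact harr _ _ (by simp)
  | succ n ih =>
    rw [trace_succ, CTPDep.step]
    split
    · exact harr _ _ ih
    · exact ih

theorem Crosses.isOpen {I : CTPForDep} {π : CTPPolicy I.Vertex I.Edge} {x : I.Edge → Bool}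
    {e : I.Edge} (h : I.Crosses π x e) : x e = false := by
  obtain ⟨n, -, h1, rfl⟩ := h
  exact (I.status_trace n _).1 h1.2

/-- An edge is crossed only after the previous edge of the path. -/
theorem Crosses.prev {I : CTPForDep} {π : CTPPolicy I.Vertex I.Edge} {x : I.Edge → Bool}
    {i : Fin I.numPaths} {j : ℕ} {hj : j + 1 < I.pathLength i}
    (h : I.Crosses π x ⟨i, ⟨j + 1, hj⟩⟩) : I.Crosses π x ⟨i, ⟨j, by omega⟩⟩ := by
  obtain ⟨n, hn, h1, h2⟩ := h
  have hn' : ∀ k < n, (I.toCTPDep.trace π x k).loc ≠ Vertex.t := fun k hk => hn k hk.le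
  obtain ⟨i', m, ht⟩ := I.exists_track n hn'
  have hm := ht.lt_length (hn n le_rfl)
  have hi := h1.1
  rw [h2, ht.loc_eq] at hi
  refine I.crosses_of_mem hn' ?_
  obtain ⟨i'', m', hi', ⟨h', he, hoe⟩ | ⟨j', h', rfl, he, hoe⟩⟩ := I.move_cases hm hi
  · obtain rfl : i = i'' := congrArg Sigma.fst he
    simp only [Sigma.mk.injEq, heq_eq_eq, Fin.mk.injEq, true_and] at he
    exact (ht.change hi').mem j _ (by omega)
  · obtain rfl : i = i'' := congrArg Sigma.fst he
    simp only [Sigma.mk.injEq, heq_eq_eq, Fin.mk.injEq, true_and] at he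
    exact (ht.change hi').mem j _ (by omega)

theorem Crosses.prefixOpen {I : CTPForDep} {π : CTPPolicy I.Vertex I.Edge} {x : I.Edge → Bool}
    {i : Fin I.numPaths} {j : ℕ} {hj : j < I.pathLength i}
    (h : I.Crosses π x ⟨i, ⟨j, hj⟩⟩) : I.PrefixOpen i (j + 1) x := by
  induction j with
  | zero =>
    intro l hl hlj
    obtain rfl : l = 0 := by omega
    exact h.isOpen
  | succ j ih =>
    intro l hl hlj
    rcases Nat.lt_succ_iff_lt_or_eq.1 hlj with hlj | rfl
    · exact ih h.prev l hl hlj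
    · exact h.isOpen

/-- As long as the agent has neither crossed edge `j` of path `i` nor visited the target, it has
seen no later edge of this path. -/
theorem trace_congr {y : I.Edge → Bool} {i : Fin I.numPaths} {j : ℕ} (hj : j < I.pathLength i)
    (hxy : ∀ e, e ∉ I.tail i (j + 1) → x e = y e) (n : ℕ) (hn : I.NotYet π x n)
    (hc : (⟨i, ⟨j, hj⟩⟩ : I.Edge) ∉ I.crossedEdges π x n) :
    I.toCTPDep.trace π x n = I.toCTPDep.trace π y n := by
  -- What is revealed at a vertex does not depend on the tail, if the vertex is not behind edge `j`.
  have harr : ∀ (i' : Fin I.numPaths) (m : ℕ) (st : I.Edge → EdgeKnowledge),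
      m < I.pathLength i' → (i' = i → m ≤ j) →
      I.toCTPDep.arrive x (I.pathVertex i' m) st = I.toCTPDep.arrive y (I.pathVertex i' m) st := by
    intro i' m st hm hmj
    unfold CTPDep.arrive
    congr 1
    funext e
    by_cases he : I.toCTPDep.Incident e (I.pathVertex i' m)
    · rw [if_pos he, if_pos he, hxy e]
      intro het
      obtain ⟨rfl, hje⟩ := I.mem_tail.1 het
      obtain ⟨i'', m', hi', ⟨h', he, hoe⟩ | ⟨j', h', rfl, he, hoe⟩⟩ := I.move_cases hm he
      · subst he
        rcases hi' with ⟨rfl, rfl⟩ | ⟨rfl, rfl⟩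
        · have := hmj rfl
          simp only at hje; omega
        · simp at hje
      · subst he
        rcases hi' with ⟨rfl, rfl⟩ | ⟨rfl, h0⟩
        · have := hmj rfl
          simp only at hje; omega
        · omega
    · rw [if_neg he, if_neg he]
  induction n with
  | zero =>
    exact harr i 0 _ (by omega) (by omega)
  | succ n ih =>
    have hsub : I.crossedEdges π x n ⊆ I.crossedEdges π x (n + 1) := fun e he => by
      obtain ⟨k, hk, h⟩ := I.mem_crossedEdges.1 he
      exact I.mem_crossedEdges.2 ⟨k, by omega, h⟩
    have ih := ih (hn.mono (Nat.le_succ n)) fun h => hc (hsub h)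
    obtain ⟨i', m, ht⟩ := I.exists_track (n + 1) fun k hk => hn k hk.le
    have hm := ht.lt_length (hn _ le_rfl)
    have hmj : i' = i → m ≤ j := by
      rintro rfl
      by_contra hmj
      exact hc (ht.mem j hj (by omega))
    have hloc := ht.loc_eq
    rw [trace_succ, trace_succ, ← ih]
    rw [trace_succ] at hloc
    unfold CTPDep.step at hloc ⊢
    split
    · rename_i h
      rw [if_pos h] at hloc
      change I.toCTPDep.otherEnd _ _ = _ at hloc
      rw [hloc]
      exact harr i' m _ hm hmj
    · rfl

/-- Whether the agent crosses edge `j` of path `i` does not depend on the later edges of this path.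
-/
theorem Crosses.congr {I : CTPForDep} {π : CTPPolicy I.Vertex I.Edge} {x y : I.Edge → Bool}
    {i : Fin I.numPaths} {j : ℕ} {hj : j < I.pathLength i}
    (hxy : ∀ e, e ∉ I.tail i (j + 1) → x e = y e) (h : I.Crosses π x ⟨i, ⟨j, hj⟩⟩) :
    I.Crosses π y ⟨i, ⟨j, hj⟩⟩ := by
  classical
  have hex : ∃ n, I.NotYet π x n ∧ I.CrossesAt π x n ⟨i, ⟨j, hj⟩⟩ := h
  obtain ⟨hn, hcr⟩ := Nat.find_spec hex
  set n := Nat.find hex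
  -- The traces coincide up to the first crossing.
  have htr : ∀ k ≤ n, I.toCTPDep.trace π x k = I.toCTPDep.trace π y k := fun k hk => by
    refine I.trace_congr hj hxy k (hn.mono hk) fun hmem => ?_
    obtain ⟨l, hl, h'⟩ := I.mem_crossedEdges.1 hmem
    exact Nat.find_min hex (lt_of_lt_of_le hl hk) ⟨hn.mono (by omega), h'⟩
  refine ⟨n, fun k hk => ?_, ?_⟩
  · rw [← htr k hk]; exact hn k hk
  · unfold CrossesAt at hcr ⊢
    rwa [← htr n le_rfl]

theorem freeOf_crosses (i : Fin I.numPaths) {j : ℕ} (hj : j < I.pathLength i) :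
    I.FreeOf (I.tail i (j + 1)) fun x => I.Crosses π x ⟨i, ⟨j, hj⟩⟩ := fun _ _ hxy =>
  propext ⟨fun h => h.congr hxy, fun h => h.congr fun e he => (hxy e he).symm⟩

variable (π)

/-- Whatever made the agent cross edge `j`, it has no information on the rest of the path, so that
it finds the next edge open with the conditional probability. -/
theorem pr_crosses_succ_le (i : Fin I.numPaths) {j : ℕ} (hj : j + 1 < I.pathLength i) :
    I.pr (fun x => I.Crosses π x ⟨i, ⟨j + 1, hj⟩⟩) ≤
      I.clear i (j + 1) * I.pr (fun x => I.Crosses π x ⟨i, ⟨j, by omega⟩⟩) := by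
  rw [← I.pr_and_open i hj (I.freeOf_crosses i (by omega)) fun x hx => hx.prefixOpen]
  exact I.pr_mono fun x _ h => ⟨h.prev, h.isOpen⟩

/-- The last edge of a path is crossed with at most the probability of crossing edge `j`, times
the conditional probability that the rest of the path is open. -/
theorem pr_crosses_last_le (i : Fin I.numPaths) (k : ℕ) : ∀ {j : ℕ} (hj : j < I.pathLength i)
    (hjk : j + k < I.pathLength i),
    I.pr (fun x => I.Crosses π x ⟨i, ⟨j + k, hjk⟩⟩) * I.pathProb i (j + 1) ≤
      I.pr (fun x => I.Crosses π x ⟨i, ⟨j, hj⟩⟩) * I.pathProb i (j + k + 1) := by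
  induction k with
  | zero => intro j hj hjk; exact le_rfl
  | succ k ih =>
    intro j hj hjk
    have h1 := ih hj (by omega)
    have h2 := I.pr_crosses_succ_le π i (j := j + k) hjk
    have h3 := I.clear_nonneg i (j + k + 1)
    have h4 := I.pathProb_nonneg i (j + 1)
    calc I.pr (fun x => I.Crosses π x ⟨i, ⟨j + (k + 1), hjk⟩⟩) * I.pathProb i (j + 1)
        ≤ (I.clear i (j + k + 1) * I.pr (fun x => I.Crosses π x ⟨i, ⟨j + k, by omega⟩⟩)) *
            I.pathProb i (j + 1) := mul_le_mul_of_nonneg_right h2 h4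
      _ = I.clear i (j + k + 1) * (I.pr (fun x => I.Crosses π x ⟨i, ⟨j + k, by omega⟩⟩) *
            I.pathProb i (j + 1)) := by ring
      _ ≤ I.clear i (j + k + 1) * (I.pr (fun x => I.Crosses π x ⟨i, ⟨j, hj⟩⟩) *
            I.pathProb i (j + k + 1)) := mul_le_mul_of_nonneg_left h1 h3
      _ = I.pr (fun x => I.Crosses π x ⟨i, ⟨j, hj⟩⟩) * I.pathProb i (j + (k + 1) + 1) := by
        rw [← add_assoc, I.pathProb_succ i (j + k + 1)]; ring

/-- A walk that reaches the target does so on an open path. Its cost, and the weight of this path,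
pay twice for each crossed edge. -/
theorem exists_finish (x : I.Edge → Bool) (h : I.toCTPDep.travelCost π x ≠ ⊤) :
    ∃ (c : ℝ) (i : Fin I.numPaths), 0 ≤ c ∧ ENNReal.ofReal c ≤ I.toCTPDep.travelCost π x ∧
      I.PathOpen i x ∧ (∀ j (hj : j < I.pathLength i), I.Crosses π x ⟨i, ⟨j, hj⟩⟩) ∧
      ∀ R : Finset I.Edge, (∀ e ∈ R, I.Crosses π x e) →
        2 * ∑ e ∈ R, I.weight e ≤ c + I.prefixWeight i (I.pathLength i) := by
  classical
  have hex : ∃ n, (I.toCTPDep.trace π x n).loc = Vertex.t := by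
    by_contra hno
    push Not at hno
    refine h ?_
    simp only [CTPDep.travelCost]
    refine iInf_eq_top.2 fun n => iInf_eq_top.2 fun hn => absurd hn (hno n)
  have hn := Nat.find_spec hex
  have hmin := fun k hk => Nat.find_min hex (m := k) hk
  set n := Nat.find hex
  obtain ⟨i, m, ht⟩ := I.exists_track n hmin
  have hm : m = I.pathLength i := by
    rw [← I.pathVertex_eq_t_iff ht.le_length, ← ht.loc_eq, hn]
  have hcr : ∀ j (hj : j < I.pathLength i), I.Crosses π x ⟨i, ⟨j, hj⟩⟩ := fun j hj =>
    I.crosses_of_mem hmin (ht.mem j hj (hm ▸ hj))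
  have htop : ∀ b, I.toCTPDep.stepCost π b ≠ ⊤ := fun b => by
    unfold CTPDep.stepCost; split <;> simp
  refine ⟨I.costUpTo π x n, i, Finset.sum_nonneg fun k _ => ENNReal.toReal_nonneg, ?_,
    fun j hj _ => (hcr j hj).isOpen, hcr, fun R hR => ?_⟩
  · rw [costUpTo, ← ENNReal.toReal_sum fun k _ => htop _,
      ENNReal.ofReal_toReal (ENNReal.sum_ne_top.2 fun k _ => htop _)]
    refine le_iInf fun l => le_iInf fun hl => ?_
    refine Finset.sum_le_sum_of_subset fun k hk => ?_
    have : n ≤ l := Nat.find_min' hex hl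
    simp only [Finset.mem_range] at hk ⊢
    omega
  · have h1 := ht.le_cost
    rw [hm] at h1
    refine le_trans (mul_le_mul_of_nonneg_left ?_ zero_le_two) h1
    refine Finset.sum_le_sum_of_subset_of_nonneg (fun e he => ?_) fun e _ _ => I.weight_nonneg e
    obtain ⟨k, hk, h'⟩ := hR e he
    refine I.mem_crossedEdges.2 ⟨k, ?_, h'⟩
    by_contra hkn
    exact hk n (by omega) hn

end CTPForDep

namespace CTPForDep

variable (I : CTPForDep)

/-! ### The index of a path and the lower bound -/

/-- The probability that path `i` is open. -/
def openProb (i : Fin I.numPaths) : ℝ := I.pathProb i (I.pathLength i)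

/-- The weight of path `i`. -/
def pathWeight (i : Fin I.numPaths) : ℝ := I.prefixWeight i (I.pathLength i)

/-- The expected weight of the open edges of path `i` before the first blocked one. -/
def expectedReach (i : Fin I.numPaths) : ℝ :=
  ∑ j ∈ Finset.range (I.pathLength i), I.pathProb i (j + 1) * I.weightAt i j

/-- The index of a path: the expected cost of trying it (that is, walking along it until `t` is
reached, or until a blocked edge forces the agent to return to `s`), divided by the probability of
success. It is used for paths with positive success probability only. -/
def index (i : Fin I.numPaths) : ℝ :=
  (2 * I.expectedReach i - I.openProb i * I.pathWeight i) / I.openProb i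

/-- Path `i` comes before path `j` in the order of indices, ties being broken by the number. -/
def Before (i j : Fin I.numPaths) : Prop := I.index i < I.index j ∨ (I.index i = I.index j ∧ i ≤ j)

theorem Before.refl (i : Fin I.numPaths) : I.Before i i := Or.inr ⟨rfl, le_rfl⟩

theorem Before.index_le {I : CTPForDep} {i j : Fin I.numPaths} (h : I.Before i j) :
    I.index i ≤ I.index j := h.elim le_of_lt fun h => h.1.le

theorem Before.antisymm {I : CTPForDep} {i j : Fin I.numPaths} (h : I.Before i j)
    (h' : I.Before j i) : i = j := by
  rcases h with h | ⟨h, hij⟩ <;> rcases h' with h' | ⟨h', hji⟩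
  · exact absurd h h'.not_gt
  · exact absurd h'.symm h.ne
  · exact absurd h.symm h'.ne
  · exact le_antisymm hij hji

/-- `i` is the first path in the order of indices that satisfies `T`. -/
def IsBest (T : Fin I.numPaths → Prop) (i : Fin I.numPaths) : Prop :=
  T i ∧ ∀ j, T j → I.Before i j

theorem exists_isBest {T : Fin I.numPaths → Prop} {i : Fin I.numPaths} (hi : T i) :
    ∃ b, I.IsBest T b := by
  classical
  obtain ⟨b, hb, hmin⟩ := (Finset.univ.filter T).exists_min_image
    (fun i => toLex (I.index i, i)) ⟨i, by simpa using hi⟩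
  refine ⟨b, by simpa using hb, fun j hj => ?_⟩
  have := hmin j (by simpa using hj)
  simpa [Before, Prod.Lex.le_iff] using this

/-- Path `i` has a positive success probability, and no open path comes before it. The statuses of
the edges of path `i` itself do not matter. -/
def Unbeaten (i : Fin I.numPaths) (x : I.Edge → Bool) : Prop :=
  I.openProb i ≠ 0 ∧ ∀ j, I.openProb j ≠ 0 → I.PathOpen j x → I.Before i j

/-- Path `i` is the first open path in the order of indices. -/
def IsFirst (i : Fin I.numPaths) (x : I.Edge → Bool) : Prop := I.Unbeaten i x ∧ I.PathOpen i x

theorem IsFirst.unique {I : CTPForDep} {i j : Fin I.numPaths} {x : I.Edge → Bool}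
    (hi : I.IsFirst i x) (hj : I.IsFirst j x) : i = j :=
  (hi.1.2 j hj.1.1 hj.2).antisymm (hj.1.2 i hi.1.1 hi.2)

theorem exists_isFirst {i : Fin I.numPaths} {x : I.Edge → Bool} (hi : I.openProb i ≠ 0)
    (hx : I.PathOpen i x) : ∃ b, I.IsFirst b x := by
  obtain ⟨b, hb, h⟩ := I.exists_isBest (T := fun i => I.openProb i ≠ 0 ∧ I.PathOpen i x) ⟨hi, hx⟩
  exact ⟨b, ⟨hb.1, fun j h1 h2 => h j ⟨h1, h2⟩⟩, hb.2⟩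

/-- The expected index of the first open path. -/
def value : ℝ := ∑ i, I.index i * I.pr (I.IsFirst i)

theorem pr_pathOpen (i : Fin I.numPaths) : I.pr (I.PathOpen i) = I.openProb i := by
  have := I.pr_and_prefixOpen i (A := fun _ => True) (fun _ _ _ => rfl) le_rfl
  simp only [true_and, pr_true, mul_one] at this
  exact this

theorem openProb_nonneg (i : Fin I.numPaths) : 0 ≤ I.openProb i := I.pathProb_nonneg i _

theorem prob_le_pr {A : (I.Edge → Bool) → Prop} {x : I.Edge → Bool} (h : A x) :
    I.prob x ≤ I.pr A := by
  classical
  have := Finset.single_le_sum (f := fun x => if A x then I.prob x else 0)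
    (fun y _ => by split <;> [exact I.prob_nonneg y; exact le_rfl]) (Finset.mem_univ x)
  simpa [pr, h] using this

theorem openProb_ne_zero {i : Fin I.numPaths} {x : I.Edge → Bool} (hx : 0 < I.prob x)
    (h : I.PathOpen i x) : I.openProb i ≠ 0 := by
  have := I.prob_le_pr h
  rw [pr_pathOpen] at this
  exact (hx.trans_le this).ne'

open Classical in
theorem sum_mul_ite (a : ℝ) (A : (I.Edge → Bool) → Prop) :
    ∑ x, I.prob x * (if A x then a else 0) = a * I.pr A := by
  rw [pr, Finset.mul_sum]
  refine Finset.sum_congr rfl fun x _ => ?_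
  split <;> ring

/-- The expectation of a function of the random variable `f`. -/
theorem sum_mul_pr_eq (f : (I.Edge → Bool) → Fin I.numPaths) (g : Fin I.numPaths → ℝ) :
    ∑ i, g i * I.pr (fun x => f x = i) = ∑ x, I.prob x * g (f x) := by
  classical
  simp_rw [← I.sum_mul_ite]
  rw [Finset.sum_comm]
  refine Finset.sum_congr rfl fun x _ => ?_
  rw [← Finset.mul_sum]
  congr 1
  exact (Finset.sum_eq_single (f x) (fun i _ hi => if_neg (Ne.symm hi))
    (fun h => absurd (Finset.mem_univ _) h)).trans (if_pos rfl)

open Classical in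
theorem value_eq_sum : I.value = ∑ x, I.prob x * ∑ i, if I.IsFirst i x then I.index i else 0 := by
  simp_rw [Finset.mul_sum]
  rw [Finset.sum_comm]
  simp_rw [I.sum_mul_ite]
  rfl

theorem travelCost_eq_top (π : CTPPolicy I.Vertex I.Edge) {x : I.Edge → Bool}
    (h : ∀ i, ¬ I.PathOpen i x) : I.toCTPDep.travelCost π x = ⊤ := by
  by_contra hne
  obtain ⟨c, i, -, -, hi, -⟩ := I.exists_finish π x hne
  exact h i hi

/-- If it can happen that no path is open, the expected cost is infinite. -/
theorem expectedCost_eq_top (π : CTPPolicy I.Vertex I.Edge)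
    (h : I.pr (fun x => ∀ i, I.openProb i ≠ 0 → ¬ I.PathOpen i x) ≠ 0) :
    I.toCTPDep.expectedCost π = ⊤ := by
  classical
  obtain ⟨x, -, hx⟩ := Finset.exists_ne_zero_of_sum_ne_zero h
  have hx' : (∀ i, I.openProb i ≠ 0 → ¬ I.PathOpen i x) ∧ I.prob x ≠ 0 := by
    by_cases hA : ∀ i, I.openProb i ≠ 0 → ¬ I.PathOpen i x
    · exact ⟨hA, by rwa [if_pos hA] at hx⟩
    · rw [if_neg hA] at hx; exact absurd rfl hx
  have hpos : 0 < I.prob x := lt_of_le_of_ne (I.prob_nonneg x) hx'.2.symm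
  refine ENNReal.sum_eq_top.2 ⟨x, Finset.mem_univ x, ?_⟩
  rw [I.travelCost_eq_top π fun i hi => hx'.1 i (I.openProb_ne_zero hpos hi) hi, jointProb_eq]
  exact ENNReal.mul_top (by simpa using hpos)

/-- The amount that a policy pays on path `i`, less the weight of this path if it finishes there,
is at least the index times the probability of finishing there. -/
theorem pr_mul_index_le (π : CTPPolicy I.Vertex I.Edge) (i : Fin I.numPaths)
    (A : (I.Edge → Bool) → Prop) (hA : ∀ x, 0 < I.prob x → A x →
      ∀ j (hj : j < I.pathLength i), I.Crosses π x ⟨i, ⟨j, hj⟩⟩) :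
    I.index i * I.pr A + I.pathWeight i * I.pr A ≤
      2 * ∑ j : Fin (I.pathLength i), I.weight ⟨i, j⟩ * I.pr (fun x => I.Crosses π x ⟨i, j⟩) := by
  have hlen := I.pathLength_pos i
  by_cases hS : I.openProb i = 0
  · have : I.pr A = 0 := by
      refine le_antisymm ?_ (I.pr_nonneg A)
      rw [← hS, ← pr_pathOpen]
      exact I.pr_mono fun x hx h j hj _ => (hA x hx h j hj).isOpen
    rw [this, mul_zero, mul_zero, add_zero]
    exact mul_nonneg zero_le_two (Finset.sum_nonneg fun j _ =>
      mul_nonneg (I.weight_nonneg _) (I.pr_nonneg _))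
  · have hS' : 0 < I.openProb i := lt_of_le_of_ne (I.openProb_nonneg i) (Ne.symm hS)
    have h1 : I.index i * I.pr A + I.pathWeight i * I.pr A =
        2 * ∑ j ∈ Finset.range (I.pathLength i),
          I.pr A * I.pathProb i (j + 1) / I.openProb i * I.weightAt i j := by
      have : ∑ j ∈ Finset.range (I.pathLength i),
          I.pr A * I.pathProb i (j + 1) / I.openProb i * I.weightAt i j =
          I.pr A / I.openProb i * I.expectedReach i := by
        rw [expectedReach, Finset.mul_sum]
        refine Finset.sum_congr rfl fun j _ => by ring
      rw [this, index]
      field_simp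
      ring
    rw [h1, Finset.sum_range]
    refine mul_le_mul_of_nonneg_left (Finset.sum_le_sum fun j _ => ?_) zero_le_two
    rw [weightAt, dif_pos j.2, mul_comm]
    refine mul_le_mul_of_nonneg_left ?_ (I.weight_nonneg _)
    rw [div_le_iff₀ hS']
    -- Where the whole path is crossed, its last edge is crossed.
    obtain ⟨k, hk⟩ : ∃ k, (j : ℕ) + k + 1 = I.pathLength i :=
      ⟨I.pathLength i - j - 1, by omega⟩
    have h2 := I.pr_crosses_last_le π i k j.2 (by omega)
    rw [hk] at h2
    refine le_trans (mul_le_mul_of_nonneg_right ?_ (I.pathProb_nonneg i _)) h2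
    exact I.pr_mono fun x hx h => hA x hx h _ _

/-- No policy is better than `value`: it pays in expectation at least the index of the path on which
it finishes, and this path is open, so that its index is at least that of the first open path. -/
theorem value_le_expectedCost (π : CTPPolicy I.Vertex I.Edge) :
    ENNReal.ofReal I.value ≤ I.toCTPDep.expectedCost π := by
  classical
  by_cases htop : I.toCTPDep.expectedCost π = ⊤
  · rw [htop]; exact le_top
  have hfin : ∀ x, 0 < I.prob x → I.toCTPDep.travelCost π x ≠ ⊤ := fun x hx h => by
    refine htop (ENNReal.sum_eq_top.2 ⟨x, Finset.mem_univ x, ?_⟩)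
    rw [h, jointProb_eq]
    exact ENNReal.mul_top (by simpa using hx)
  have i₀ : Fin I.numPaths := ⟨0, List.length_pos_of_ne_nil I.paths_ne_nil⟩
  have hex : ∀ x, ∃ (c : ℝ) (i : Fin I.numPaths), 0 ≤ c ∧ (0 < I.prob x →
      ENNReal.ofReal c ≤ I.toCTPDep.travelCost π x ∧ I.PathOpen i x ∧
      (∀ j (hj : j < I.pathLength i), I.Crosses π x ⟨i, ⟨j, hj⟩⟩) ∧
      ∀ R : Finset I.Edge, (∀ e ∈ R, I.Crosses π x e) →
        2 * ∑ e ∈ R, I.weight e ≤ c + I.prefixWeight i (I.pathLength i)) := fun x => by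
    by_cases hx : 0 < I.prob x
    · obtain ⟨c, i, hc, h⟩ := I.exists_finish π x (hfin x hx)
      exact ⟨c, i, hc, fun _ => h⟩
    · exact ⟨0, i₀, le_rfl, fun h => absurd h hx⟩
  choose c f hc h using hex
  have hcost : ENNReal.ofReal (∑ x, I.prob x * c x) ≤ I.toCTPDep.expectedCost π := by
    rw [ENNReal.ofReal_sum_of_nonneg fun x _ => mul_nonneg (I.prob_nonneg x) (hc x)]
    refine Finset.sum_le_sum fun x _ => ?_
    rw [ENNReal.ofReal_mul (I.prob_nonneg x), jointProb_eq]
    rcases (I.prob_nonneg x).eq_or_lt with h0 | hx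
    · simp [← h0]
    · exact mul_le_mul_right (h x hx).1 _
  refine le_trans (ENNReal.ofReal_le_ofReal ?_) hcost
  -- The crossed edges are paid for twice.
  have h1 : 2 * ∑ e, I.weight e * I.pr (fun x => I.Crosses π x e) ≤
      ∑ x, I.prob x * c x + ∑ i, I.pathWeight i * I.pr (fun x => f x = i) := by
    have e1 : ∑ i, I.pathWeight i * I.pr (fun x => f x = i) =
        ∑ x, I.prob x * I.pathWeight (f x) := I.sum_mul_pr_eq f _
    have e2 : ∑ e, I.weight e * I.pr (fun x => I.Crosses π x e) =
        ∑ x, I.prob x * ∑ e ∈ Finset.univ.filter (fun e => I.Crosses π x e), I.weight e := by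
      simp_rw [← I.sum_mul_ite]
      rw [Finset.sum_comm]
      refine Finset.sum_congr rfl fun x _ => ?_
      rw [← Finset.mul_sum, Finset.sum_filter]
    rw [e1, e2, Finset.mul_sum, ← Finset.sum_add_distrib]
    refine Finset.sum_le_sum fun x _ => ?_
    rw [mul_left_comm, ← mul_add]
    rcases (I.prob_nonneg x).eq_or_lt with h0 | hx
    · simp [← h0]
    · refine mul_le_mul_of_nonneg_left ((h x hx).2.2.2 _ fun e he => ?_) hx.le
      simpa using he
  have h2 : ∑ i, I.index i * I.pr (fun x => f x = i) ≤ ∑ x, I.prob x * c x := by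
    have h3 := Finset.sum_le_sum fun i (_ : i ∈ Finset.univ) =>
      I.pr_mul_index_le π i (fun x => f x = i) fun x hx hfx => hfx ▸ (h x hx).2.2.1
    rw [Finset.sum_add_distrib, ← Finset.mul_sum, ← Fintype.sum_sigma'] at h3
    have h4 := h3.trans h1
    linarith
  refine le_trans ?_ h2
  -- The index of the open path on which the walk ends is at least that of the first open path.
  rw [I.sum_mul_pr_eq f, value_eq_sum]
  refine Finset.sum_le_sum fun x _ => ?_
  rcases (I.prob_nonneg x).eq_or_lt with h0 | hx
  · simp [← h0]
  · refine mul_le_mul_of_nonneg_left ?_ hx.le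
    have hopen := (h x hx).2.1
    have hne := I.openProb_ne_zero hx hopen
    obtain ⟨b, hb⟩ := I.exists_isFirst hne hopen
    rw [Finset.sum_eq_single b (fun i _ hib => if_neg fun hi => hib (hi.unique hb))
      (fun h => absurd (Finset.mem_univ b) h), if_pos hb]
    exact (hb.1.2 _ hne hopen).index_le

end CTPForDep

namespace CTPForDep

variable (I : CTPForDep)

/-! ### Committing policies -/

/-- Path `i` may be open according to the knowledge of the agent. -/
def Promising (b : BeliefForm I.Vertex I.Edge) (i : Fin I.numPaths) : Prop :=
  I.openProb i ≠ 0 ∧ ∀ j, b.status ⟨i, j⟩ ≠ EdgeKnowledge.isBlocked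

/-- The policy enters the promising path with the least index, and walks on until it reaches `t` or
sees a blocked edge, in which case it returns to `s`. -/
structure Committing (π : CTPPolicy I.Vertex I.Edge) : Prop where
  start : ∀ b i, b.loc = Vertex.s → I.IsBest (I.Promising b) i →
    π b = ⟨i, ⟨0, I.pathLength_pos i⟩⟩
  forward : ∀ b i j, b.loc = Vertex.inner i j → I.Promising b i → π b = ⟨i, ⟨j + 1, by omega⟩⟩
  back : ∀ b i j, b.loc = Vertex.inner i j → ¬ I.Promising b i → π b = ⟨i, ⟨j, by omega⟩⟩

/-- The walk of a committing policy: the agent is at vertex `m` of path `i`, it has crossed the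
edges `R` and paid `c`. Every crossed edge has been crossed exactly once in each direction, apart
from those between `s` and the location; of the promising paths only the present one has been
entered. -/
structure Commit (x : I.Edge → Bool) (b : BeliefForm I.Vertex I.Edge) (R : Finset I.Edge) (c : ℝ)
    (i : Fin I.numPaths) (m : ℕ) : Prop where
  le_length : m ≤ I.pathLength i
  loc_eq : b.loc = I.pathVertex i m
  mem : ∀ j (h : j < I.pathLength i), j < m → (⟨i, ⟨j, h⟩⟩ : I.Edge) ∈ R
  cost_eq : 2 * ∑ e ∈ R, I.weight e = c + I.prefixWeight i m
  of_mem : ∀ e ∈ R, I.Unbeaten e.1 x ∧ I.PrefixOpen e.1 (e.2 + 1) x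
  blocked : ∀ e, b.status e = EdgeKnowledge.isBlocked → x e = true
  seen : ∀ e, I.toCTPDep.Incident e b.loc →
    b.status e = if x e then EdgeKnowledge.isBlocked else EdgeKnowledge.isOpen
  entered : ∀ e ∈ R, I.Promising b e.1 → e.1 = i ∧ (e.2 : ℕ) < m

variable {I}

theorem pathVertex_cases {i : Fin I.numPaths} {m : ℕ} (hm : m < I.pathLength i) :
    (m = 0 ∧ I.pathVertex i m = Vertex.s) ∨
      ∃ j : Fin (I.pathLength i - 1), m = j + 1 ∧ I.pathVertex i m = Vertex.inner i j := by
  cases m with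
  | zero => exact Or.inl ⟨rfl, rfl⟩
  | succ m => exact Or.inr ⟨⟨m, by omega⟩, rfl, by simp only [pathVertex]; rw [dif_pos]⟩

/-- New observations do not make a path promising. -/
theorem promising_of_arrive {x : I.Edge → Bool} {v : I.Vertex} {b : BeliefForm I.Vertex I.Edge}
    (hb : ∀ e, b.status e = EdgeKnowledge.isBlocked → x e = true) {i : Fin I.numPaths}
    (h : I.Promising (I.toCTPDep.arrive x v b.status) i) : I.Promising b i := by
  refine ⟨h.1, fun j hj => h.2 j ?_⟩
  have := hb _ hj
  simp only [CTPDep.arrive]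
  split
  · rfl
  · exact hj

theorem arrive_blocked {x : I.Edge → Bool} {v : I.Vertex} {st : I.Edge → EdgeKnowledge}
    (hst : ∀ e, st e = EdgeKnowledge.isBlocked → x e = true) (e : I.Edge)
    (he : (I.toCTPDep.arrive x v st).status e = EdgeKnowledge.isBlocked) : x e = true := by
  simp only [CTPDep.arrive] at he
  split at he
  · cases hx : x e
    · simp [hx] at he
    · rfl
  · exact hst e he

theorem arrive_seen {x : I.Edge → Bool} {v : I.Vertex} {st : I.Edge → EdgeKnowledge} (e : I.Edge)
    (he : I.toCTPDep.Incident e (I.toCTPDep.arrive x v st).loc) :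
    (I.toCTPDep.arrive x v st).status e =
      if x e then EdgeKnowledge.isBlocked else EdgeKnowledge.isOpen := by
  simp only [CTPDep.arrive] at he ⊢
  rw [if_pos he]

theorem not_blocked_of_pathOpen {x : I.Edge → Bool} {b : BeliefForm I.Vertex I.Edge}
    (hb : ∀ e, b.status e = EdgeKnowledge.isBlocked → x e = true) {i : Fin I.numPaths}
    (hS : I.openProb i ≠ 0) (h : I.PathOpen i x) : I.Promising b i :=
  ⟨hS, fun j hj => by simpa [h j j.2 j.2] using hb _ hj⟩

theorem Commit.isOpen_of_promising {x : I.Edge → Bool} {b : BeliefForm I.Vertex I.Edge}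
    {R : Finset I.Edge} {c : ℝ} {i : Fin I.numPaths} {m : ℕ} (h : I.Commit x b R c i m)
    {e : I.Edge} (he : I.toCTPDep.Incident e b.loc) (hp : I.Promising b e.1) : x e = false := by
  have h1 := h.seen e he
  cases hx : x e
  · rfl
  · exact absurd (by simpa [hx] using h1) (hp.2 e.2)

/-- A move to the next vertex of a promising path. -/
theorem Commit.forward {x : I.Edge → Bool} {b : BeliefForm I.Vertex I.Edge} {R : Finset I.Edge}
    {c : ℝ} {i : Fin I.numPaths} {m : ℕ} (h : I.Commit x b R c i m) (hm : m < I.pathLength i)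
    (hp : I.Promising b i) (hu : I.Unbeaten i x) :
    I.toCTPDep.CanMove b ⟨i, ⟨m, hm⟩⟩ ∧ (⟨i, ⟨m, hm⟩⟩ : I.Edge) ∉ R ∧
      I.Commit x (I.toCTPDep.arrive x (I.toCTPDep.otherEnd ⟨i, ⟨m, hm⟩⟩ b.loc) b.status)
        (insert ⟨i, ⟨m, hm⟩⟩ R) (c + I.weight ⟨i, ⟨m, hm⟩⟩) i (m + 1) := by
  have hinc : I.toCTPDep.Incident ⟨i, ⟨m, hm⟩⟩ b.loc := Or.inl h.loc_eq
  have hopen := h.isOpen_of_promising hinc hp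
  have hR : (⟨i, ⟨m, hm⟩⟩ : I.Edge) ∉ R := fun hR => lt_irrefl _ (h.entered _ hR hp).2
  have hoe : I.toCTPDep.otherEnd ⟨i, ⟨m, hm⟩⟩ b.loc = I.pathVertex i (m + 1) := if_pos h.loc_eq
  refine ⟨⟨hinc, by simpa [hopen] using h.seen _ hinc⟩, hR, hm, hoe, fun j hj hjm => ?_, ?_,
    fun e he => ?_, arrive_blocked h.blocked, arrive_seen, fun e he hpe => ?_⟩
  · rcases Nat.lt_succ_iff_lt_or_eq.1 hjm with hjm | rfl
    · exact Finset.mem_insert_of_mem (h.mem j hj hjm)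
    · exact Finset.mem_insert_self _ _
  · rw [Finset.sum_insert hR, I.prefixWeight_succ i hm]
    linarith [h.cost_eq]
  · rcases Finset.mem_insert.1 he with rfl | he
    · refine ⟨hu, fun j hj hjm => ?_⟩
      rcases Nat.lt_succ_iff_lt_or_eq.1 hjm with hjm | rfl
      · exact (h.of_mem _ (h.mem j hj hjm)).2 j hj (Nat.lt_succ_self j)
      · exact hopen
    · exact h.of_mem e he
  · rcases Finset.mem_insert.1 he with rfl | he
    · exact ⟨rfl, Nat.lt_succ_self m⟩
    · obtain ⟨h1, h2⟩ := h.entered e he (promising_of_arrive h.blocked hpe)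
      exact ⟨h1, by omega⟩

/-- A move back on a path that is known to be blocked. -/
theorem Commit.back {x : I.Edge → Bool} {b : BeliefForm I.Vertex I.Edge} {R : Finset I.Edge}
    {c : ℝ} {i : Fin I.numPaths} {m : ℕ} (h : I.Commit x b R c i (m + 1))
    (hm : m + 1 < I.pathLength i) (hp : ¬ I.Promising b i) :
    I.toCTPDep.CanMove b ⟨i, ⟨m, by omega⟩⟩ ∧
      I.Commit x (I.toCTPDep.arrive x (I.toCTPDep.otherEnd ⟨i, ⟨m, by omega⟩⟩ b.loc) b.status)
        R (c + I.weight ⟨i, ⟨m, by omega⟩⟩) i m := by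
  have hm' : m < I.pathLength i := by omega
  have hinc : I.toCTPDep.Incident ⟨i, ⟨m, hm'⟩⟩ b.loc := Or.inr h.loc_eq
  have hR := h.mem m hm' (Nat.lt_succ_self m)
  have hopen := (h.of_mem _ hR).2 m hm' (Nat.lt_succ_self m)
  have hoe : I.toCTPDep.otherEnd ⟨i, ⟨m, hm'⟩⟩ b.loc = I.pathVertex i m :=
    if_neg fun h' => I.pathVertex_ne_succ i hm' (h'.symm.trans h.loc_eq)
  refine ⟨⟨hinc, by simpa [hopen] using h.seen _ hinc⟩, hm'.le, hoe,
    fun j hj hjm => h.mem j hj (by omega), ?_, h.of_mem, arrive_blocked h.blocked, arrive_seen,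
    fun e he hpe => ?_⟩
  · have := h.cost_eq
    rw [I.prefixWeight_succ i hm'] at this
    linarith
  · have hpe' := promising_of_arrive h.blocked hpe
    exact absurd ((h.entered e he hpe').1 ▸ hpe') hp

/-- Progress is measured by the number of edges not crossed, counted twice, plus the distance
from `s`. -/
theorem Commit.step {π : CTPPolicy I.Vertex I.Edge} (hπ : I.Committing π) {x : I.Edge → Bool}
    {i₀ : Fin I.numPaths} (hi₀ : I.IsFirst i₀ x) {b : BeliefForm I.Vertex I.Edge}
    {R : Finset I.Edge} {c : ℝ} {i : Fin I.numPaths} {m : ℕ} (h : I.Commit x b R c i m)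
    (hm : m < I.pathLength i) :
    I.toCTPDep.CanMove b (π b) ∧ ∃ R' i' m',
      I.Commit x (I.toCTPDep.arrive x (I.toCTPDep.otherEnd (π b) b.loc) b.status) R'
        (c + I.weight (π b)) i' m' ∧ 2 * R'ᶜ.card + m' < 2 * Rᶜ.card + m := by
  have hcard : ∀ e : I.Edge, e ∉ R → (insert e R)ᶜ.card + 1 = Rᶜ.card := fun e he => by
    rw [Finset.compl_insert, Finset.card_erase_of_mem (by simpa using he)]
    have : 0 < Rᶜ.card := Finset.card_pos.2 ⟨e, by simpa using he⟩
    omega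
  rcases pathVertex_cases hm with ⟨rfl, hs⟩ | ⟨j, rfl, hin⟩
  · obtain ⟨k, hk⟩ := I.exists_isBest (T := I.Promising b)
      (not_blocked_of_pathOpen h.blocked hi₀.1.1 hi₀.2)
    have hu : I.Unbeaten k x := ⟨hk.1.1, fun j hS hj => hk.2 j
      (not_blocked_of_pathOpen h.blocked hS hj)⟩
    have h' : I.Commit x b R c k 0 := ⟨Nat.zero_le _, h.loc_eq,
      fun j _ hj => absurd hj (Nat.not_lt_zero j), by simpa [prefixWeight] using h.cost_eq,
      h.of_mem, h.blocked, h.seen, fun e he hp => absurd (h.entered e he hp).2 (Nat.not_lt_zero _)⟩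
    rw [hπ.start b k (h.loc_eq.trans hs) hk]
    obtain ⟨h1, h2, h3⟩ := h'.forward (I.pathLength_pos k) hk.1 hu
    have := hcard _ h2
    exact ⟨h1, _, _, _, h3, by omega⟩
  · by_cases hp : I.Promising b i
    · rw [hπ.forward b i j (h.loc_eq.trans hin) hp]
      obtain ⟨h1, h2, h3⟩ := h.forward hm hp (h.of_mem _ (h.mem j (by omega) (by omega))).1
      have := hcard _ h2
      exact ⟨h1, _, _, _, h3, by omega⟩
    · rw [hπ.back b i j (h.loc_eq.trans hin) hp]
      obtain ⟨h1, h2⟩ := h.back hm hp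
      exact ⟨h1, _, _, _, h2, by omega⟩

/-- If some path is open, a committing policy reaches the target. -/
theorem Commit.reach {π : CTPPolicy I.Vertex I.Edge} (hπ : I.Committing π) {x : I.Edge → Bool}
    {i₀ : Fin I.numPaths} (hi₀ : I.IsFirst i₀ x) (d : ℕ) : ∀ {n : ℕ} {R : Finset I.Edge}
    {i : Fin I.numPaths} {m : ℕ}, I.Commit x (I.toCTPDep.trace π x n) R (I.costUpTo π x n) i m →
      2 * Rᶜ.card + m = d → ∃ n R i,
        I.Commit x (I.toCTPDep.trace π x n) R (I.costUpTo π x n) i (I.pathLength i) := by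
  induction d using Nat.strong_induction_on with
  | _ d ih =>
    intro n R i m h hd
    rcases h.le_length.lt_or_eq with hm | rfl
    · obtain ⟨h1, R', i', m', h2, h3⟩ := h.step hπ hi₀ hm
      refine ih _ (hd ▸ h3) (n := n + 1) (i := i') ?_ rfl
      rw [trace_succ, CTPDep.step, if_pos h1, costUpTo, Finset.sum_range_succ, ← costUpTo,
        I.stepCost_toReal π h1]
      exact h2
    · exact ⟨n, R, i, h⟩

/-- A committing policy crosses `e` before it reaches the target. -/
def Reaches (I : CTPForDep) (e : I.Edge) (x : I.Edge → Bool) : Prop :=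
  I.Unbeaten e.1 x ∧ I.PrefixOpen e.1 (e.2 + 1) x

open Classical in
/-- The edges that a committing policy crosses before it reaches the target. -/
def reachedEdges (I : CTPForDep) (x : I.Edge → Bool) : Finset I.Edge :=
  Finset.univ.filter fun e => I.Reaches e x

/-- A committing policy reaches the target on the first open path, and crosses each of
the other edges in both directions. -/
theorem Committing.travelCost_le {π : CTPPolicy I.Vertex I.Edge} (hπ : I.Committing π)
    {x : I.Edge → Bool} {i₀ : Fin I.numPaths} (hi₀ : I.IsFirst i₀ x) :
    I.toCTPDep.travelCost π x ≤ ENNReal.ofReal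
      (2 * ∑ e ∈ I.reachedEdges x, I.weight e - I.pathWeight i₀) := by
  classical
  have h0 : I.Commit x (I.toCTPDep.trace π x 0) ∅ (I.costUpTo π x 0) i₀ 0 :=
    ⟨Nat.zero_le _, rfl, fun j _ hj => absurd hj (Nat.not_lt_zero j),
      by simp [costUpTo, prefixWeight], by simp, arrive_blocked (by simp), arrive_seen, by simp⟩
  obtain ⟨n, R, i, h⟩ := h0.reach hπ hi₀ _ rfl
  have hlen := I.pathLength_pos i
  have hlast := h.of_mem _ (h.mem (I.pathLength i - 1) (by omega) (by omega))
  -- All edges of the path on which the agent has arrived were crossed, so they are open.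
  have hi : i = i₀ := by
    refine IsFirst.unique (x := x) ⟨hlast.1, ?_⟩ hi₀
    have := hlast.2
    simp only [Nat.sub_add_cancel hlen] at this
    exact this
  subst hi
  have htop : ∀ b, I.toCTPDep.stepCost π b ≠ ⊤ := fun b => by
    unfold CTPDep.stepCost; split <;> simp
  have hle : I.toCTPDep.travelCost π x ≤ ENNReal.ofReal (I.costUpTo π x n) := by
    rw [costUpTo, ← ENNReal.toReal_sum fun k _ => htop _,
      ENNReal.ofReal_toReal (ENNReal.sum_ne_top.2 fun k _ => htop _)]
    exact iInf₂_le n (h.loc_eq.trans (I.pathVertex_length i))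
  refine hle.trans (ENNReal.ofReal_le_ofReal ?_)
  have hsub : ∑ e ∈ R, I.weight e ≤ ∑ e ∈ I.reachedEdges x, I.weight e :=
    Finset.sum_le_sum_of_subset_of_nonneg
      (fun e he => Finset.mem_filter.2 ⟨Finset.mem_univ e, h.of_mem e he⟩)
      fun e _ _ => I.weight_nonneg e
  have := h.cost_eq
  unfold pathWeight
  linarith

/-- The order of the indices is reflexive, so that path `i` being open does not matter. -/
theorem freeOf_unbeaten (i : Fin I.numPaths) : I.FreeOf (I.tail i 0) (I.Unbeaten i) := by
  intro x y hxy
  refine propext (and_congr_right fun _ => forall_congr' fun j => imp_congr_right fun _ => ?_)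
  by_cases hij : j = i
  · subst hij
    simp [Before.refl]
  · have : I.PathOpen j x ↔ I.PathOpen j y := by
      refine forall_congr' fun l => forall_congr' fun hl => ?_
      rw [hxy ⟨j, ⟨l, hl⟩⟩ fun h => hij (I.mem_tail.1 h).1]
    rw [this]

theorem pr_unbeaten_and_prefixOpen (i : Fin I.numPaths) {c : ℕ} (hc : c ≤ I.pathLength i) :
    I.pr (fun x => I.Unbeaten i x ∧ I.PrefixOpen i c x) =
      I.pathProb i c * I.pr (I.Unbeaten i) :=
  I.pr_and_prefixOpen i (freeOf_unbeaten i) hc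

theorem pr_isFirst (i : Fin I.numPaths) :
    I.pr (I.IsFirst i) = I.openProb i * I.pr (I.Unbeaten i) :=
  pr_unbeaten_and_prefixOpen i le_rfl

/-- Path `i` is tried if no path before it is open, which is independent of the statuses on path
`i`; so the expected amount that a committing policy pays on path `i` is the index times the
probability that path `i` is the first open path. -/
theorem Committing.expectedCost_le {π : CTPPolicy I.Vertex I.Edge} (hπ : I.Committing π)
    (h : I.pr (fun x => ∀ i, I.openProb i ≠ 0 → ¬ I.PathOpen i x) = 0) :
    I.toCTPDep.expectedCost π ≤ ENNReal.ofReal I.value := by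
  classical
  have hex : ∀ x, 0 < I.prob x → ∃ i, I.IsFirst i x := fun x hx => by
    by_contra hno
    push Not at hno
    have h1 : ∀ i, I.openProb i ≠ 0 → ¬ I.PathOpen i x := fun i hS hi =>
      let ⟨b, hb⟩ := I.exists_isFirst hS hi
      hno b hb
    have h2 := I.prob_le_pr (A := fun x => ∀ i, I.openProb i ≠ 0 → ¬ I.PathOpen i x) h1
    linarith
  have h1 : I.toCTPDep.expectedCost π ≤ ENNReal.ofReal (∑ x, I.prob x *
      (2 * ∑ e ∈ I.reachedEdges x, I.weight e -
        ∑ i, if I.IsFirst i x then I.pathWeight i else 0)) := by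
    have hterm : ∀ x, 0 < I.prob x → ∃ i, I.IsFirst i x ∧
        ∑ i, (if I.IsFirst i x then I.pathWeight i else 0) = I.pathWeight i := fun x hx => by
      obtain ⟨b, hb⟩ := hex x hx
      refine ⟨b, hb, ?_⟩
      rw [Finset.sum_eq_single b (fun i _ hib => if_neg fun hi => hib (hi.unique hb))
        (fun h => absurd (Finset.mem_univ b) h), if_pos hb]
    rw [ENNReal.ofReal_sum_of_nonneg]
    · refine Finset.sum_le_sum fun x _ => ?_
      rw [ENNReal.ofReal_mul (I.prob_nonneg x), jointProb_eq]
      rcases (I.prob_nonneg x).eq_or_lt with h0 | hx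
      · simp [← h0]
      · obtain ⟨i, hi, hsum⟩ := hterm x hx
        rw [hsum]
        exact mul_le_mul_right (hπ.travelCost_le hi) _
    · intro x _
      rcases (I.prob_nonneg x).eq_or_lt with h0 | hx
      · simp [← h0]
      · obtain ⟨i, hi, hsum⟩ := hterm x hx
        rw [hsum]
        refine mul_nonneg hx.le (sub_nonneg.2 ?_)
        have hw : I.pathWeight i ≤ ∑ e ∈ I.reachedEdges x, I.weight e := by
          have hsub : (Finset.univ : Finset (Fin (I.pathLength i))).map
              ⟨Sigma.mk i, sigma_mk_injective⟩ ⊆ I.reachedEdges x := by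
            intro e he
            obtain ⟨j, -, rfl⟩ := Finset.mem_map.1 he
            exact Finset.mem_filter.2 ⟨Finset.mem_univ _, hi.1,
              fun l hl _ => hi.2 l hl hl⟩
          refine le_trans (le_of_eq ?_)
            (Finset.sum_le_sum_of_subset_of_nonneg hsub fun e _ _ => I.weight_nonneg e)
          rw [Finset.sum_map, pathWeight, prefixWeight, Finset.sum_range]
          refine Finset.sum_congr rfl fun j _ => ?_
          rw [weightAt, dif_pos j.2]
          rfl
        have := Finset.sum_nonneg fun e (_ : e ∈ I.reachedEdges x) => I.weight_nonneg e
        linarith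
  refine h1.trans (ENNReal.ofReal_le_ofReal (le_of_eq ?_))
  -- The expected weight of the edges that the policy crosses.
  have e1 : ∑ x, I.prob x * ∑ e ∈ I.reachedEdges x, I.weight e =
      ∑ i, I.pr (I.Unbeaten i) * I.expectedReach i := by
    have : ∀ x, I.prob x * ∑ e ∈ I.reachedEdges x, I.weight e =
        ∑ e : I.Edge, I.prob x * if I.Reaches e x then I.weight e else 0 := fun x => by
      rw [← Finset.mul_sum, reachedEdges, Finset.sum_filter]
    rw [Finset.sum_congr rfl fun x _ => this x, Finset.sum_comm,
      Finset.sum_congr rfl fun e _ => I.sum_mul_ite (I.weight e) (I.Reaches e), Fintype.sum_sigma]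
    refine Finset.sum_congr rfl fun i _ => ?_
    rw [expectedReach, Finset.sum_range, Finset.mul_sum]
    refine Finset.sum_congr rfl fun j _ => ?_
    have := pr_unbeaten_and_prefixOpen i j.2
    change I.pr (I.Reaches ⟨i, j⟩) = _ at this
    rw [this, weightAt, dif_pos j.2]
    ring
  have e2 : ∑ x, I.prob x * (∑ i, if I.IsFirst i x then I.pathWeight i else 0) =
      ∑ i, I.pathWeight i * I.pr (I.IsFirst i) := by
    simp_rw [Finset.mul_sum]
    rw [Finset.sum_comm]
    simp_rw [I.sum_mul_ite]
  simp_rw [mul_sub, mul_left_comm _ (2 : ℝ)]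
  rw [Finset.sum_sub_distrib, ← Finset.mul_sum, e1, e2, Finset.mul_sum, ← Finset.sum_sub_distrib,
    value]
  refine Finset.sum_congr rfl fun i _ => ?_
  rw [pr_isFirst]
  by_cases hS : I.openProb i = 0
  · have : I.pr (I.Unbeaten i) = 0 := by
      unfold pr
      exact Finset.sum_eq_zero fun x _ => if_neg fun hu => hu.1 hS
    simp [this]
  · rw [index]
    field_simp

theorem Committing.isOptimal {π : CTPPolicy I.Vertex I.Edge} (hπ : I.Committing π) :
    I.toCTPDep.IsOptimal π := by
  intro π'
  by_cases h : I.pr (fun x => ∀ i, I.openProb i ≠ 0 → ¬ I.PathOpen i x) = 0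
  · exact (hπ.expectedCost_le h).trans (I.value_le_expectedCost π')
  · rw [I.expectedCost_eq_top π' h]; exact le_top

theorem Committing.optimalCost_eq {π : CTPPolicy I.Vertex I.Edge} (hπ : I.Committing π)
    (h : I.pr (fun x => ∀ i, I.openProb i ≠ 0 → ¬ I.PathOpen i x) = 0) :
    I.toCTPDep.optimalCost = ENNReal.ofReal I.value :=
  le_antisymm ((iInf_le _ π).trans (hπ.expectedCost_le h))
    (le_iInf fun π' => I.value_le_expectedCost π')

theorem optimalCost_eq_top
    (h : I.pr (fun x => ∀ i, I.openProb i ≠ 0 → ¬ I.PathOpen i x) ≠ 0) :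
    I.toCTPDep.optimalCost = ⊤ :=
  iInf_eq_top.2 fun π => I.expectedCost_eq_top π h

/-! ### Trying the paths one by one -/

/-- The event that no path in `U` is open. -/
def NoneOpen (I : CTPForDep) (U : Finset (Fin I.numPaths)) (x : I.Edge → Bool) : Prop :=
  ∀ i ∈ U, ¬ I.PathOpen i x

/-- Different paths are independent. -/
theorem pr_noneOpen_and (U : Finset (Fin I.numPaths)) {i : Fin I.numPaths} (hi : i ∉ U) :
    I.pr (fun x => I.NoneOpen U x ∧ I.PathOpen i x) = I.openProb i * I.pr (I.NoneOpen U) := by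
  refine I.pr_and_prefixOpen i (fun x y hxy => ?_) le_rfl
  refine propext (forall_congr' fun j => forall_congr' fun hj => not_congr ?_)
  refine forall_congr' fun l => forall_congr' fun hl => ?_
  rw [hxy ⟨j, ⟨l, hl⟩⟩ fun h => hi ((I.mem_tail.1 h).1 ▸ hj)]

theorem pr_noneOpen_insert (U : Finset (Fin I.numPaths)) {i : Fin I.numPaths} (hi : i ∉ U) :
    I.pr (I.NoneOpen (insert i U)) = (1 - I.openProb i) * I.pr (I.NoneOpen U) := by
  have h1 := I.pr_and_add_pr_and_not (I.NoneOpen U) (I.PathOpen i)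
  rw [pr_noneOpen_and U hi] at h1
  have h2 : I.NoneOpen (insert i U) = fun x => I.NoneOpen U x ∧ ¬ I.PathOpen i x := by
    funext x
    refine propext ⟨fun h => ⟨fun j hj => h j (Finset.mem_insert_of_mem hj),
      h i (Finset.mem_insert_self i U)⟩, fun h j hj => ?_⟩
    rcases Finset.mem_insert.1 hj with rfl | hj
    · exact h.2
    · exact h.1 j hj
  rw [h2]
  linarith

/-- `U` consists of the first few of the paths with positive success probability. -/
structure Initial (I : CTPForDep) (U : Finset (Fin I.numPaths)) : Prop where
  openProb_ne_zero : ∀ i ∈ U, I.openProb i ≠ 0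
  before : ∀ i ∈ U, ∀ j, I.openProb j ≠ 0 → j ∉ U → I.Before i j

/-- The part of the expected index of the first open path that comes from `U`. -/
def valueOn (I : CTPForDep) (U : Finset (Fin I.numPaths)) : ℝ :=
  ∑ i ∈ U, I.index i * I.pr (I.IsFirst i)

theorem Initial.insert {U : Finset (Fin I.numPaths)} (hU : I.Initial U) {i : Fin I.numPaths}
    (hi : I.IsBest (fun j => I.openProb j ≠ 0 ∧ j ∉ U) i) : I.Initial (insert i U) := by
  refine ⟨fun j hj => ?_, fun j hj k hk hkU => ?_⟩
  · rcases Finset.mem_insert.1 hj with rfl | hj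
    · exact hi.1.1
    · exact hU.1 j hj
  · have hkU' : k ∉ U := fun h => hkU (Finset.mem_insert_of_mem h)
    rcases Finset.mem_insert.1 hj with rfl | hj
    · exact hi.2 k ⟨hk, hkU'⟩
    · exact hU.2 j hj k hk hkU'

/-- The next path in the order of indices is the first open path if it is open and none of `U` is.
-/
theorem Initial.valueOn_insert {U : Finset (Fin I.numPaths)} (hU : I.Initial U)
    {i : Fin I.numPaths} (hi : I.IsBest (fun j => I.openProb j ≠ 0 ∧ j ∉ U) i) :
    I.valueOn (Insert.insert i U) =
      I.valueOn U + I.index i * (I.openProb i * I.pr (I.NoneOpen U)) := by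
  rw [valueOn, Finset.sum_insert hi.1.2, add_comm, ← pr_noneOpen_and U hi.1.2]
  have : I.IsFirst i = fun x => I.NoneOpen U x ∧ I.PathOpen i x := by
    funext x
    refine propext ⟨fun h => ⟨fun j hj hjx => ?_, h.2⟩, fun h => ⟨⟨hi.1.1, fun j hS hj => ?_⟩, h.2⟩⟩
    · have h1 := h.1.2 j (hU.1 j hj) hjx
      have h2 := hU.2 j hj i hi.1.1 hi.1.2
      exact hi.1.2 (h1.antisymm h2 ▸ hj)
    · exact hi.2 j ⟨hS, fun hjU => h.1 j hjU hj⟩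
  rw [this]
  rfl

theorem valueOn_eq_value {U : Finset (Fin I.numPaths)} (hU : ∀ i, I.openProb i ≠ 0 → i ∈ U) :
    I.valueOn U = I.value := by
  refine Finset.sum_subset (Finset.subset_univ U) fun i _ hi => ?_
  rw [pr_isFirst, not_not.1 fun h => hi (hU i h)]
  simp

theorem noneOpen_eq {U : Finset (Fin I.numPaths)} (hU : ∀ i, i ∈ U ↔ I.openProb i ≠ 0) :
    I.NoneOpen U = fun x => ∀ i, I.openProb i ≠ 0 → ¬ I.PathOpen i x := by
  funext x
  exact propext (forall_congr' fun i => by rw [hU])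

end CTPForDep

namespace RAM

/-! ### Verifying programs -/

theorem size_add_le (a b : ℕ) : (a + b).size ≤ a.size + b.size + 1 := by
  rw [Nat.size_le]
  have ha := Nat.lt_size_self a
  have hb := Nat.lt_size_self b
  have h1 : 2 ^ a.size ≤ 2 ^ (a.size + b.size) := Nat.pow_le_pow_right (by norm_num) (by omega)
  have h2 : 2 ^ b.size ≤ 2 ^ (a.size + b.size) := Nat.pow_le_pow_right (by norm_num) (by omega)
  rw [pow_succ]
  omega

theorem size_mul_le (a b : ℕ) : (a * b).size ≤ a.size + b.size := by
  rcases Nat.eq_zero_or_pos a with rfl | ha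
  · simp
  · rw [Nat.size_le, pow_add]
    exact mul_lt_mul'' (Nat.lt_size_self a) (Nat.lt_size_self b) (Nat.zero_le _) (Nat.zero_le _)

/-- If all cells hold numbers of at most `B` bits, the value of an expression has at most
`bits e * (B + 1)` bits. -/
def Expr.bits : Expr → ℕ
  | lit n => n.size
  | cell _ => 1
  | add a b => a.bits + b.bits + 1
  | sub a _ => a.bits
  | mul a b => a.bits + b.bits
  | div a _ => a.bits

/-- If all cells hold numbers of at most `B` bits, the cost of evaluating an expression is at most
`units e * (B + 1)`. -/
def Expr.units : Expr → ℕ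
  | lit n => 1 + n.size
  | cell a => a.units + 1 + a.bits + 1
  | add a b => a.units + b.units + 1 + a.bits + b.bits
  | sub a b => a.units + b.units + 1 + a.bits + b.bits
  | mul a b => a.units + b.units + 1 + a.bits + b.bits
  | div a b => a.units + b.units + 1 + a.bits + b.bits

theorem Expr.size_eval_le {m : Memory} {B : ℕ} (hm : ∀ a, m a < 2 ^ B) (e : Expr) :
    (e.eval m).size ≤ e.bits * (B + 1) := by
  induction e with
  | lit n => exact Nat.le_mul_of_pos_right _ (Nat.succ_pos B)
  | cell a => have := Nat.size_le.2 (hm (a.eval m)); simp only [bits, eval]; omega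
  | add a b iha ihb =>
    have := size_add_le (a.eval m) (b.eval m)
    simp only [bits, eval, add_mul]; omega
  | sub a b iha ihb => exact (Nat.size_le_size (Nat.sub_le _ _)).trans iha
  | mul a b iha ihb =>
    have := size_mul_le (a.eval m) (b.eval m)
    simp only [bits, eval, add_mul]; omega
  | div a b iha ihb => exact (Nat.size_le_size (Nat.div_le_self _ _)).trans iha

theorem Expr.cost_le {m : Memory} {B : ℕ} (hm : ∀ a, m a < 2 ^ B) (e : Expr) :
    e.cost m ≤ e.units * (B + 1) := by
  induction e with
  | lit n => exact Nat.le_mul_of_pos_right _ (Nat.succ_pos B)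
  | cell a iha =>
    have h1 := Nat.size_le.2 (hm (a.eval m))
    have h2 := a.size_eval_le hm
    simp only [units, cost, add_mul]; omega
  | add a b iha ihb | sub a b iha ihb | mul a b iha ihb | div a b iha ihb =>
    have h1 := a.size_eval_le hm
    have h2 := b.size_eval_le hm
    simp only [units, cost, add_mul]; omega

/-- The memory of the programs below: the input `l`, followed by 32 registers `s` and by eight
interleaved arrays `a 0`, …, `a 7`. -/
def mem (l : List ℕ) (s : ℕ → ℕ) (a : ℕ → ℕ → ℕ) : Memory
  | 0 => l.length
  | n + 1 =>
    if n < l.length then l.getD n 0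
    else if n - l.length < 32 then s (n - l.length)
    else a ((n - l.length - 32) % 8) ((n - l.length - 32) / 8)

theorem load_eq_mem (l : List ℕ) : load l = mem l (fun _ => 0) (fun _ _ => 0) := by
  funext n
  cases n with
  | zero => rfl
  | succ n =>
    simp only [load, mem, ite_self]
    split
    · rfl
    · rw [List.getD_eq_default _ _ (by omega)]

/-- The address of a cell behind the input, whose length is found in cell 0. -/
def addr (e : Expr) : Expr := .add (.cell (.lit 0)) (.add e (.lit 1))

/-- Register `c`. -/
def reg (c : ℕ) : Expr := .cell (addr (.lit c))

/-- The number of the cell of array `f` with index `i`. -/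
def arrIndex (f : ℕ) (i : Expr) : Expr := .add (.lit 32) (.add (.mul (.lit 8) i) (.lit f))

/-- The entry of array `f` with index `i`. -/
def arr (f : ℕ) (i : Expr) : Expr := .cell (addr (arrIndex f i))

/-- The entry of the input at position `i`. -/
def inp (i : Expr) : Expr := .cell (.add i (.lit 1))

/-- Writes the value of `e` into register `c`. -/
def setReg (c : ℕ) (e : Expr) : Prog := .store (addr (.lit c)) e

/-- Writes the value of `e` into array `f` at index `i`. -/
def setArr (f : ℕ) (i e : Expr) : Prog := .store (addr (arrIndex f i)) e

section

variable {l : List ℕ} {s : ℕ → ℕ} {a : ℕ → ℕ → ℕ} {B : ℕ}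

theorem mem_behind (n : ℕ) : mem l s a (l.length + (n + 1)) =
    if n < 32 then s n else a ((n - 32) % 8) ((n - 32) / 8) := by
  rw [← add_assoc]
  simp [mem]

theorem eval_reg {c : ℕ} (hc : c < 32) : (reg c).eval (mem l s a) = s c := by
  have := mem_behind (l := l) (s := s) (a := a) c
  rw [if_pos hc] at this
  exact this

theorem eval_arr {f : ℕ} (hf : f < 8) (i : Expr) :
    (arr f i).eval (mem l s a) = a f (i.eval (mem l s a)) := by
  have := mem_behind (l := l) (s := s) (a := a) (32 + (8 * i.eval (mem l s a) + f))
  rw [if_neg (by omega), Nat.add_sub_cancel_left, Nat.mul_add_mod, Nat.mod_eq_of_lt hf,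
    Nat.mul_add_div (by norm_num), Nat.div_eq_of_lt hf, add_zero] at this
  exact this

theorem eval_inp (i : Expr) :
    (inp i).eval (mem l s a) = mem l s a (i.eval (mem l s a) + 1) := rfl

/-- The entry number `k` of a part `as` of the input that starts at position `p`. -/
theorem mem_succ_of_drop {p k : ℕ} {as rest : List ℕ} (h : l.drop p = as ++ rest)
    (hk : k < as.length) (s : ℕ → ℕ) (a : ℕ → ℕ → ℕ) :
    mem l s a (p + k + 1) = as[k] := by
  have h1 : p + k < l.length := by
    have := congrArg List.length h
    simp only [List.length_drop, List.length_append] at this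
    omega
  have h2 : l[p + k]? = some as[k] := by
    rw [← List.getElem?_drop, h, List.getElem?_append_left hk, List.getElem?_eq_getElem hk]
  rw [mem, if_pos h1, List.getD_eq_getElem?_getD, h2]
  rfl

theorem update_mem_reg {c : ℕ} (hc : c < 32) (v : ℕ) :
    Function.update (mem l s a) ((addr (.lit c)).eval (mem l s a)) v =
      mem l (Function.update s c v) a := by
  have h : (addr (.lit c)).eval (mem l s a) = l.length + (c + 1) := rfl
  rw [h]
  funext n
  by_cases hn : n = l.length + (c + 1)
  · subst hn
    rw [Function.update_self, mem_behind, if_pos hc, Function.update_self]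
  · rw [Function.update_of_ne hn]
    cases n with
    | zero => rfl
    | succ n =>
      simp only [mem]
      split
      · rfl
      · split
        · rw [Function.update_of_ne (by omega)]
        · rfl

theorem update_mem_arr {f : ℕ} (hf : f < 8) (i : Expr) (v : ℕ) :
    Function.update (mem l s a) ((addr (arrIndex f i)).eval (mem l s a)) v =
      mem l s (Function.update a f (Function.update (a f) (i.eval (mem l s a)) v)) := by
  set j := i.eval (mem l s a) with hj
  have h : (addr (arrIndex f i)).eval (mem l s a) = l.length + (32 + (8 * j + f) + 1) := rfl
  rw [h]
  funext n
  by_cases hn : n = l.length + (32 + (8 * j + f) + 1)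
  · subst hn
    rw [Function.update_self, mem_behind, if_neg (by omega), Nat.add_sub_cancel_left,
      Nat.mul_add_mod, Nat.mod_eq_of_lt hf, Nat.mul_add_div (by norm_num), Nat.div_eq_of_lt hf,
      add_zero, Function.update_self, Function.update_self]
  · rw [Function.update_of_ne hn]
    cases n with
    | zero => rfl
    | succ n =>
      simp only [mem]
      split
      · rfl
      · split
        · rfl
        · by_cases hf' : (n - l.length - 32) % 8 = f
          · rw [hf', Function.update_self, Function.update_of_ne]
            omega
          · rw [Function.update_of_ne hf']

/-- All numbers in the memory have at most `B` bits. -/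
structure Bounded (l : List ℕ) (B : ℕ) (s : ℕ → ℕ) (a : ℕ → ℕ → ℕ) : Prop where
  length : l.length < 2 ^ B
  input : ∀ v ∈ l, v < 2 ^ B
  reg : ∀ c, s c < 2 ^ B
  arr : ∀ f i, a f i < 2 ^ B

theorem Bounded.mem (h : Bounded l B s a) (n : ℕ) : mem l s a n < 2 ^ B := by
  cases n with
  | zero => exact h.length
  | succ n =>
    simp only [RAM.mem]
    split
    · rename_i hn
      rw [List.getD_eq_getElem _ _ hn]
      exact h.input _ (List.getElem_mem hn)
    · split
      · exact h.reg _
      · exact h.arr _ _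

/-- Started on registers `s` and arrays `a` of numbers of at most `B` bits, `p` halts with
registers and arrays that satisfy `Q`, after at most `n` elementary operations: each of them costs
at most `B + 1`, as all numbers that occur have at most `B` bits. -/
def Runs (l : List ℕ) (B : ℕ) (p : Prog) (n : ℕ) (s : ℕ → ℕ) (a : ℕ → ℕ → ℕ)
    (Q : (ℕ → ℕ) → (ℕ → ℕ → ℕ) → Prop) : Prop :=
  Bounded l B s a → ∃ s' a' k, Exec p (mem l s a) k (mem l s' a') ∧ k ≤ n * (B + 1) ∧
    Bounded l B s' a' ∧ Q s' a'

variable {p q : Prog} {n m : ℕ} {e : Expr} {Q Q' : (ℕ → ℕ) → (ℕ → ℕ → ℕ) → Prop}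

theorem Runs.mono (h : Runs l B p n s a Q) (hnm : n ≤ m) (hQ : ∀ s a, Q s a → Q' s a) :
    Runs l B p m s a Q' := fun hb =>
  let ⟨s', a', k, h1, h2, h3, h4⟩ := h hb
  ⟨s', a', k, h1, h2.trans (Nat.mul_le_mul_right _ hnm), h3, hQ _ _ h4⟩

theorem Runs.seq (h : Runs l B p n s a fun s a => Runs l B q m s a Q) :
    Runs l B (.seq p q) (n + m) s a Q := fun hb =>
  let ⟨_, _, _, h1, h2, h3, h4⟩ := h hb
  let ⟨s', a', _, h1', h2', h3', h4'⟩ := h4 h3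
  ⟨s', a', _, .seq h1 h1', by rw [add_mul]; exact add_le_add h2 h2', h3', h4'⟩

theorem runs_skip (h : Q s a) : Runs l B .skip 1 s a Q := fun hb =>
  ⟨s, a, 1, .skip _, by omega, hb, h⟩

/-- The number of elementary operations of an assignment. -/
def storeUnits (a e : Expr) : ℕ := a.units + e.units + 1 + a.bits + e.bits

theorem store_cost_le {m : Memory} (hm : ∀ a, m a < 2 ^ B) (x e : Expr) :
    x.cost m + e.cost m + 1 + (x.eval m).size + (e.eval m).size ≤ storeUnits x e * (B + 1) := by
  have h1 := x.cost_le hm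
  have h2 := e.cost_le hm
  have h3 := x.size_eval_le hm
  have h4 := e.size_eval_le hm
  simp only [storeUnits, add_mul]
  omega

theorem runs_setReg {c : ℕ} (v : ℕ) (hv : e.eval (mem l s a) = v) (hc : c < 32)
    (hB : Bounded l B s a → v < 2 ^ B) (h : Q (Function.update s c v) a) :
    Runs l B (setReg c e) (storeUnits (addr (.lit c)) e) s a Q := fun hb =>
  ⟨_, a, _, by rw [← update_mem_reg hc, ← hv]; exact .store _ _ _, store_cost_le hb.mem _ _,
    ⟨hb.length, hb.input, fun d => by
      by_cases hd : d = c
      · subst hd; rw [Function.update_self]; exact hB hb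
      · rw [Function.update_of_ne hd]; exact hb.reg d, hb.arr⟩, h⟩

theorem runs_setArr {f : ℕ} {i : Expr} (j v : ℕ) (hj : i.eval (mem l s a) = j)
    (hv : e.eval (mem l s a) = v) (hf : f < 8) (hB : Bounded l B s a → v < 2 ^ B)
    (h : Q s (Function.update a f (Function.update (a f) j v))) :
    Runs l B (setArr f i e) (storeUnits (addr (arrIndex f i)) e) s a Q := fun hb =>
  ⟨s, _, _, by rw [← hj, ← update_mem_arr hf, ← hv]; exact .store _ _ _, store_cost_le hb.mem _ _,
    ⟨hb.length, hb.input, hb.reg, fun g k => by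
      by_cases hg : g = f
      · subst hg
        rw [Function.update_self]
        by_cases hk : k = j
        · subst hk; rw [Function.update_self]; exact hB hb
        · rw [Function.update_of_ne hk]; exact hb.arr g k
      · rw [Function.update_of_ne hg]; exact hb.arr g k⟩, h⟩

theorem test_cost_le (hb : Bounded l B s a) (e : Expr) :
    e.cost (mem l s a) + 1 ≤ (e.units + 1) * (B + 1) := by
  have := e.cost_le hb.mem
  rw [add_mul]
  omega

theorem runs_if (h1 : e.eval (mem l s a) ≠ 0 → Runs l B p n s a Q)
    (h2 : e.eval (mem l s a) = 0 → Runs l B q m s a Q) :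
    Runs l B (.ifNonzero e p q) (e.units + 1 + (n + m)) s a Q := fun hb => by
  have ht := test_cost_le hb e
  by_cases he : e.eval (mem l s a) = 0
  · obtain ⟨s', a', k, h, hk, hb', hQ⟩ := h2 he hb
    exact ⟨s', a', _, .if_false he h, by simp only [add_mul] at ht ⊢; omega, hb', hQ⟩
  · obtain ⟨s', a', k, h, hk, hb', hQ⟩ := h1 he hb
    exact ⟨s', a', _, .if_true he h, by simp only [add_mul] at ht ⊢; omega, hb', hQ⟩

theorem runs_while_false (he : e.eval (mem l s a) = 0) (h : Q s a) :
    Runs l B (.whileNonzero e p) (e.units + 1) s a Q := fun hb =>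
  ⟨s, a, _, .while_false he, test_cost_le hb e, hb, h⟩

theorem runs_while_true (he : e.eval (mem l s a) ≠ 0)
    (h : Runs l B p n s a fun s a => Runs l B (.whileNonzero e p) m s a Q) :
    Runs l B (.whileNonzero e p) (e.units + 1 + (n + m)) s a Q := fun hb => by
  have ht := test_cost_le hb e
  obtain ⟨s₁, a₁, k₁, h1, hk1, hb1, h2⟩ := h hb
  obtain ⟨s', a', k, h2, hk2, hb', hQ⟩ := h2 hb1
  refine ⟨s', a', _, .while_true he h1 h2, ?_, hb', hQ⟩
  simp only [add_mul] at ht ⊢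
  omega

/-- A program that leaves the contents of the registers `c` and `d` as its output. -/
def output (c d : ℕ) : Prog :=
  .seq (.store (.lit 1) (reg c)) (.seq (.store (.lit 2) (reg d)) (.store (.lit 0) (.lit 2)))

/-- The number of elementary operations of `output c d`. -/
def outputUnits (c d : ℕ) : ℕ :=
  storeUnits (.lit 1) (reg c) + (storeUnits (.lit 2) (reg d) + storeUnits (.lit 0) (.lit 2))

/-- A computation that ends with its result in two registers, followed by the output of these. -/
theorem Runs.output {c d : ℕ} (hc : c < 32) (hd : d < 32) (hl : 2 ≤ l.length)
    (h : Runs l B p n s a Q) (hb : Bounded l B s a) :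
    ∃ s' a', Q s' a' ∧ ∃ k m', Exec (.seq p (output c d)) (RAM.mem l s a) k m' ∧
      k ≤ (n + outputUnits c d) * (B + 1) ∧ Holds m' [s' c, s' d] := by
  obtain ⟨s', a', k, h1, hk, hb', hQ⟩ := h hb
  refine ⟨s', a', hQ, ?_⟩
  have hupd : ∀ (m : Memory) (x v : ℕ), (∀ a, m a < 2 ^ B) → v < 2 ^ B →
      ∀ a, Function.update m x v a < 2 ^ B := fun m x v hm hv a => by
    rw [Function.update_apply]
    split
    · exact hv
    · exact hm a
  -- The output overwrites the input, so `mem` does not describe the memory any longer; as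
  -- the input has at least two entries, the registers are not overwritten, nor is cell 0 before the
  -- last step.
  obtain ⟨m₀, hm₀⟩ : ∃ m, m = RAM.mem l s' a' := ⟨_, rfl⟩
  have hm₀B := hb'.mem
  rw [← hm₀] at h1 hm₀B
  have e1 : (reg c).eval m₀ = s' c := hm₀ ▸ eval_reg hc
  set m₁ := Function.update m₀ 1 (s' c) with hm₁
  have hm₁B : ∀ a, m₁ a < 2 ^ B := hupd _ _ _ hm₀B (hb'.reg c)
  have e2 : (reg d).eval m₁ = s' d := by
    have h0 : m₁ 0 = l.length := by rw [hm₁, hm₀]; rfl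
    have : (reg d).eval m₁ = m₁ (m₁ 0 + (d + 1)) := rfl
    rw [this, h0, hm₁, Function.update_of_ne (by omega), hm₀, mem_behind, if_pos hd]
  set m₂ := Function.update m₁ 2 (s' d) with hm₂
  have hm₂B : ∀ a, m₂ a < 2 ^ B := hupd _ _ _ hm₁B (hb'.reg d)
  have x1 := Exec.store (.lit 1) (reg c) m₀
  have x2 := Exec.store (.lit 2) (reg d) m₁
  have x3 := Exec.store (.lit 0) (.lit 2) m₂
  have c1 := store_cost_le hm₀B (.lit 1) (reg c)
  have c2 := store_cost_le hm₁B (.lit 2) (reg d)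
  have c3 := store_cost_le hm₂B (.lit 0) (.lit 2)
  rw [e1] at x1
  rw [e2] at x2
  rw [e1] at c1
  rw [e2] at c2
  refine ⟨_, _, .seq h1 (.seq x1 (.seq x2 x3)), ?_, rfl, fun i hi => ?_⟩
  · simp only [outputUnits, add_mul]
    omega
  · have hi' : i < 2 := hi
    interval_cases i <;> rfl

end

end RAM

/-! ### Integer data of a path -/

/-- The first entry of the table of an edge. -/
def EdgeSpec.head (d : EdgeSpec) : ℚ≥0 := d.table.headD 0

/-- Integers that represent the success probability `s / q` of the first few edges of a path, their
weight `w / v`, and the expected weight `g / (q * v)` of the open edges among them before the first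
blocked one. -/
structure PathData where
  g : ℕ
  s : ℕ
  w : ℕ
  q : ℕ
  v : ℕ

/-- The data after one more edge. -/
def PathData.step (a : PathData) (d : EdgeSpec) : PathData where
  g := a.g * d.head.den * d.weight.den + a.s * (d.head.den - d.head.num) * d.weight.num * a.v
  s := a.s * (d.head.den - d.head.num)
  w := a.w * d.weight.den + d.weight.num * a.v
  q := a.q * d.head.den
  v := a.v * d.weight.den

/-- The data of no edges. -/
def PathData.init : PathData := ⟨0, 1, 0, 1, 1⟩

/-- The data of a path with the edges `es`. -/
def pathData (es : List EdgeSpec) : PathData := es.foldl PathData.step PathData.init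

/-- The numerator of the index of a path (the difference is not truncated, as `s * w ≤ g`). -/
def PathData.c (a : PathData) : ℕ := 2 * a.g - a.s * a.w

/-- The denominator of the index of a path; it is 0 if the path has no chance of success. -/
def PathData.u (a : PathData) : ℕ := a.v * a.s

/-- A bound for the factor by which an edge increases the data of a path. -/
def EdgeSpec.cap (d : EdgeSpec) : ℕ := d.head.den * (d.weight.num + d.weight.den)

/-- A bound for the data of a path. -/
def pathCap (es : List EdgeSpec) : ℕ := (es.map EdgeSpec.cap).prod

/-- The data are bounded by `M`. -/
structure PathData.Small (a : PathData) (M : ℕ) : Prop where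
  g_le : a.g ≤ M
  s_le : a.s ≤ a.q
  le : a.q * (a.w + a.v) ≤ M
  q_pos : 0 < a.q
  v_pos : 0 < a.v
  le_g : a.s * a.w ≤ a.g

theorem PathData.small_init : PathData.init.Small 1 := by
  constructor <;> simp [PathData.init]

/-- An edge increases the bound for the data by the factor `d.cap`. -/
theorem PathData.Small.step {a : PathData} {M : ℕ} (h : a.Small M) (d : EdgeSpec) :
    (a.step d).Small (M * d.cap) := by
  obtain ⟨h1, h2, h3, h4, h5, h6⟩ := h
  have h8 : a.q * a.v ≤ M := (Nat.mul_le_mul_left _ (Nat.le_add_left _ _)).trans h3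
  have key : ∀ e y x z : ℕ, 0 < e → 0 < y → z ≤ e →
      (⟨a.g * e * y + a.s * z * x * a.v, a.s * z, a.w * y + x * a.v, a.q * e, a.v * y⟩ :
        PathData).Small (M * (e * (x + y))) := by
    intro e y x z he hy hz
    have hs : a.s * z ≤ a.q * e := Nat.mul_le_mul h2 hz
    refine ⟨?_, hs, ?_, Nat.mul_pos h4 he, Nat.mul_pos h5 hy, ?_⟩
    · calc a.g * e * y + a.s * z * x * a.v ≤ M * e * y + a.q * e * x * a.v :=
            add_le_add (Nat.mul_le_mul_right _ (Nat.mul_le_mul_right _ h1))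
              (Nat.mul_le_mul_right _ (Nat.mul_le_mul_right _ hs))
        _ = M * e * y + (a.q * a.v) * (e * x) := by ring
        _ ≤ M * e * y + M * (e * x) := Nat.add_le_add_left (Nat.mul_le_mul_right _ h8) _
        _ = M * (e * (x + y)) := by ring
    · calc a.q * e * (a.w * y + x * a.v + a.v * y)
          ≤ a.q * e * (a.w * y + x * a.v + a.v * y + x * a.w) :=
            Nat.mul_le_mul_left _ (Nat.le_add_right _ _)
        _ = (a.q * (a.w + a.v)) * (e * (x + y)) := by ring
        _ ≤ M * (e * (x + y)) := Nat.mul_le_mul_right _ h3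
    · calc a.s * z * (a.w * y + x * a.v) = (a.s * a.w) * z * y + a.s * z * x * a.v := by ring
        _ ≤ a.g * e * y + a.s * z * x * a.v :=
          Nat.add_le_add_right (Nat.mul_le_mul_right _ (Nat.mul_le_mul h6 hz)) _
  exact key _ _ _ _ d.head.den_pos d.weight.den_pos (Nat.sub_le _ _)

theorem PathData.Small.foldl {a : PathData} {M : ℕ} (h : a.Small M) (es : List EdgeSpec) :
    (es.foldl PathData.step a).Small (M * pathCap es) := by
  induction es generalizing a M with
  | nil => simpa [pathCap] using h
  | cons d es ih =>
    have := ih (h.step d)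
    simpa [pathCap, mul_assoc] using this

theorem small_pathData (es : List EdgeSpec) : (pathData es).Small (pathCap es) := by
  have := PathData.small_init.foldl es
  rwa [one_mul] at this

theorem PathData.Small.s_le_cap {a : PathData} {M : ℕ} (h : a.Small M) : a.s ≤ M :=
  h.s_le.trans ((Nat.le_mul_of_pos_right _ (by have := h.v_pos; omega)).trans h.le)

theorem PathData.Small.q_le_cap {a : PathData} {M : ℕ} (h : a.Small M) : a.q ≤ M :=
  (Nat.le_mul_of_pos_right _ (by have := h.v_pos; omega)).trans h.le

theorem PathData.Small.w_le_cap {a : PathData} {M : ℕ} (h : a.Small M) : a.w ≤ M :=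
  (Nat.le_add_right _ _).trans ((Nat.le_mul_of_pos_left _ h.q_pos).trans h.le)

theorem PathData.Small.q_mul_v_le {a : PathData} {M : ℕ} (h : a.Small M) : a.q * a.v ≤ M :=
  (Nat.mul_le_mul_left _ (Nat.le_add_left _ _)).trans h.le

theorem PathData.Small.v_le_cap {a : PathData} {M : ℕ} (h : a.Small M) : a.v ≤ M :=
  (Nat.le_mul_of_pos_left _ h.q_pos).trans h.q_mul_v_le

theorem PathData.Small.u_le_cap {a : PathData} {M : ℕ} (h : a.Small M) : a.u ≤ M := by
  rw [PathData.u, mul_comm]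
  exact (Nat.mul_le_mul_right _ h.s_le).trans h.q_mul_v_le

theorem PathData.Small.c_le {a : PathData} {M : ℕ} (h : a.Small M) : a.c ≤ 2 * M :=
  (Nat.sub_le _ _).trans (Nat.mul_le_mul_left _ h.g_le)

theorem EdgeSpec.cap_pos (d : EdgeSpec) : 0 < d.cap :=
  Nat.mul_pos d.head.den_pos (Nat.add_pos_right _ d.weight.den_pos)

theorem pathCap_pos (es : List EdgeSpec) : 0 < pathCap es :=
  Nat.pos_of_ne_zero (List.prod_ne_zero (by
    simp only [List.mem_map, not_exists, not_and]
    exact fun d _ h => d.cap_pos.ne' h))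

namespace CTPForDep

variable (I : CTPForDep)

/-- The data of path `i`. -/
def data (i : Fin I.numPaths) : PathData := pathData I.paths[i]

/-- The probability `clear i c` as a fraction. -/
theorem clear_eq (i : Fin I.numPaths) {c : ℕ} (hc : c < I.pathLength i) :
    I.clear i c * (I.paths[i])[c].head.den =
      (((I.paths[i])[c].head.den - (I.paths[i])[c].head.num : ℕ) : ℝ) := by
  have hle : (I.paths[i])[c].head ≤ 1 := by
    have := I.spec_valid ⟨i, ⟨c, hc⟩⟩
    have hs : I.spec ⟨i, ⟨c, hc⟩⟩ = (I.paths[i])[c] := rfl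
    rw [hs] at this
    unfold EdgeSpec.head
    cases ht : (I.paths[i])[c].table with
    | nil => simp
    | cons q l => simpa using this.table_le_one q (by rw [ht]; exact List.mem_cons_self)
  have hle' : (I.paths[i])[c].head.num ≤ (I.paths[i])[c].head.den := by
    rw [← NNRat.num_div_den (I.paths[i])[c].head, div_le_one (by
      exact_mod_cast NNRat.den_pos _)] at hle
    exact_mod_cast hle
  have hclear : I.clear i c = 1 - (((I.paths[i])[c].head : ℚ≥0) : ℝ) := by
    rw [clear, dif_pos hc]; rfl
  have hden : ((I.paths[i])[c].head.den : ℝ) ≠ 0 := by exact_mod_cast NNRat.den_ne_zero _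
  rw [hclear, Nat.cast_sub hle', NNRat.cast_def]
  field_simp

theorem weightAt_eq (i : Fin I.numPaths) {c : ℕ} (hc : c < I.pathLength i) :
    I.weightAt i c * (I.paths[i])[c].weight.den = ((I.paths[i])[c].weight.num : ℝ) := by
  have hden : ((I.paths[i])[c].weight.den : ℝ) ≠ 0 := by exact_mod_cast NNRat.den_ne_zero _
  have : I.weightAt i c = (((I.paths[i])[c].weight : ℚ≥0) : ℝ) := by
    rw [weightAt, dif_pos hc]; rfl
  rw [this, NNRat.cast_def]
  field_simp

theorem pathData_take (i : Fin I.numPaths) : ∀ {c : ℕ}, c ≤ I.pathLength i →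
    ((pathData (I.paths[i].take c)).s : ℝ) =
        I.pathProb i c * (pathData (I.paths[i].take c)).q ∧
      ((pathData (I.paths[i].take c)).w : ℝ) =
        I.prefixWeight i c * (pathData (I.paths[i].take c)).v ∧
      ((pathData (I.paths[i].take c)).g : ℝ) =
        (∑ j ∈ Finset.range c, I.pathProb i (j + 1) * I.weightAt i j) *
          ((pathData (I.paths[i].take c)).q * (pathData (I.paths[i].take c)).v) := by
  intro c
  induction c with
  | zero => intro _; simp [pathData, PathData.init, pathProb, prefixWeight]
  | succ c ih =>
    intro hc
    obtain ⟨h1, h2, h3⟩ := ih (by omega)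
    have hstep : pathData (I.paths[i].take (c + 1)) =
        (pathData (I.paths[i].take c)).step (I.paths[i])[c] := by
      rw [pathData, List.take_succ_eq_append_getElem hc, List.foldl_append]
      rfl
    have hc1 := I.clear_eq i hc
    have hc2 := I.weightAt_eq i hc
    rw [hstep]
    generalize pathData (I.paths[i].take c) = a at *
    simp only [PathData.step, Nat.cast_add, Nat.cast_mul, ← hc1, ← hc2, h1, h2, h3]
    refine ⟨?_, ?_, ?_⟩
    · rw [pathProb_succ]; ring
    · rw [show I.prefixWeight i (c + 1) = _ from Finset.sum_range_succ _ _, ← prefixWeight]; ring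
    · rw [Finset.sum_range_succ, pathProb_succ]; ring

theorem data_eq (i : Fin I.numPaths) :
    ((I.data i).s : ℝ) = I.openProb i * (I.data i).q ∧
      ((I.data i).w : ℝ) = I.pathWeight i * (I.data i).v ∧
      ((I.data i).g : ℝ) = I.expectedReach i * ((I.data i).q * (I.data i).v) := by
  have := I.pathData_take i le_rfl
  rwa [List.take_length] at this

theorem small_data (i : Fin I.numPaths) : (I.data i).Small (pathCap I.paths[i]) :=
  small_pathData _

theorem openProb_eq (i : Fin I.numPaths) : I.openProb i = (I.data i).s / (I.data i).q := by
  have : ((I.data i).q : ℝ) ≠ 0 := by exact_mod_cast (I.small_data i).q_pos.ne'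
  rw [(I.data_eq i).1]
  field_simp

theorem openProb_ne_zero_iff (i : Fin I.numPaths) : I.openProb i ≠ 0 ↔ (I.data i).u ≠ 0 := by
  have hq : ((I.data i).q : ℝ) ≠ 0 := by exact_mod_cast (I.small_data i).q_pos.ne'
  have hv := (I.small_data i).v_pos.ne'
  rw [I.openProb_eq i, PathData.u]
  simp [hq, hv]

theorem cost_eq (i : Fin I.numPaths) :
    2 * I.expectedReach i - I.openProb i * I.pathWeight i =
      (I.data i).c / ((I.data i).q * (I.data i).v) := by
  have h := I.small_data i
  have hq : ((I.data i).q : ℝ) ≠ 0 := by exact_mod_cast h.q_pos.ne'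
  have hv : ((I.data i).v : ℝ) ≠ 0 := by exact_mod_cast h.v_pos.ne'
  obtain ⟨h1, h2, h3⟩ := I.data_eq i
  rw [PathData.c, Nat.cast_sub (by have := h.le_g; omega)]
  push_cast
  rw [h1, h2, h3]
  field_simp

theorem index_eq {i : Fin I.numPaths} (hi : (I.data i).u ≠ 0) :
    I.index i = (I.data i).c / (I.data i).u := by
  have h := I.small_data i
  have hq : ((I.data i).q : ℝ) ≠ 0 := by exact_mod_cast h.q_pos.ne'
  have hv : ((I.data i).v : ℝ) ≠ 0 := by exact_mod_cast h.v_pos.ne'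
  have hs : ((I.data i).s : ℝ) ≠ 0 := by
    intro h0
    exact hi (by rw [PathData.u, Nat.cast_eq_zero.1 h0, mul_zero])
  rw [index, cost_eq, openProb_eq, PathData.u]
  push_cast
  field_simp

end CTPForDep

/-! ### Finding the least index -/

/-- The least of the fractions `c 0 / u 0, …, c (n - 1) / u (n - 1)` (the first one if there are
several): its number, its numerator, and its denominator. Fractions with denominator 0 are left
out; if no other is there, the result is `(0, 1, 0)`. The search starts with `1 / 0`, that is, with
infinity; a truncated difference that is not 0 says that the left fraction is the greater one. -/
def bestUpTo (c u : ℕ → ℕ) : ℕ → ℕ × ℕ × ℕ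
  | 0 => (0, 1, 0)
  | n + 1 =>
    if (bestUpTo c u n).2.1 * u n - c n * (bestUpTo c u n).2.2 ≠ 0 then (n, c n, u n)
    else bestUpTo c u n

theorem bestUpTo_spec (c u : ℕ → ℕ) (n : ℕ) :
    (bestUpTo c u n = (0, 1, 0) ∧ ∀ i < n, u i = 0) ∨
      ∃ b < n, bestUpTo c u n = (b, c b, u b) ∧ u b ≠ 0 ∧
        ∀ i < n, u i ≠ 0 → c b * u i < c i * u b ∨ (c b * u i = c i * u b ∧ b ≤ i) := by
  induction n with
  | zero => exact Or.inl ⟨rfl, by simp⟩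
  | succ n ih =>
    rw [bestUpTo]
    rcases ih with ⟨h1, h2⟩ | ⟨b, hb, h1, h2, h3⟩
    · rw [h1]
      simp only [one_mul, mul_zero, tsub_zero, ne_eq, ite_not]
      by_cases hu : u n = 0
      · rw [if_pos hu]
        refine Or.inl ⟨rfl, fun i hi => ?_⟩
        rcases Nat.lt_succ_iff_lt_or_eq.1 hi with hi | rfl
        · exact h2 i hi
        · exact hu
      · rw [if_neg hu]
        refine Or.inr ⟨n, Nat.lt_succ_self n, rfl, hu, fun i hi hui => ?_⟩
        rcases Nat.lt_succ_iff_lt_or_eq.1 hi with hi | rfl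
        · exact absurd (h2 i hi) hui
        · exact Or.inr ⟨rfl, le_rfl⟩
    · rw [h1]
      simp only [ne_eq, ite_not]
      refine Or.inr ?_
      by_cases hlt : c b * u n - c n * u b = 0
      · rw [if_pos hlt]
        refine ⟨b, by omega, rfl, h2, fun i hi hui => ?_⟩
        rcases Nat.lt_succ_iff_lt_or_eq.1 hi with hi | rfl
        · exact h3 i hi hui
        · have := Nat.sub_eq_zero_iff_le.1 hlt
          rcases this.lt_or_eq with h | h
          · exact Or.inl h
          · exact Or.inr ⟨h, hb.le⟩
      · rw [if_neg hlt]
        have hlt : c n * u b < c b * u n := by omega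
        have hn : u n ≠ 0 := by rintro h; simp [h] at hlt
        refine ⟨n, Nat.lt_succ_self n, rfl, hn, fun i hi hui => ?_⟩
        rcases Nat.lt_succ_iff_lt_or_eq.1 hi with hi | rfl
        · left
          have h4 : c b * u i ≤ c i * u b := by
            rcases h3 i hi hui with h | h
            · exact h.le
            · exact h.1.le
          refine lt_of_mul_lt_mul_right ?_ (Nat.zero_le (u b))
          calc c n * u i * u b = c n * u b * u i := by ring
            _ < c b * u n * u i := Nat.mul_lt_mul_of_pos_right hlt (Nat.pos_of_ne_zero hui)
            _ = c b * u i * u n := by ring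
            _ ≤ c i * u b * u n := Nat.mul_le_mul_right _ h4
            _ = c i * u n * u b := by ring
        · exact Or.inr ⟨rfl, le_rfl⟩

theorem bestUpTo_lt (c u : ℕ → ℕ) {n : ℕ} (hn : 0 < n) : (bestUpTo c u n).1 < n := by
  rcases bestUpTo_spec c u n with ⟨h, -⟩ | ⟨b, hb, h, -⟩
  · rw [h]; exact hn
  · rw [h]; exact hb

theorem bestUpTo_congr {c u c' u' : ℕ → ℕ} {n : ℕ} (hc : ∀ i < n, c i = c' i)
    (hu : ∀ i < n, u i = u' i) : bestUpTo c u n = bestUpTo c' u' n := by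
  induction n with
  | zero => rfl
  | succ n ih =>
    rw [bestUpTo, bestUpTo, ih (fun i hi => hc i (by omega)) fun i hi => hu i (by omega),
      hc n (Nat.lt_succ_self n), hu n (Nat.lt_succ_self n)]

namespace CTPForDep

variable (I : CTPForDep)

/-- The numerators of the indices. -/
def indexNum (i : ℕ) : ℕ := (pathData (I.paths.getD i [])).c

open Classical in
/-- The denominators of the indices of the paths that satisfy `T`, and 0 for the other paths. -/
def indexDen (T : Fin I.numPaths → Prop) (i : ℕ) : ℕ :=
  if h : i < I.numPaths then if T ⟨i, h⟩ then (I.data ⟨i, h⟩).u else 0 else 0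

theorem indexNum_eq (i : Fin I.numPaths) : I.indexNum i = (I.data i).c := by
  rw [indexNum, List.getD_eq_getElem _ _ i.2]; rfl

theorem indexDen_ne_zero {T : Fin I.numPaths → Prop} {i : Fin I.numPaths} :
    I.indexDen T i ≠ 0 ↔ I.openProb i ≠ 0 ∧ T i := by
  rw [indexDen, dif_pos i.2, I.openProb_ne_zero_iff]
  by_cases h : T i <;> simp [h]

theorem before_of_data {i j : Fin I.numPaths} (hi : (I.data i).u ≠ 0) (hj : (I.data j).u ≠ 0)
    (h : (I.data i).c * (I.data j).u < (I.data j).c * (I.data i).u ∨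
      ((I.data i).c * (I.data j).u = (I.data j).c * (I.data i).u ∧ i ≤ j)) : I.Before i j := by
  have hi' : (0 : ℝ) < (I.data i).u := by exact_mod_cast Nat.pos_of_ne_zero hi
  have hj' : (0 : ℝ) < (I.data j).u := by exact_mod_cast Nat.pos_of_ne_zero hj
  rw [Before, I.index_eq hi, I.index_eq hj, div_lt_div_iff₀ hi' hj', div_eq_div_iff hi'.ne' hj'.ne']
  exact_mod_cast h

/-- If the search finds a path, it is the first one in the order of indices among those that satisfy
`T` and have a positive success probability. -/
theorem isBest_of_bestUpTo {T : Fin I.numPaths → Prop} {b : Fin I.numPaths}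
    (hb : (bestUpTo I.indexNum (I.indexDen T) I.numPaths).1 = b)
    (hu : (bestUpTo I.indexNum (I.indexDen T) I.numPaths).2.2 ≠ 0) :
    I.IsBest (fun i => I.openProb i ≠ 0 ∧ T i) b := by
  have hval : ∀ i : Fin I.numPaths, I.indexDen T i ≠ 0 → I.indexDen T i = (I.data i).u :=
    fun i hi => by
      have := (I.indexDen_ne_zero.1 hi).2
      rw [indexDen, dif_pos i.2]; simp [this]
  rcases bestUpTo_spec I.indexNum (I.indexDen T) I.numPaths with ⟨h, -⟩ | ⟨b', hb', h, hne, h'⟩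
  · rw [h] at hu; exact absurd rfl hu
  · rw [h] at hb
    simp only at hb
    subst hb
    refine ⟨I.indexDen_ne_zero.1 hne, fun j hj => ?_⟩
    have hj' := I.indexDen_ne_zero.2 hj
    have h'' := h' j j.2 hj'
    rw [hval b hne, hval j hj', I.indexNum_eq, I.indexNum_eq] at h''
    exact I.before_of_data (hval b hne ▸ hne) (hval j hj' ▸ hj') h''

theorem bestUpTo_eq_zero {T : Fin I.numPaths → Prop}
    (hu : (bestUpTo I.indexNum (I.indexDen T) I.numPaths).2.2 = 0) (i : Fin I.numPaths) :
    ¬ (I.openProb i ≠ 0 ∧ T i) := by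
  rcases bestUpTo_spec I.indexNum (I.indexDen T) I.numPaths with ⟨-, h⟩ | ⟨b', hb', h, hne, -⟩
  · intro hi
    exact I.indexDen_ne_zero.2 hi (h i i.2)
  · rw [h] at hu; exact absurd hu hne

/-! ### The optimal policy -/

/-- No edge of path `i` is known to be blocked. -/
def NotBlocked (b : BeliefForm I.Vertex I.Edge) (i : Fin I.numPaths) : Prop :=
  ∀ j, b.status ⟨i, j⟩ ≠ EdgeKnowledge.isBlocked

/-- The first edge of the path with the least index among those that are not known to be blocked
(of the first path if there are none). -/
def entrance (b : BeliefForm I.Vertex I.Edge) : I.Edge :=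
  ⟨⟨(bestUpTo I.indexNum (I.indexDen (I.NotBlocked b)) I.numPaths).1,
    bestUpTo_lt _ _ (List.length_pos_of_ne_nil I.paths_ne_nil)⟩, ⟨0, I.pathLength_pos _⟩⟩

/-- At `s` (and, for lack of anything to do, at `t`), enter the path with the least index that is
not known to be blocked; on a path, walk on unless this path is known to be blocked. -/
def policy : CTPPolicy I.Vertex I.Edge := fun b =>
  match b.loc with
  | Vertex.inner i j =>
    if I.indexDen (I.NotBlocked b) i = 0 then ⟨i, ⟨j, by omega⟩⟩ else ⟨i, ⟨j + 1, by omega⟩⟩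
  | _ => I.entrance b

theorem policy_of_s {b : BeliefForm I.Vertex I.Edge} (hb : b.loc = Vertex.s) :
    I.policy b = I.entrance b := by
  rw [policy, hb]

theorem policy_of_t {b : BeliefForm I.Vertex I.Edge} (hb : b.loc = Vertex.t) :
    I.policy b = I.entrance b := by
  rw [policy, hb]

variable {b : BeliefForm I.Vertex I.Edge} {i : Fin I.numPaths} {j : Fin (I.pathLength i - 1)}

theorem policy_of_inner_of_eq (hb : b.loc = Vertex.inner i j)
    (h : I.indexDen (I.NotBlocked b) i = 0) : I.policy b = ⟨i, ⟨j, by omega⟩⟩ := by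
  rw [policy, hb]
  simp only [h, if_true]

theorem policy_of_inner_of_ne (hb : b.loc = Vertex.inner i j)
    (h : I.indexDen (I.NotBlocked b) i ≠ 0) : I.policy b = ⟨i, ⟨j + 1, by omega⟩⟩ := by
  rw [policy, hb]
  simp only [h, if_false]

theorem committing_policy : I.Committing I.policy := by
  have hp : ∀ b, (fun i => I.openProb i ≠ 0 ∧ I.NotBlocked b i) = I.Promising b := fun b => rfl
  refine ⟨fun b i hb hi => ?_, fun b i j hb hi => ?_, fun b i j hb hi => ?_⟩
  · rw [I.policy_of_s hb, entrance]
    set k : Fin I.numPaths := ⟨(bestUpTo I.indexNum (I.indexDen (I.NotBlocked b)) I.numPaths).1,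
      bestUpTo_lt _ _ (List.length_pos_of_ne_nil I.paths_ne_nil)⟩ with hk
    have hne : (bestUpTo I.indexNum (I.indexDen (I.NotBlocked b)) I.numPaths).2.2 ≠ 0 :=
      fun h0 => I.bestUpTo_eq_zero h0 i hi.1
    have hbest := I.isBest_of_bestUpTo (b := k) rfl hne
    rw [hp] at hbest
    have : k = i := (hbest.2 i hi.1).antisymm (hi.2 k hbest.1)
    exact congrArg (fun k => (⟨k, ⟨0, I.pathLength_pos k⟩⟩ : I.Edge)) this
  · exact I.policy_of_inner_of_ne hb (I.indexDen_ne_zero.2 hi)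
  · exact I.policy_of_inner_of_eq hb (not_not.1 fun h => hi (I.indexDen_ne_zero.1 h))

end CTPForDep

namespace RAM

open RAM.Expr RAM.Prog

/-- The number of elementary operations of a program in which each loop is passed once. The
time bounds below have the form `units * (k + 1)`, where `k` accounts for the passes of the
loops. -/
def Prog.units : Prog → ℕ
  | skip => 1
  | store a e => storeUnits a e
  | seq p q => p.units + q.units
  | ifNonzero e p q => e.units + 1 + (p.units + q.units)
  | whileNonzero e p => e.units + 1 + p.units

/-- Arrays with one entry changed. -/
def updateArr (a : ℕ → ℕ → ℕ) (f i v : ℕ) : ℕ → ℕ → ℕ :=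
  Function.update a f (Function.update (a f) i v)

theorem updateArr_apply (a : ℕ → ℕ → ℕ) (f i v g j : ℕ) :
    updateArr a f i v g j = if g = f ∧ j = i then v else a g j := by
  unfold updateArr
  by_cases h : g = f
  · subst h; simp [Function.update_apply]
  · simp [h]

/-- Programs in sequence. -/
def block : List Prog → Prog
  | [] => .skip
  | p :: ps => .seq p (block ps)

section

variable {l : List ℕ} {s : ℕ → ℕ} {a : ℕ → ℕ → ℕ} {B : ℕ}
  {Q : (ℕ → ℕ) → (ℕ → ℕ → ℕ) → Prop}

variable {k : ℕ}

theorem runs_block_nil (h : Q s a) : Runs l B (block []) ((block []).units * (k + 1)) s a Q :=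
  (runs_skip h).mono (Nat.le_mul_of_pos_right _ (Nat.succ_pos k)) fun _ _ h => h

theorem runs_block_cons {p : Prog} {ps : List Prog}
    (h : Runs l B p (p.units * (k + 1)) s a fun s a =>
      Runs l B (block ps) ((block ps).units * (k + 1)) s a Q) :
    Runs l B (block (p :: ps)) ((block (p :: ps)).units * (k + 1)) s a Q :=
  (Runs.seq h).mono (add_mul _ _ _).ge fun _ _ h => h

theorem runs_reg {c : ℕ} {e : Expr} {ps : List Prog} (v : ℕ) (hv : e.eval (mem l s a) = v)
    (hc : c < 32) (hB : Bounded l B s a → v < 2 ^ B)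
    (h : Runs l B (block ps) ((block ps).units * (k + 1)) (Function.update s c v) a Q) :
    Runs l B (block (setReg c e :: ps)) ((block (setReg c e :: ps)).units * (k + 1)) s a Q :=
  runs_block_cons ((runs_setReg v hv hc hB h).mono
    (Nat.le_mul_of_pos_right _ (Nat.succ_pos k)) fun _ _ h => h)

theorem runs_arr {f : ℕ} {i e : Expr} {ps : List Prog} (j v : ℕ) (hj : i.eval (mem l s a) = j)
    (hv : e.eval (mem l s a) = v) (hf : f < 8) (hB : Bounded l B s a → v < 2 ^ B)
    (h : Runs l B (block ps) ((block ps).units * (k + 1)) s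
      (updateArr a f j v) Q) :
    Runs l B (block (setArr f i e :: ps)) ((block (setArr f i e :: ps)).units * (k + 1)) s a Q :=
  runs_block_cons ((runs_setArr j v hj hv hf hB h).mono
    (Nat.le_mul_of_pos_right _ (Nat.succ_pos k)) fun _ _ h => h)

end

/-! ### Reading the instance -/

/-- Reads the edge at position `reg 1` of the input, and adds it to the data in `reg 4` to
`reg 8`. The register 9 receives the position of the table of the edge, whose first entry is the
fraction behind it; register 1 is moved behind the whole table. -/
def edgeBody : Prog := block
  [setReg 9 (add (add (reg 1) (lit 3)) (inp (add (reg 1) (lit 2)))),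
   setReg 10 (sub (inp (add (reg 9) (lit 2))) (inp (add (reg 9) (lit 1)))),
   setReg 5 (mul (reg 5) (reg 10)),
   setReg 4 (add (mul (mul (reg 4) (inp (add (reg 9) (lit 2)))) (inp (add (reg 1) (lit 1))))
     (mul (mul (reg 5) (inp (reg 1))) (reg 8))),
   setReg 6 (add (mul (reg 6) (inp (add (reg 1) (lit 1)))) (mul (inp (reg 1)) (reg 8))),
   setReg 7 (mul (reg 7) (inp (add (reg 9) (lit 2)))),
   setReg 8 (mul (reg 8) (inp (add (reg 1) (lit 1)))),
   setReg 1 (add (add (reg 9) (lit 1)) (mul (lit 2) (inp (reg 9)))),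
   setReg 3 (sub (reg 3) (lit 1))]

/-- Reads `reg 3` edges. -/
def edgesLoop : Prog := whileNonzero (reg 3) edgeBody

/-- Reads the path number `reg 2`, and stores its data at this index in the arrays: the numerator
and the denominator of its index in the arrays 0 and 1, its success probability in the arrays 2 and
3, the denominator of its weight in array 4, and its length in array 5. -/
def pathBody : Prog := block
  [setReg 3 (inp (reg 1)),
   setReg 1 (add (reg 1) (lit 1)),
   setReg 4 (lit 0), setReg 5 (lit 1), setReg 6 (lit 0), setReg 7 (lit 1), setReg 8 (lit 1),
   setReg 11 (reg 3),
   edgesLoop,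
   setArr 0 (reg 2) (sub (mul (lit 2) (reg 4)) (mul (reg 5) (reg 6))),
   setArr 1 (reg 2) (mul (reg 8) (reg 5)),
   setArr 2 (reg 2) (reg 5),
   setArr 3 (reg 2) (reg 7),
   setArr 4 (reg 2) (reg 8),
   setArr 5 (reg 2) (reg 11),
   setReg 2 (add (reg 2) (lit 1)),
   setReg 0 (sub (reg 0) (lit 1))]

/-- Reads `reg 0` paths. -/
def pathsLoop : Prog := whileNonzero (reg 0) pathBody

/-- Reads the instance. Afterwards `reg 1` is the position behind it, and `reg 2` is the number of
paths. -/
def parse : Prog := block [setReg 0 (inp (lit 0)), setReg 1 (lit 1), pathsLoop]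

/-- The registers contain the data `d` of the edges read so far. -/
def HasData (s : ℕ → ℕ) (d : PathData) : Prop :=
  s 4 = d.g ∧ s 5 = d.s ∧ s 6 = d.w ∧ s 7 = d.q ∧ s 8 = d.v

section

variable {l : List ℕ} {s : ℕ → ℕ} {a : ℕ → ℕ → ℕ} {B : ℕ}

theorem drop_add_length {α : Type} {l xs ys : List α} {p : ℕ} (h : l.drop p = xs ++ ys) :
    l.drop (p + xs.length) = ys := by
  rw [← List.drop_drop, h, List.drop_left]

theorem length_le_of_drop {α : Type} {l xs ys : List α} {p : ℕ} (h : l.drop p = xs ++ ys)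
    (hx : 0 < xs.length) : p + xs.length ≤ l.length := by
  have := congrArg List.length h
  simp only [List.length_drop, List.length_append] at this
  omega

/-- The parts of the encoding of an edge that matter: only the first row of its table is read. -/
theorem encode_eq {d : EdgeSpec} (hd : d.table ≠ []) : ∃ rest,
    d.encode = [d.weight.num, d.weight.den, d.parents.length] ++ d.parents ++
      ([d.table.length, d.head.num, d.head.den] ++ rest) ∧
      d.encode.length = 4 + d.parents.length + 2 * d.table.length := by
  have hflat : ∀ t : List ℚ≥0, (t.flatMap encodeRat).length = 2 * t.length := fun t => by
    induction t with
    | nil => rfl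
    | cons q t ih => simp only [List.flatMap_cons, List.length_append, ih, encodeRat,
        List.length_cons, List.length_nil]; ring
  have hpar : d.parents.flatMap (fun p => [p]) = d.parents := by
    simp [List.flatMap_singleton']
  obtain ⟨q, t, ht⟩ := List.exists_cons_of_ne_nil hd
  refine ⟨t.flatMap encodeRat, ?_, ?_⟩
  · simp [EdgeSpec.encode, encodeList, hpar, EdgeSpec.head, ht, encodeRat]
  · simp only [EdgeSpec.encode, encodeList, hpar, List.length_append, encodeRat, List.length_cons,
      List.length_nil, hflat]
    ring

theorem runs_edgeBody {d : EdgeSpec} (hd : d.table ≠ []) {rest : List ℕ} {p M : ℕ}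
    (hdrop : l.drop p = d.encode ++ rest) (hp : s 1 = p) {D : PathData} (hD : HasData s D)
    (hM : (D.step d).Small M) (hMB : M < 2 ^ B) :
    Runs l B edgeBody (edgeBody.units * (0 + 1)) s a fun s' a' => a' = a ∧
      s' 1 = p + d.encode.length ∧ s' 3 = s 3 - 1 ∧ HasData s' (D.step d) ∧
      ∀ c, c ≠ 1 → c ≠ 3 → (c < 4 ∨ 10 < c) → s' c = s c := by
  obtain ⟨tl, henc, hlen⟩ := encode_eq hd
  have hple := length_le_of_drop hdrop (by omega)
  have hdrop1 := hdrop
  rw [henc, List.append_assoc, List.append_assoc] at hdrop1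
  have hdrop2 := drop_add_length (xs := [d.weight.num, d.weight.den, d.parents.length] ++ d.parents)
    (ys := [d.table.length, d.head.num, d.head.den] ++ (tl ++ rest))
    (by rw [hdrop1]; simp only [List.append_assoc])
  set T := p + ([d.weight.num, d.weight.den, d.parents.length] ++ d.parents).length with hT
  have hT' : T = p + 3 + d.parents.length := by
    rw [hT]; simp only [List.length_append, List.length_cons, List.length_nil]; omega
  have r0 : ∀ s a, mem l s a (p + 1) = d.weight.num := mem_succ_of_drop (k := 0) hdrop1 (by simp)
  have r1 : ∀ s a, mem l s a (p + 2) = d.weight.den := mem_succ_of_drop (k := 1) hdrop1 (by simp)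
  have r2 : ∀ s a, mem l s a (p + 3) = d.parents.length :=
    mem_succ_of_drop (k := 2) hdrop1 (by simp)
  have t0 : ∀ s a, mem l s a (T + 1) = d.table.length := mem_succ_of_drop (k := 0) hdrop2 (by simp)
  have t1 : ∀ s a, mem l s a (T + 2) = d.head.num := mem_succ_of_drop (k := 1) hdrop2 (by simp)
  have t2 : ∀ s a, mem l s a (T + 3) = d.head.den := mem_succ_of_drop (k := 2) hdrop2 (by simp)
  obtain ⟨h4, h5, h6, h7, h8⟩ := hD
  unfold edgeBody
  refine runs_reg T (by simp [eval, eval_reg, eval_inp, hp, r2, hT']) (by norm_num)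
    (fun hb => lt_of_le_of_lt (by omega) hb.length) ?_
  refine runs_reg (d.head.den - d.head.num) (by simp [eval, eval_reg, eval_inp, t1, t2])
    (by norm_num) (fun hb => lt_of_le_of_lt (Nat.sub_le _ _)
      (t2 (Function.update s 9 T) a ▸ hb.mem (T + 3))) ?_
  refine runs_reg (D.step d).s (by simp [eval, eval_reg, h5, PathData.step]) (by norm_num)
    (fun _ => hM.s_le_cap.trans_lt hMB) ?_
  refine runs_reg (D.step d).g (by
    simp [eval, eval_reg, eval_inp, h4, h8, hp, t2, r0, r1, PathData.step]) (by norm_num)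
    (fun _ => hM.g_le.trans_lt hMB) ?_
  refine runs_reg (D.step d).w (by
    simp [eval, eval_reg, eval_inp, h6, h8, hp, r0, r1, PathData.step]) (by norm_num)
    (fun _ => hM.w_le_cap.trans_lt hMB) ?_
  refine runs_reg (D.step d).q (by
    simp [eval, eval_reg, eval_inp, h7, t2, PathData.step]) (by norm_num)
    (fun _ => hM.q_le_cap.trans_lt hMB) ?_
  refine runs_reg (D.step d).v (by
    simp [eval, eval_reg, eval_inp, h8, hp, r1, PathData.step]) (by norm_num)
    (fun _ => hM.v_le_cap.trans_lt hMB) ?_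
  refine runs_reg (p + d.encode.length) (by
    simp [eval, eval_reg, eval_inp, t0, hlen]; omega) (by norm_num)
    (fun hb => lt_of_le_of_lt hple hb.length) ?_
  refine runs_reg (s 3 - 1) (by simp [eval, eval_reg]) (by norm_num)
    (fun hb => lt_of_le_of_lt (Nat.sub_le _ _) (by simpa using hb.reg 3)) ?_
  refine runs_block_nil ⟨rfl, by simp, by simp, by simp [HasData], fun c h1 h3 hc => ?_⟩
  have : c ≠ 4 ∧ c ≠ 5 ∧ c ≠ 6 ∧ c ≠ 7 ∧ c ≠ 8 ∧ c ≠ 9 ∧ c ≠ 10 := by omega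
  simp [Function.update_of_ne, *]

/-- The loop started with the data `D` of the edges before `es`, which are bounded by `M`. -/
theorem runs_edgesLoop (es : List EdgeSpec) : ∀ {s : ℕ → ℕ} {p M : ℕ} {rest : List ℕ}
    {D : PathData}, (∀ d ∈ es, d.table ≠ []) → l.drop p = es.flatMap EdgeSpec.encode ++ rest →
    s 1 = p → s 3 = es.length → HasData s D → D.Small M → M * pathCap es < 2 ^ B →
    Runs l B edgesLoop (edgesLoop.units * (es.length + 1)) s a fun s' a' => a' = a ∧
      s' 1 = p + (es.flatMap EdgeSpec.encode).length ∧
      HasData s' (es.foldl PathData.step D) ∧ ∀ c, c ≠ 1 → c ≠ 3 → (c < 4 ∨ 10 < c) →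
        s' c = s c := by
  induction es with
  | nil =>
    intro s p M rest D _ _ hp hs hD _ _
    refine (runs_while_false (by simpa [eval_reg] using hs) ⟨rfl, by simpa using hp, hD,
      fun _ _ _ _ => rfl⟩).mono ?_ fun _ _ h => h
    simp [edgesLoop, Prog.units]
  | cons d es ih =>
    intro s p M rest D hes hdrop hp hs hD hM hB
    rw [List.flatMap_cons, List.append_assoc] at hdrop
    have hM' := hM.step d
    have hcap : pathCap (d :: es) = d.cap * pathCap es := by simp [pathCap]
    rw [hcap, ← mul_assoc] at hB
    have hpos := pathCap_pos es
    refine (runs_while_true (n := edgeBody.units * (0 + 1)) (m := edgesLoop.units * (es.length + 1))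
      (by simp [eval_reg, hs]) ((runs_edgeBody (hes d (by simp)) hdrop hp hD hM'
        (lt_of_le_of_lt (Nat.le_mul_of_pos_right _ hpos) hB)).mono le_rfl ?_)).mono ?_
      fun _ _ h => h
    · rintro s' a' ⟨rfl, h1, h3, hD', hfr⟩
      have := ih (s := s') (fun d hd => hes d (by simp [hd])) (drop_add_length hdrop) h1
        (by rw [h3, hs]; simp) hD' hM' hB
      refine this.mono le_rfl ?_
      rintro s'' a'' ⟨rfl, h1', hD'', hfr'⟩
      refine ⟨rfl, ?_, hD'', fun c e1 e3 ec => (hfr' c e1 e3 ec).trans (hfr c e1 e3 ec)⟩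
      rw [h1', List.flatMap_cons, List.length_append, add_assoc]
    · simp only [edgesLoop, Prog.units, List.length_cons]
      ring_nf
      omega

/-- The arrays contain at index `i` the data of the path with the edges `es`. -/
structure HasPath (a : ℕ → ℕ → ℕ) (i : ℕ) (es : List EdgeSpec) : Prop where
  c : a 0 i = (pathData es).c
  u : a 1 i = (pathData es).u
  s : a 2 i = (pathData es).s
  q : a 3 i = (pathData es).q
  v : a 4 i = (pathData es).v
  n : a 5 i = es.length

theorem runs_pathBody {es : List EdgeSpec} {p i : ℕ} {rest : List ℕ}
    (hes : ∀ d ∈ es, d.table ≠ [])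
    (hdrop : l.drop p = encodeList EdgeSpec.encode es ++ rest) (hp : s 1 = p) (hi : s 2 = i)
    (hB : 2 * pathCap es < 2 ^ B) (hiB : i + 1 < 2 ^ B) :
    Runs l B pathBody (pathBody.units * (es.length + 1)) s a fun s' a' =>
      s' 0 = s 0 - 1 ∧ s' 1 = p + (encodeList EdgeSpec.encode es).length ∧ s' 2 = i + 1 ∧
      HasPath a' i es ∧ ∀ f j, j ≠ i → a' f j = a f j := by
  have hpos := pathCap_pos es
  have hsm := small_pathData es
  have hone : 1 < 2 ^ B := by omega
  have hcap : pathCap es < 2 ^ B := by omega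
  have hn : ∀ s a, mem l s a (p + 1) = es.length :=
    mem_succ_of_drop (k := 0) (as := encodeList EdgeSpec.encode es) hdrop (by simp [encodeList])
  have hdrop' : l.drop (p + 1) = es.flatMap EdgeSpec.encode ++ rest :=
    drop_add_length (xs := [es.length]) hdrop
  have hple := length_le_of_drop hdrop (by simp [encodeList])
  have hlen : (encodeList EdgeSpec.encode es).length =
      (es.flatMap EdgeSpec.encode).length + 1 := rfl
  unfold pathBody
  refine runs_reg es.length (by simp [eval_reg, eval_inp, hp, hn]) (by norm_num)
    (fun hb => hn s a ▸ hb.mem (p + 1)) ?_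
  refine runs_reg (p + 1) (by simp [eval, eval_reg, hp]) (by norm_num)
    (fun hb => lt_of_le_of_lt (by omega) hb.length) ?_
  refine runs_reg 0 rfl (by norm_num) (fun _ => by omega) ?_
  refine runs_reg 1 rfl (by norm_num) (fun _ => by omega) ?_
  refine runs_reg 0 rfl (by norm_num) (fun _ => by omega) ?_
  refine runs_reg 1 rfl (by norm_num) (fun _ => by omega) ?_
  refine runs_reg 1 rfl (by norm_num) (fun _ => by omega) ?_
  refine runs_reg es.length (by simp [eval_reg]) (by norm_num)
    (fun hb => by simpa using hb.reg 3) ?_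
  refine runs_block_cons ((runs_edgesLoop es (p := p + 1) (M := 1) (rest := rest)
    (D := PathData.init) hes hdrop' (by simp) (by simp) (by simp [HasData, PathData.init])
    PathData.small_init (by omega)).mono le_rfl ?_)
  rintro s' a' ⟨rfl, h1, ⟨h4, h5, h6, h7, h8⟩, hfr⟩
  have f0 : s' 0 = s 0 := by rw [hfr 0 (by norm_num) (by norm_num) (by norm_num)]; simp
  have f2 : s' 2 = i := by rw [hfr 2 (by norm_num) (by norm_num) (by norm_num)]; simp [hi]
  have f11 : s' 11 = es.length := by
    rw [hfr 11 (by norm_num) (by norm_num) (by norm_num)]; simp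
  change s' 4 = (pathData es).g at h4
  change s' 5 = (pathData es).s at h5
  change s' 6 = (pathData es).w at h6
  change s' 7 = (pathData es).q at h7
  change s' 8 = (pathData es).v at h8
  have ei : ∀ a, (reg 2).eval (mem l s' a) = i := fun a => by simp [eval_reg, f2]
  refine runs_arr i (pathData es).c (ei _) (by simp [eval, eval_reg, h4, h5, h6, PathData.c])
    (by norm_num) (fun _ => hsm.c_le.trans_lt hB) ?_
  refine runs_arr i (pathData es).u (ei _) (by simp [eval, eval_reg, h5, h8, PathData.u])
    (by norm_num) (fun _ => hsm.u_le_cap.trans_lt hcap) ?_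
  refine runs_arr i (pathData es).s (ei _) (by simp [eval_reg, h5])
    (by norm_num) (fun _ => hsm.s_le_cap.trans_lt hcap) ?_
  refine runs_arr i (pathData es).q (ei _) (by simp [eval_reg, h7])
    (by norm_num) (fun _ => hsm.q_le_cap.trans_lt hcap) ?_
  refine runs_arr i (pathData es).v (ei _) (by simp [eval_reg, h8])
    (by norm_num) (fun _ => hsm.v_le_cap.trans_lt hcap) ?_
  refine runs_arr i es.length (ei _) (by simp [eval_reg, f11])
    (by norm_num) (fun hb => f11 ▸ hb.reg 11) ?_
  refine runs_reg (i + 1) (by simp [eval, eval_reg, f2]) (by norm_num) (fun _ => hiB) ?_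
  refine runs_reg (s 0 - 1) (by simp [eval, eval_reg, f0]) (by norm_num)
    (fun hb => lt_of_le_of_lt (Nat.sub_le _ _) (by simpa [f0] using hb.reg 0)) ?_
  refine runs_block_nil ⟨by simp, by simp [h1, hlen]; omega, by simp, ?_, fun f j hj => ?_⟩
  · constructor <;> simp [updateArr_apply]
  · simp [updateArr_apply, hj]

/-- The loop started at index `i`; the entries of the arrays at smaller indices are kept. -/
theorem runs_pathsLoop (ps : List (List EdgeSpec)) : ∀ {s : ℕ → ℕ} {a : ℕ → ℕ → ℕ} {p i : ℕ}
    {rest : List ℕ}, (∀ es ∈ ps, ∀ d ∈ es, d.table ≠ []) →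
    l.drop p = ps.flatMap (encodeList EdgeSpec.encode) ++ rest → s 0 = ps.length → s 1 = p →
    s 2 = i → (∀ es ∈ ps, 2 * pathCap es < 2 ^ B) → i + ps.length < 2 ^ B →
    Runs l B pathsLoop
      (pathsLoop.units * ((ps.flatMap (encodeList EdgeSpec.encode)).length + 1)) s a
      fun s' a' => s' 1 = p + (ps.flatMap (encodeList EdgeSpec.encode)).length ∧
        s' 2 = i + ps.length ∧ (∀ j (h : j < ps.length), HasPath a' (i + j) ps[j]) ∧
        ∀ f j, j < i → a' f j = a f j := by
  induction ps with
  | nil =>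
    intro s a p i rest _ _ h0 h1 h2 _ _
    refine (runs_while_false (by simpa [eval_reg] using h0) ⟨by simpa using h1, by simpa using h2,
      by simp, fun _ _ _ => rfl⟩).mono ?_ fun _ _ h => h
    simp [pathsLoop, Prog.units]
  | cons es ps ih =>
    intro s a p i rest hps hdrop h0 h1 h2 hB hiB
    rw [List.flatMap_cons, List.append_assoc] at hdrop
    rw [List.length_cons] at hiB
    refine (runs_while_true (n := pathBody.units * (es.length + 1))
      (m := pathsLoop.units * ((ps.flatMap (encodeList EdgeSpec.encode)).length + 1))
      (by simp [eval_reg, h0]) ((runs_pathBody (hps es (by simp)) hdrop h1 h2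
        (hB es (by simp)) (by omega)).mono le_rfl ?_)).mono ?_ fun _ _ h => h
    · rintro s' a' ⟨h0', h1', h2', hpath, hfr⟩
      have := ih (s := s') (a := a') (fun es hes => hps es (by simp [hes]))
        (drop_add_length hdrop) (by rw [h0', h0]; simp) h1' h2'
        (fun es hes => hB es (by simp [hes])) (by omega)
      refine this.mono le_rfl ?_
      rintro s'' a'' ⟨h1'', h2'', hpath', hfr'⟩
      refine ⟨?_, ?_, fun j hj => ?_, fun f j hj => ?_⟩
      · rw [h1'', List.flatMap_cons, List.length_append, add_assoc]
      · rw [h2'', List.length_cons]; omega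
      · cases j with
        | zero =>
          have e : ∀ f, a'' f i = a' f i := fun f => hfr' f i (Nat.lt_succ_self i)
          obtain ⟨e0, e1, e2, e3, e4, e5⟩ := hpath
          exact ⟨(e _).trans e0, (e _).trans e1, (e _).trans e2, (e _).trans e3, (e _).trans e4,
            (e _).trans e5⟩
        | succ j =>
          have := hpath' j (by simpa using hj)
          rw [add_right_comm, add_assoc] at this
          exact this
      · rw [hfr' f j (by omega), hfr f j (by omega)]
    · have hlen : es.length ≤ (es.flatMap EdgeSpec.encode).length := by
        rw [List.length_flatMap]
        refine le_trans (le_of_eq ?_) (List.length_le_sum_of_one_le _ ?_)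
        · rw [List.length_map]
        · intro n hn
          obtain ⟨d, -, rfl⟩ := List.mem_map.1 hn
          simp [EdgeSpec.encode, encodeRat]
      have hx : (encodeList EdgeSpec.encode es).length =
        (es.flatMap EdgeSpec.encode).length + 1 := rfl
      simp only [pathsLoop, Prog.units, List.flatMap_cons, List.length_append, hx]
      generalize (es.flatMap EdgeSpec.encode).length = x at *
      generalize (ps.flatMap (encodeList EdgeSpec.encode)).length = y at *
      have h3 : pathBody.units * (es.length + 1) ≤ pathBody.units * (x + 1) :=
        Nat.mul_le_mul_left _ (by omega)
      have h4 : (reg 0).units + 1 ≤ ((reg 0).units + 1) * (x + 1) :=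
        Nat.le_mul_of_pos_right _ (Nat.succ_pos x)
      calc _ ≤ ((reg 0).units + 1) * (x + 1) + (pathBody.units * (x + 1) +
            ((reg 0).units + 1 + pathBody.units) * (y + 1)) := by gcongr
        _ = _ := by ring

/-- A table has a row even if there are no parents. -/
theorem _root_.CTPForDep.table_ne_nil (I : CTPForDep) :
    ∀ es ∈ I.paths, ∀ d ∈ es, d.table ≠ [] := fun es hes d hd h => by
  obtain ⟨j, hj, rfl⟩ := List.getElem_of_mem hd
  have := (I.valid es hes j hj).table_length
  rw [h] at this
  exact absurd this.symm (by simp)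

theorem runs_parse {I : CTPForDep} {rest : List ℕ} (hl : l = I.encode ++ rest)
    (h2 : s 2 = 0) (hB : ∀ es ∈ I.paths, 2 * pathCap es < 2 ^ B) (hiB : I.numPaths < 2 ^ B)
    (hone : 1 < 2 ^ B) :
    Runs l B parse (parse.units * (I.encode.length + 1)) s a fun s' a' =>
      s' 1 = I.encode.length ∧ s' 2 = I.numPaths ∧
        ∀ i : Fin I.numPaths, HasPath a' i I.paths[i] := by
  have hdrop : l.drop 0 = [I.numPaths] ++
      (I.paths.flatMap (encodeList EdgeSpec.encode) ++ rest) := by rw [hl]; rfl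
  have hn : ∀ s a, mem l s a 1 = I.numPaths := mem_succ_of_drop (k := 0) hdrop (by simp)
  have hdrop' := drop_add_length hdrop
  have hlen : I.encode.length = (I.paths.flatMap (encodeList EdgeSpec.encode)).length + 1 := rfl
  unfold parse
  refine runs_reg I.numPaths (by simp [eval, eval_inp, hn]) (by norm_num) (fun _ => hiB) ?_
  refine runs_reg 1 rfl (by norm_num) (fun _ => hone) ?_
  refine runs_block_cons ((runs_pathsLoop I.paths (p := 1) (i := 0) I.table_ne_nil hdrop' (by simp)
    (by simp) (by simp [h2]) hB (by simpa using hiB)).mono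
      (Nat.mul_le_mul_left _ (by omega)) ?_)
  rintro s' a' ⟨h1, h2, hpath, -⟩
  refine runs_block_nil ⟨by rw [h1, hlen, add_comm], by simpa using h2, fun i => ?_⟩
  have := hpath i i.2
  rw [zero_add] at this
  exact this

end

end RAM

namespace RAM

open RAM.Expr RAM.Prog

/-! ### Reading the belief state -/

section

variable {l : List ℕ} {s : ℕ → ℕ} {a : ℕ → ℕ → ℕ} {B k : ℕ}
  {Q : (ℕ → ℕ) → (ℕ → ℕ → ℕ) → Prop}

theorem runs_block_if {e : Expr} {p q : Prog} {ps : List Prog}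
    (h1 : e.eval (mem l s a) ≠ 0 → Runs l B p (p.units * (k + 1)) s a fun s a =>
      Runs l B (block ps) ((block ps).units * (k + 1)) s a Q)
    (h2 : e.eval (mem l s a) = 0 → Runs l B q (q.units * (k + 1)) s a fun s a =>
      Runs l B (block ps) ((block ps).units * (k + 1)) s a Q) :
    Runs l B (block (ifNonzero e p q :: ps)) ((block (ifNonzero e p q :: ps)).units * (k + 1))
      s a Q := by
  refine runs_block_cons ((runs_if h1 h2).mono ?_ fun _ _ h => h)
  have : e.units + 1 ≤ (e.units + 1) * (k + 1) := Nat.le_mul_of_pos_right _ (Nat.succ_pos k)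
  simp only [Prog.units]
  calc _ ≤ (e.units + 1) * (k + 1) + (p.units * (k + 1) + q.units * (k + 1)) := by gcongr
    _ = _ := by ring

end

/-- Reads the status of an edge; if it is blocked, which is encoded as 2, the denominator of the
index of its path becomes 0. -/
def statusBody : Prog := block
  [ifNonzero (sub (inp (reg 1)) (lit 1)) (block [setArr 1 (reg 2) (lit 0)]) (block []),
   setReg 1 (add (reg 1) (lit 1)),
   setReg 3 (sub (reg 3) (lit 1))]

/-- Reads the statuses of `reg 3` edges. -/
def statusLoop : Prog := whileNonzero (reg 3) statusBody

/-- Reads the statuses of the edges of a path. -/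
def pathStatusBody : Prog := block
  [setReg 3 (arr 5 (reg 2)),
   statusLoop,
   setReg 2 (add (reg 2) (lit 1)),
   setReg 0 (sub (reg 0) (lit 1))]

/-- Reads the statuses of the edges of `reg 0` paths. -/
def pathStatusLoop : Prog := whileNonzero (reg 0) pathStatusBody

/-- Compares the index of the path `reg 2` with the least index so far. -/
def bestBody : Prog := block
  [ifNonzero (sub (mul (reg 14) (arr 1 (reg 2))) (mul (arr 0 (reg 2)) (reg 15)))
     (block [setReg 13 (reg 2), setReg 14 (arr 0 (reg 2)), setReg 15 (arr 1 (reg 2))]) (block []),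
   setReg 2 (add (reg 2) (lit 1)),
   setReg 0 (sub (reg 0) (lit 1))]

/-- Does this for `reg 0` paths. -/
def bestLoop : Prog := whileNonzero (reg 0) bestBody

/-- Finds the least index; `reg 2` is the number of paths. The registers 13 to 15 receive the number
of the path, and the numerator and the denominator of its index. -/
def best : Prog := block
  [setReg 13 (lit 0), setReg 14 (lit 1), setReg 15 (lit 0), setReg 0 (reg 2), setReg 2 (lit 0),
   bestLoop]

/-- Computes the move of the optimal policy. The register 12 points to the location of the agent,
which is encoded as `[2, i, j]` if it is an inner vertex, and starts with 0 or 1 otherwise; it is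
followed by the statuses. -/
def move : Prog := block
  [parse,
   setReg 12 (reg 1),
   setReg 1 (add (reg 1) (lit 3)),
   setReg 0 (reg 2),
   setReg 2 (lit 0),
   pathStatusLoop,
   best,
   ifNonzero (sub (inp (reg 12)) (lit 1))
     (block
       [setReg 16 (inp (add (reg 12) (lit 1))),
        setReg 17 (inp (add (reg 12) (lit 2))),
        ifNonzero (arr 1 (reg 16)) (block [setReg 17 (add (reg 17) (lit 1))]) (block [])])
     (block [setReg 16 (reg 13), setReg 17 (lit 0)])]

section

variable {l : List ℕ} {B : ℕ}

/-- The loop makes the denominator of the index of path `i` 0 if one of the statuses `st` is the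
code 2 of a blocked edge, and changes nothing else in the arrays. -/
theorem runs_statusLoop (st : List ℕ) : ∀ {s : ℕ → ℕ} {a : ℕ → ℕ → ℕ} {p i : ℕ} {rest : List ℕ},
    l.drop p = st ++ rest → s 1 = p → s 2 = i → s 3 = st.length →
    Runs l B statusLoop (statusLoop.units * (st.length + 1)) s a fun s' a' =>
      s' 1 = p + st.length ∧ (∀ c, c ≠ 1 → c ≠ 3 → s' c = s c) ∧
      ((a' 1 i = 0 ∧ ∃ v ∈ st, 2 ≤ v) ∨ (a' 1 i = a 1 i ∧ ¬ ∃ v ∈ st, 2 ≤ v)) ∧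
      ∀ f j, (f ≠ 1 ∨ j ≠ i) → a' f j = a f j := by
  induction st with
  | nil =>
    intro s a p i rest _ h1 h2 h3
    refine (runs_while_false (by simpa [eval_reg] using h3) ⟨by simpa using h1, fun _ _ _ => rfl,
      by simp, fun _ _ _ => rfl⟩).mono ?_ fun _ _ h => h
    simp [statusLoop, Prog.units]
  | cons v st ih =>
    intro s a p i rest hdrop h1 h2 h3
    have hv : ∀ s a, mem l s a (p + 1) = v := mem_succ_of_drop (k := 0) hdrop (by simp)
    have hple := length_le_of_drop hdrop (by simp)
    have hdrop' : l.drop (p + 1) = st ++ rest := drop_add_length (xs := [v]) hdrop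
    rw [List.length_cons] at hple h3
    have hbody : Runs l B statusBody (statusBody.units * (0 + 1)) s a fun s' a' =>
        s' 1 = p + 1 ∧ s' 2 = i ∧ s' 3 = st.length ∧ (∀ c, c ≠ 1 → c ≠ 3 → s' c = s c) ∧
        ((a' 1 i = 0 ∧ 2 ≤ v) ∨ (a' 1 i = a 1 i ∧ ¬ 2 ≤ v)) ∧
        ∀ f j, (f ≠ 1 ∨ j ≠ i) → a' f j = a f j := by
      have hend : ∀ a', ((a' 1 i = 0 ∧ 2 ≤ v) ∨ (a' 1 i = a 1 i ∧ ¬ 2 ≤ v)) →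
          (∀ f j, (f ≠ 1 ∨ j ≠ i) → a' f j = a f j) →
          Runs l B (block [setReg 1 (add (reg 1) (lit 1)), setReg 3 (sub (reg 3) (lit 1))])
            ((block [setReg 1 (add (reg 1) (lit 1)), setReg 3 (sub (reg 3) (lit 1))]).units *
              (0 + 1)) s a' fun s' a' =>
            s' 1 = p + 1 ∧ s' 2 = i ∧ s' 3 = st.length ∧ (∀ c, c ≠ 1 → c ≠ 3 → s' c = s c) ∧
            ((a' 1 i = 0 ∧ 2 ≤ v) ∨ (a' 1 i = a 1 i ∧ ¬ 2 ≤ v)) ∧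
            ∀ f j, (f ≠ 1 ∨ j ≠ i) → a' f j = a f j := by
        intro a' ha hfr
        refine runs_reg (p + 1) (by simp [eval, eval_reg, h1]) (by norm_num)
          (fun hb => lt_of_le_of_lt (by omega) hb.length) ?_
        refine runs_reg st.length (by simp [eval, eval_reg, h3]) (by norm_num)
          (fun hb => lt_of_le_of_lt (by omega) hb.length) ?_
        exact runs_block_nil ⟨by simp, by simp [h2], by simp,
          fun c e1 e3 => by simp [Function.update_of_ne, *], ha, hfr⟩
      unfold statusBody
      refine runs_block_if (fun hne => ?_) fun he => ?_
      · have hv2 : 2 ≤ v := by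
          simp [eval, eval_reg, eval_inp, h1, hv] at hne
          omega
        refine runs_arr i 0 (by simp [eval_reg, h2]) rfl (by norm_num)
          (fun _ => Nat.pow_pos (by norm_num)) ?_
        refine runs_block_nil (hend _ (Or.inl ⟨by simp [updateArr_apply], hv2⟩) fun f j h => ?_)
        rw [updateArr_apply, if_neg (by tauto)]
      · have hv2 : ¬ 2 ≤ v := by
          simp [eval, eval_reg, eval_inp, h1, hv] at he
          omega
        exact runs_block_nil (hend a (Or.inr ⟨rfl, hv2⟩) fun _ _ _ => rfl)
    refine (runs_while_true (n := statusBody.units * (0 + 1))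
      (m := statusLoop.units * (st.length + 1)) (by simp [eval_reg, h3])
      (hbody.mono le_rfl ?_)).mono ?_ fun _ _ h => h
    · rintro s' a' ⟨h1', h2', h3', hfr, ha, haf⟩
      refine (ih hdrop' h1' h2' h3').mono le_rfl ?_
      rintro s'' a'' ⟨h1'', hfr', ha', haf'⟩
      refine ⟨by rw [h1'', List.length_cons]; omega,
        fun c e1 e3 => (hfr' c e1 e3).trans (hfr c e1 e3), ?_,
        fun f j h => (haf' f j h).trans (haf f j h)⟩
      simp only [List.mem_cons, exists_eq_or_imp]
      rcases ha with ⟨ha, hv⟩ | ⟨ha, hv⟩ <;> rcases ha' with ⟨ha', hv'⟩ | ⟨ha', hv'⟩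
      · exact Or.inl ⟨ha', Or.inl hv⟩
      · exact Or.inl ⟨ha'.trans ha, Or.inl hv⟩
      · exact Or.inl ⟨ha', Or.inr hv'⟩
      · exact Or.inr ⟨ha'.trans ha, fun h => h.elim hv hv'⟩
    · simp only [statusLoop, Prog.units, List.length_cons]
      ring_nf
      omega

theorem runs_pathStatusLoop (sts : List (List ℕ)) : ∀ {s : ℕ → ℕ} {a : ℕ → ℕ → ℕ} {p i : ℕ}
    {rest : List ℕ}, l.drop p = sts.flatten ++ rest → s 0 = sts.length → s 1 = p → s 2 = i →
    (∀ j (h : j < sts.length), a 5 (i + j) = sts[j].length) → i + sts.length < 2 ^ B →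
    Runs l B pathStatusLoop (pathStatusLoop.units * (sts.flatten.length + sts.length + 1)) s a
      fun s' a' => s' 2 = i + sts.length ∧ (∀ c, 4 ≤ c → s' c = s c) ∧
      (∀ j (h : j < sts.length), (a' 1 (i + j) = 0 ∧ ∃ v ∈ sts[j], 2 ≤ v) ∨
        (a' 1 (i + j) = a 1 (i + j) ∧ ¬ ∃ v ∈ sts[j], 2 ≤ v)) ∧
      ∀ f j, (f ≠ 1 ∨ j < i) → a' f j = a f j := by
  induction sts with
  | nil =>
    intro s a p i rest _ h0 h1 h2 _ _
    refine (runs_while_false (by simpa [eval_reg] using h0) ⟨by simpa using h2, fun _ _ => rfl,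
      by simp, fun _ _ _ => rfl⟩).mono ?_ fun _ _ h => h
    simp [pathStatusLoop, Prog.units]
  | cons st sts ih =>
    intro s a p i rest hdrop h0 h1 h2 h5 hB
    rw [List.flatten_cons, List.append_assoc] at hdrop
    rw [List.length_cons] at hB h0
    have h50 : a 5 i = st.length := h5 0 (by simp)
    have hbody : Runs l B pathStatusBody (pathStatusBody.units * (st.length + 1)) s a
        fun s' a' => s' 0 = sts.length ∧ s' 1 = p + st.length ∧ s' 2 = i + 1 ∧
        (∀ c, 4 ≤ c → s' c = s c) ∧
        ((a' 1 i = 0 ∧ ∃ v ∈ st, 2 ≤ v) ∨ (a' 1 i = a 1 i ∧ ¬ ∃ v ∈ st, 2 ≤ v)) ∧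
        ∀ f j, (f ≠ 1 ∨ j ≠ i) → a' f j = a f j := by
      unfold pathStatusBody
      refine runs_reg st.length (by simp [eval_reg, eval_arr, h2, h50]) (by norm_num)
        (fun hb => h50 ▸ hb.arr 5 i) ?_
      refine runs_block_cons ((runs_statusLoop st (i := i) hdrop (by simp [h1]) (by simp [h2])
        (by simp)).mono le_rfl ?_)
      rintro s' a' ⟨h1', hfr, ha, haf⟩
      have f0 : s' 0 = sts.length + 1 := by
        rw [hfr 0 (by norm_num) (by norm_num)]; simp [h0]
      have f2 : s' 2 = i := by
        rw [hfr 2 (by norm_num) (by norm_num)]; simp [h2]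
      refine runs_reg (i + 1) (by simp [eval, eval_reg, f2]) (by norm_num) (fun _ => by omega) ?_
      refine runs_reg sts.length (by simp [eval, eval_reg, f0]) (by norm_num)
        (fun _ => by omega) ?_
      refine runs_block_nil ⟨by simp, by simp [h1'], by simp, fun c hc => ?_, ha, haf⟩
      have e : c ≠ 0 ∧ c ≠ 1 ∧ c ≠ 2 ∧ c ≠ 3 := by omega
      rw [Function.update_of_ne e.1, Function.update_of_ne e.2.2.1, hfr c e.2.1 e.2.2.2,
        Function.update_of_ne e.2.2.2]
    refine (runs_while_true (n := pathStatusBody.units * (st.length + 1))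
      (m := pathStatusLoop.units * (sts.flatten.length + sts.length + 1)) (by simp [eval_reg, h0])
      (hbody.mono le_rfl ?_)).mono ?_ fun _ _ h => h
    · rintro s' a' ⟨h0', h1', h2', hfr, ha, haf⟩
      refine (ih (drop_add_length hdrop) h0' h1' h2' (fun j hj => ?_) (by omega)).mono le_rfl ?_
      · rw [haf 5 _ (Or.inl (by norm_num)), add_assoc, add_comm 1 j]
        exact h5 (j + 1) (by simpa using hj)
      · rintro s'' a'' ⟨h2'', hfr', ha', haf'⟩
        refine ⟨by rw [h2'', List.length_cons]; omega,
          fun c hc => (hfr' c hc).trans (hfr c hc), fun j hj => ?_, fun f j h => ?_⟩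
        · cases j with
          | zero =>
            rw [add_zero, haf' 1 i (Or.inr (Nat.lt_succ_self i))]
            exact ha
          | succ j =>
            have := ha' j (by simpa using hj)
            rw [haf 1 (i + 1 + j) (Or.inr (by omega)), add_right_comm, add_assoc] at this
            exact this
        · rw [haf' f j (h.imp_right (by omega)), haf f j (h.imp_right (by omega))]
    · simp only [pathStatusLoop, Prog.units, List.length_cons, List.flatten_cons,
        List.length_append]
      generalize sts.flatten.length = x
      generalize sts.length = y
      generalize st.length = z
      have h4 : (reg 0).units + 1 ≤ ((reg 0).units + 1) * (z + 1) :=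
        Nat.le_mul_of_pos_right _ (Nat.succ_pos z)
      calc _ ≤ ((reg 0).units + 1) * (z + 1) + (pathStatusBody.units * (z + 1) +
            ((reg 0).units + 1 + pathStatusBody.units) * (x + y + 1)) := by gcongr
        _ = _ := by ring

/-- The registers contain the result of `bestUpTo`. -/
def HasBest (s : ℕ → ℕ) (r : ℕ × ℕ × ℕ) : Prop := s 13 = r.1 ∧ s 14 = r.2.1 ∧ s 15 = r.2.2

/-- The loop started when the first `i` paths have been compared. -/
theorem runs_bestLoop (r : ℕ) : ∀ {s : ℕ → ℕ} {a : ℕ → ℕ → ℕ} {i : ℕ}, s 0 = r → s 2 = i →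
    HasBest s (bestUpTo (a 0) (a 1) i) → i + r < 2 ^ B →
    Runs l B bestLoop (bestLoop.units * (r + 1)) s a fun s' a' => a' = a ∧ s' 2 = i + r ∧
      HasBest s' (bestUpTo (a 0) (a 1) (i + r)) ∧ ∀ c, 16 ≤ c ∨ c = 12 → s' c = s c := by
  induction r with
  | zero =>
    intro s a i h0 h2 hbest _
    refine (runs_while_false (by simpa [eval_reg] using h0) ⟨rfl, by simpa using h2, hbest,
      fun _ _ => rfl⟩).mono ?_ fun _ _ h => h
    simp [bestLoop, Prog.units]
  | succ r ih =>
    intro s a i h0 h2 hbest hB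
    obtain ⟨h13, h14, h15⟩ := hbest
    have hbody : Runs l B bestBody (bestBody.units * (0 + 1)) s a fun s' a' => a' = a ∧
        s' 0 = r ∧ s' 2 = i + 1 ∧ HasBest s' (bestUpTo (a 0) (a 1) (i + 1)) ∧
        ∀ c, 16 ≤ c ∨ c = 12 → s' c = s c := by
      have hend : ∀ s', s' 0 = r + 1 → s' 2 = i → HasBest s' (bestUpTo (a 0) (a 1) (i + 1)) →
          (∀ c, 16 ≤ c ∨ c = 12 → s' c = s c) →
          Runs l B (block [setReg 2 (add (reg 2) (lit 1)), setReg 0 (sub (reg 0) (lit 1))])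
            ((block [setReg 2 (add (reg 2) (lit 1)), setReg 0 (sub (reg 0) (lit 1))]).units *
              (0 + 1)) s' a fun s' a' => a' = a ∧
            s' 0 = r ∧ s' 2 = i + 1 ∧ HasBest s' (bestUpTo (a 0) (a 1) (i + 1)) ∧
            ∀ c, 16 ≤ c ∨ c = 12 → s' c = s c := by
        intro s' h0' h2' hb hfr
        refine runs_reg (i + 1) (by simp [eval, eval_reg, h2']) (by norm_num)
          (fun _ => by omega) ?_
        refine runs_reg r (by simp [eval, eval_reg, h0']) (by norm_num) (fun _ => by omega) ?_
        refine runs_block_nil ⟨rfl, by simp, by simp, by simpa [HasBest] using hb, fun c hc => ?_⟩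
        rw [Function.update_of_ne (by omega), Function.update_of_ne (by omega), hfr c hc]
      have hcond : (sub (mul (reg 14) (arr 1 (reg 2))) (mul (arr 0 (reg 2)) (reg 15))).eval
          (mem l s a) = (bestUpTo (a 0) (a 1) i).2.1 * a 1 i -
            a 0 i * (bestUpTo (a 0) (a 1) i).2.2 := by
        simp [eval, eval_reg, eval_arr, h2, h14, h15]
      unfold bestBody
      refine runs_block_if (fun hne => ?_) fun he => ?_
      · rw [hcond] at hne
        refine runs_reg i (by simp [eval_reg, h2]) (by norm_num) (fun _ => by omega) ?_
        refine runs_reg (a 0 i) (by simp [eval_reg, eval_arr, h2]) (by norm_num)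
          (fun hb => hb.arr 0 i) ?_
        refine runs_reg (a 1 i) (by simp [eval_reg, eval_arr, h2]) (by norm_num)
          (fun hb => hb.arr 1 i) ?_
        refine runs_block_nil (hend _ (by simp [h0]) (by simp [h2]) ?_ fun c hc => ?_)
        · rw [bestUpTo, if_pos hne]
          simp [HasBest]
        · rw [Function.update_of_ne (by omega), Function.update_of_ne (by omega),
            Function.update_of_ne (by omega)]
      · rw [hcond] at he
        refine runs_block_nil (hend s h0 h2 ?_ fun _ _ => rfl)
        rw [bestUpTo, if_neg (not_not.2 he)]
        exact ⟨h13, h14, h15⟩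
    refine (runs_while_true (n := bestBody.units * (0 + 1))
      (m := bestLoop.units * (r + 1)) (by simp [eval_reg, h0])
      (hbody.mono le_rfl ?_)).mono ?_ fun _ _ h => h
    · rintro s' a' ⟨rfl, h0', h2', hb, hfr⟩
      refine (ih h0' h2' hb (by omega)).mono le_rfl ?_
      rintro s'' a'' ⟨rfl, h2'', hb', hfr'⟩
      rw [add_right_comm, add_assoc] at h2'' hb'
      exact ⟨rfl, h2'', hb', fun c hc => (hfr' c hc).trans (hfr c hc)⟩
    · simp only [bestLoop, Prog.units]
      ring_nf
      omega

theorem runs_best {s : ℕ → ℕ} {a : ℕ → ℕ → ℕ} {r : ℕ} (h2 : s 2 = r) (hB : r < 2 ^ B)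
    (hone : 1 < 2 ^ B) :
    Runs l B best (best.units * (r + 1)) s a fun s' a' => a' = a ∧ s' 2 = r ∧
      HasBest s' (bestUpTo (a 0) (a 1) r) ∧ ∀ c, 16 ≤ c ∨ c = 12 → s' c = s c := by
  unfold best
  refine runs_reg 0 rfl (by norm_num) (fun _ => by omega) ?_
  refine runs_reg 1 rfl (by norm_num) (fun _ => hone) ?_
  refine runs_reg 0 rfl (by norm_num) (fun _ => by omega) ?_
  refine runs_reg r (by simp [eval_reg, h2]) (by norm_num) (fun _ => hB) ?_
  refine runs_reg 0 rfl (by norm_num) (fun _ => by omega) ?_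
  refine runs_block_cons ((runs_bestLoop r (i := 0) (by simp) (by simp)
    (by simp [HasBest, bestUpTo]) (by simpa using hB)).mono le_rfl ?_)
  rintro s' a' ⟨rfl, h2', hb, hfr⟩
  rw [zero_add] at h2' hb
  refine runs_block_nil ⟨rfl, h2', hb, fun c hc => ?_⟩
  rw [hfr c hc]
  have : c ≠ 0 ∧ c ≠ 2 ∧ c ≠ 13 ∧ c ≠ 14 ∧ c ≠ 15 := by omega
  simp [Function.update_of_ne, *]

/-- The statuses of the edges as they appear in the input, path by path. -/
def statusLists (I : CTPForDep) (b : BeliefForm I.Vertex I.Edge) : List (List ℕ) :=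
  (List.finRange I.numPaths).map fun i =>
    (List.finRange (I.pathLength i)).map fun j => (b.status ⟨i, j⟩).encode

theorem encodeBelief_eq (I : CTPForDep) (b : BeliefForm I.Vertex I.Edge) :
    I.encodeBelief b = I.encodeVertex b.loc ++ (statusLists I b).flatten := by
  rw [CTPForDep.encodeBelief, List.flatMap_def]
  rfl

theorem numPaths_le_length (I : CTPForDep) : I.numPaths ≤ I.encode.length := by
  have : I.encode.length = (I.paths.flatMap (encodeList EdgeSpec.encode)).length + 1 := rfl
  rw [this, List.length_flatMap]
  refine le_trans (le_trans (le_of_eq ?_) (List.length_le_sum_of_one_le _ ?_)) (Nat.le_succ _)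
  · rw [List.length_map]
  · intro n hn
    obtain ⟨d, -, rfl⟩ := List.mem_map.1 hn
    simp [encodeList]

theorem runs_move {I : CTPForDep} {b : BeliefForm I.Vertex I.Edge} {s : ℕ → ℕ} {a : ℕ → ℕ → ℕ}
    (hl : l = I.encode ++ I.encodeBelief b) (h2 : s 2 = 0)
    (hB : ∀ es ∈ I.paths, 2 * pathCap es < 2 ^ B) (hlB : l.length + 1 < 2 ^ B) :
    Runs l B move (move.units * (l.length + 1)) s a fun s' _ =>
      s' 16 = (I.policy b).1 ∧ s' 17 = (I.policy b).2 := by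
  have hloc : (I.encodeVertex b.loc).length = 3 := by
    cases b.loc <;> rfl
  have hnum := numPaths_le_length I
  have hsl : (statusLists I b).length = I.numPaths := by simp [statusLists]
  have hlen : l.length = I.encode.length + (3 + (statusLists I b).flatten.length) := by
    rw [hl, List.length_append, encodeBelief_eq, List.length_append, hloc]
  have hdrop : l.drop I.encode.length = I.encodeVertex b.loc ++ (statusLists I b).flatten := by
    rw [hl, List.drop_left, encodeBelief_eq]
  have hdrop' : l.drop (I.encode.length + 3) = (statusLists I b).flatten ++ [] := by
    rw [← hloc, drop_add_length hdrop, List.append_nil]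
  set E := I.encode.length with hE
  unfold move
  refine runs_block_cons ((runs_parse hl h2 hB (by omega) (by omega)).mono
    (Nat.mul_le_mul_left _ (by omega)) ?_)
  rintro s₁ a₁ ⟨h1, h2, hpath⟩
  refine runs_reg E (by simp [eval_reg, h1, hE]) (by norm_num) (fun _ => by omega) ?_
  refine runs_reg (E + 3) (by simp [eval, eval_reg, h1, hE]) (by norm_num)
    (fun _ => by omega) ?_
  refine runs_reg I.numPaths (by simp [eval_reg, h2]) (by norm_num) (fun _ => by omega) ?_
  refine runs_reg 0 rfl (by norm_num) (fun _ => by omega) ?_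
  refine runs_block_cons ((runs_pathStatusLoop (statusLists I b) (i := 0) hdrop'
    (by simp [hsl]) (by simp) (by simp) (fun j hj => ?_) (by omega)).mono
      (Nat.mul_le_mul_left _ (by omega)) ?_)
  · rw [zero_add, (hpath ⟨j, hsl ▸ hj⟩).n]
    simp [statusLists]
    rfl
  rintro s₂ a₂ ⟨h2, hfr, ha, haf⟩
  have hc : ∀ i < I.numPaths, a₂ 0 i = I.indexNum i := fun i hi => by
    rw [haf 0 i (Or.inl (by norm_num)), (hpath ⟨i, hi⟩).c, CTPForDep.indexNum,
      List.getD_eq_getElem _ _ hi]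
    rfl
  have hu : ∀ i < I.numPaths, a₂ 1 i = I.indexDen (I.NotBlocked b) i := fun i hi => by
    have h := ha i (by omega)
    have hmem : (∃ v ∈ (statusLists I b)[i]'(by omega), 2 ≤ v) ↔ ¬ I.NotBlocked b ⟨i, hi⟩ := by
      have hst : (statusLists I b)[i]'(by omega) = (List.finRange (I.pathLength ⟨i, hi⟩)).map
          fun j => (b.status ⟨⟨i, hi⟩, j⟩).encode := by
        simp only [statusLists, List.getElem_map]
        have : (List.finRange I.numPaths)[i]'(by simpa using hi) = ⟨i, hi⟩ := by simp
        rw [this]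
      rw [hst]
      simp only [List.mem_map, List.mem_finRange, true_and, exists_exists_eq_and,
        CTPForDep.NotBlocked, not_forall, not_not]
      refine exists_congr fun j => ?_
      cases b.status ⟨⟨i, hi⟩, j⟩ <;> simp [EdgeKnowledge.encode]
    rw [zero_add, hmem] at h
    rw [CTPForDep.indexDen, dif_pos hi]
    by_cases hn : I.NotBlocked b ⟨i, hi⟩
    · rw [if_pos hn]
      rcases h with h | h
      · exact absurd hn h.2
      · rw [h.1, (hpath ⟨i, hi⟩).u]
        rfl
    · rw [if_neg hn]
      rcases h with h | h
      · exact h.1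
      · exact absurd hn h.2
  have h12 : s₂ 12 = E := by rw [hfr 12 (by norm_num)]; simp
  refine runs_block_cons ((runs_best (by rw [h2, zero_add]) (by omega)
    (by omega)).mono (Nat.mul_le_mul_left _ (by omega)) ?_)
  rintro s₃ a₃ ⟨rfl, -, ⟨h13, -, -⟩, hfr3⟩
  rw [hsl, bestUpTo_congr hc hu] at h13
  have h12' : s₃ 12 = E := by rw [hfr3 12 (Or.inr rfl), h12]
  have hr := fun k (hk : k < (I.encodeVertex b.loc).length) => mem_succ_of_drop hdrop hk
  cases hbl : b.loc with
  | s =>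
    have r0 := hr 0 (by omega)
    simp only [hbl, CTPForDep.encodeVertex, add_zero, List.getElem_cons_zero] at r0
    refine runs_block_if (fun hne => absurd ?_ hne) fun _ => ?_
    · simp [eval, eval_inp, eval_reg, h12', r0]
    · refine runs_reg (s₃ 13) (by simp [eval_reg]) (by norm_num) (fun hb => hb.reg 13) ?_
      refine runs_reg 0 rfl (by norm_num) (fun _ => by omega) ?_
      refine runs_block_nil (runs_block_nil ?_)
      rw [I.policy_of_s hbl]
      simpa [CTPForDep.entrance] using h13
  | t =>
    have r0 := hr 0 (by omega)
    simp only [hbl, CTPForDep.encodeVertex, add_zero, List.getElem_cons_zero] at r0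
    refine runs_block_if (fun hne => absurd ?_ hne) fun _ => ?_
    · simp [eval, eval_inp, eval_reg, h12', r0]
    · refine runs_reg (s₃ 13) (by simp [eval_reg]) (by norm_num) (fun hb => hb.reg 13) ?_
      refine runs_reg 0 rfl (by norm_num) (fun _ => by omega) ?_
      refine runs_block_nil (runs_block_nil ?_)
      rw [I.policy_of_t hbl]
      simpa [CTPForDep.entrance] using h13
  | inner i j =>
    have r0 := hr 0 (by omega)
    have r1 := hr 1 (by omega)
    have r2 := hr 2 (by omega)
    simp only [hbl, CTPForDep.encodeVertex, add_zero, List.getElem_cons_zero,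
      List.getElem_cons_succ] at r0 r1 r2
    have hi := i.2
    have hj := j.2
    refine runs_block_if (fun _ => ?_) fun he => absurd he ?_
    · refine runs_reg i (by simp [eval, eval_inp, eval_reg, h12', r1]) (by norm_num)
        (fun hb => r1 s₃ a₃ ▸ hb.mem (E + 1 + 1)) ?_
      refine runs_reg j (by simp [eval, eval_inp, eval_reg, h12', r2]) (by norm_num)
        (fun hb => r2 (Function.update s₃ 16 i) a₃ ▸ hb.mem (E + 2 + 1)) ?_
      have hden := hu i hi
      refine runs_block_if (fun hne => ?_) fun he => ?_
      · have hne : I.indexDen (I.NotBlocked b) i ≠ 0 := by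
          rw [← hden]; simpa [eval_reg, eval_arr] using hne
        refine runs_reg (j + 1) (by simp [eval, eval_reg]) (by norm_num) (fun hb => ?_) ?_
        · have h := hb.arr 5 i
          rw [haf 5 i (Or.inl (by norm_num)), (hpath i).n] at h
          exact lt_of_le_of_lt (Nat.succ_le_of_lt (hj.trans_le (Nat.sub_le _ _))) h
        rw [I.policy_of_inner_of_ne hbl hne]
        exact runs_block_nil (runs_block_nil (runs_block_nil (by simp)))
      · have he : I.indexDen (I.NotBlocked b) i = 0 := by
          rw [← hden]; simpa [eval_reg, eval_arr] using he
        rw [I.policy_of_inner_of_eq hbl he]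
        exact runs_block_nil (runs_block_nil (runs_block_nil (by simp)))
    · simp [eval, eval_inp, eval_reg, h12', r0]

end

end RAM

/-! ### The optimal cost as a fraction -/

namespace CTPForDep

variable (I : CTPForDep)

/-- Integers that represent, for a set `U` of paths, the probability `x / q` that none of them is
open, and `valueOn U = y / (q * v)`. -/
structure Tally where
  y : ℕ
  x : ℕ
  q : ℕ
  v : ℕ

/-- The integers for a set of paths that is enlarged by a path with the data `d`. -/
def Tally.add (t : Tally) (d : PathData) : Tally where
  y := t.y * (d.q * d.v) + t.x * d.c * t.v
  x := t.x * (d.q - d.s)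
  q := t.q * d.q
  v := t.v * d.v

/-- The integers for the empty set of paths. -/
def Tally.init : Tally := ⟨0, 1, 1, 1⟩

/-- The integers `t` represent the set `U` of paths, and are not too large. -/
structure Tally.Represents (t : Tally) (U : Finset (Fin I.numPaths)) : Prop where
  initial : I.Initial U
  pr_eq : I.pr (I.NoneOpen U) * t.q = t.x
  valueOn_eq : I.valueOn U * (t.q * t.v) = t.y
  q_pos : 0 < t.q
  v_pos : 0 < t.v
  x_le : t.x ≤ t.q
  le : t.q * t.v ≤ ∏ i ∈ U, pathCap I.paths[i]
  y_le : t.y ≤ 2 * U.card * ∏ i ∈ U, pathCap I.paths[i]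

variable {I}

theorem Tally.represents_init : Tally.init.Represents I ∅ := by
  refine ⟨⟨by simp, by simp⟩, ?_, by simp [valueOn, Tally.init], ?_, ?_, ?_, ?_, ?_⟩
  · have : I.NoneOpen ∅ = fun _ => True := by
      funext x
      simp [NoneOpen]
    rw [this, pr_true]
    simp [Tally.init]
  all_goals simp [Tally.init]

theorem Tally.Represents.add {t : Tally} {U : Finset (Fin I.numPaths)} (h : t.Represents I U)
    {i : Fin I.numPaths} (hi : I.IsBest (fun j => I.openProb j ≠ 0 ∧ j ∉ U) i) :
    (t.add (I.data i)).Represents I (insert i U) := by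
  have hs := I.small_data i
  have hq : ((I.data i).q : ℝ) ≠ 0 := by exact_mod_cast hs.q_pos.ne'
  have hv : ((I.data i).v : ℝ) ≠ 0 := by exact_mod_cast hs.v_pos.ne'
  have hidx : I.index i * I.openProb i * ((I.data i).q * (I.data i).v) = (I.data i).c := by
    rw [index, div_mul_cancel₀ _ hi.1.1, cost_eq]
    field_simp
  refine ⟨h.initial.insert hi, ?_, ?_, Nat.mul_pos h.q_pos hs.q_pos,
    Nat.mul_pos h.v_pos hs.v_pos, Nat.mul_le_mul h.x_le (Nat.sub_le _ _), ?_, ?_⟩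
  · rw [pr_noneOpen_insert U hi.1.2]
    simp only [Tally.add]
    push_cast [Nat.cast_sub hs.s_le]
    rw [(I.data_eq i).1, ← h.pr_eq]
    ring
  · rw [h.initial.valueOn_insert hi]
    simp only [Tally.add]
    push_cast
    rw [← h.pr_eq, ← h.valueOn_eq, ← hidx]
    ring
  · rw [Finset.prod_insert hi.1.2]
    calc t.q * (I.data i).q * (t.v * (I.data i).v)
        = ((I.data i).q * (I.data i).v) * (t.q * t.v) := by ring
      _ ≤ _ := Nat.mul_le_mul hs.q_mul_v_le h.le
  · rw [Finset.prod_insert hi.1.2, Finset.card_insert_of_notMem hi.1.2]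
    set P := ∏ i ∈ U, pathCap I.paths[i]
    calc t.y * ((I.data i).q * (I.data i).v) + t.x * (I.data i).c * t.v
        ≤ 2 * U.card * P * pathCap I.paths[i] + t.q * (2 * pathCap I.paths[i]) * t.v :=
          add_le_add (Nat.mul_le_mul h.y_le hs.q_mul_v_le)
            (Nat.mul_le_mul_right _ (Nat.mul_le_mul h.x_le hs.c_le))
      _ = 2 * U.card * P * pathCap I.paths[i] + 2 * pathCap I.paths[i] * (t.q * t.v) := by ring
      _ ≤ 2 * U.card * P * pathCap I.paths[i] + 2 * pathCap I.paths[i] * P :=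
          Nat.add_le_add_left (Nat.mul_le_mul_left _ h.le) _
      _ = 2 * (U.card + 1) * (pathCap I.paths[i] * P) := by ring

variable (I)

/-- The path with the least index outside `U`, as found by `bestUpTo`. -/
def bestOutside (U : Finset (Fin I.numPaths)) : ℕ × ℕ × ℕ :=
  bestUpTo I.indexNum (I.indexDen (· ∉ U)) I.numPaths

/-- The number of the path with the least index outside `U`. -/
def nextPath (U : Finset (Fin I.numPaths)) : Fin I.numPaths :=
  ⟨(I.bestOutside U).1, bestUpTo_lt _ _ (List.length_pos_of_ne_nil I.paths_ne_nil)⟩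

/-- The first `k` paths in the order of indices, and the integers that represent them. -/
def tryPaths : ℕ → Finset (Fin I.numPaths) × Tally
  | 0 => (∅, Tally.init)
  | k + 1 =>
    if (I.bestOutside (tryPaths k).1).2.2 ≠ 0 then
      (insert (I.nextPath (tryPaths k).1) (tryPaths k).1,
        (tryPaths k).2.add (I.data (I.nextPath (tryPaths k).1)))
    else tryPaths k

theorem isBest_nextPath {U : Finset (Fin I.numPaths)} (h : (I.bestOutside U).2.2 ≠ 0) :
    I.IsBest (fun j => I.openProb j ≠ 0 ∧ j ∉ U) (I.nextPath U) :=
  I.isBest_of_bestUpTo (b := I.nextPath U) rfl h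

theorem represents_tryPaths (k : ℕ) : (I.tryPaths k).2.Represents I (I.tryPaths k).1 := by
  induction k with
  | zero => exact Tally.represents_init
  | succ k ih =>
    rw [tryPaths]
    split
    · rename_i h
      exact ih.add (I.isBest_nextPath h)
    · exact ih

theorem tryPaths_card_or (k : ℕ) : (I.tryPaths k).1.card = k ∨
    ∀ i, I.openProb i ≠ 0 → i ∈ (I.tryPaths k).1 := by
  induction k with
  | zero => exact Or.inl rfl
  | succ k ih =>
    rw [tryPaths]
    split
    · rename_i h
      refine ih.imp (fun h1 => ?_) fun h1 i hi => Finset.mem_insert_of_mem (h1 i hi)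
      rw [Finset.card_insert_of_notMem (I.isBest_nextPath h).1.2, h1]
    · rename_i h
      refine Or.inr fun i hi => ?_
      by_contra hiU
      exact I.bestUpTo_eq_zero (not_not.1 h) i ⟨hi, hiU⟩

theorem mem_tryPaths (i : Fin I.numPaths) :
    i ∈ (I.tryPaths I.numPaths).1 ↔ I.openProb i ≠ 0 := by
  refine ⟨(I.represents_tryPaths _).initial.openProb_ne_zero i, fun hi => ?_⟩
  rcases I.tryPaths_card_or I.numPaths with h | h
  · rw [Finset.eq_univ_of_card _ (h.trans (Fintype.card_fin _).symm)]
    exact Finset.mem_univ i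
  · exact h i hi

/-- The optimal expected cost as a fraction; it is `1 / 0` if the paths with a positive success
probability may all turn out to be blocked. -/
def costFraction : ℕ × ℕ :=
  if (I.tryPaths I.numPaths).2.x ≠ 0 then (1, 0)
  else ((I.tryPaths I.numPaths).2.y,
    (I.tryPaths I.numPaths).2.q * (I.tryPaths I.numPaths).2.v)

theorem fractionValue_costFraction : fractionValue I.costFraction = I.toCTPDep.optimalCost := by
  have h := I.represents_tryPaths I.numPaths
  have hU := I.mem_tryPaths
  have hpr := h.pr_eq
  have hval := h.valueOn_eq
  have hq := h.q_pos
  have hv := h.v_pos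
  rw [noneOpen_eq hU] at hpr
  rw [valueOn_eq_value fun i => (hU i).2] at hval
  rw [costFraction]
  generalize (I.tryPaths I.numPaths).2 = t at *
  split
  · rename_i hx
    rw [fractionValue, if_pos rfl, optimalCost_eq_top]
    intro h0
    rw [h0, zero_mul] at hpr
    exact hx (by exact_mod_cast hpr.symm)
  · rename_i hx
    have hqv : 0 < t.q * t.v := Nat.mul_pos hq hv
    have h0 : I.pr (fun x => ∀ i, I.openProb i ≠ 0 → ¬ I.PathOpen i x) = 0 := by
      rw [not_not.1 hx, Nat.cast_zero] at hpr
      exact (mul_eq_zero.1 hpr).resolve_right (by exact_mod_cast hq.ne')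
    have hval' : I.value = (t.y : ℝ) / ((t.q * t.v : ℕ) : ℝ) := by
      rw [eq_div_iff (by exact_mod_cast hqv.ne'), ← hval]
      push_cast
      ring
    rw [fractionValue, if_neg hqv.ne', I.committing_policy.optimalCost_eq h0, hval',
      ENNReal.ofReal_div_of_pos (by exact_mod_cast hqv), ENNReal.ofReal_natCast,
      ENNReal.ofReal_natCast]

end CTPForDep

namespace RAM

open RAM.Expr RAM.Prog

/-! ### Computing the optimal cost -/

/-- Finds the next path in the order of indices; if there is one, adds it to the tally in `reg 19`
to `reg 22`, and makes the denominator of its index 0. -/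
def tallyBody : Prog := block
  [best,
   ifNonzero (reg 15)
     (block
       [setReg 19 (add (mul (reg 19) (mul (arr 3 (reg 13)) (arr 4 (reg 13))))
          (mul (mul (reg 20) (arr 0 (reg 13))) (reg 22))),
        setReg 20 (mul (reg 20) (sub (arr 3 (reg 13)) (arr 2 (reg 13)))),
        setReg 21 (mul (reg 21) (arr 3 (reg 13))),
        setReg 22 (mul (reg 22) (arr 4 (reg 13))),
        setArr 1 (reg 13) (lit 0)])
     (block []),
   setReg 18 (sub (reg 18) (lit 1))]

/-- Does this `reg 18` times. -/
def tallyLoop : Prog := whileNonzero (reg 18) tallyBody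

/-- Computes the optimal cost as a fraction. -/
def cost : Prog := block
  [parse,
   setReg 18 (reg 2), setReg 19 (lit 0), setReg 20 (lit 1), setReg 21 (lit 1), setReg 22 (lit 1),
   tallyLoop,
   ifNonzero (reg 20) (block [setReg 16 (lit 1), setReg 17 (lit 0)])
     (block [setReg 16 (reg 19), setReg 17 (mul (reg 21) (reg 22))])]

section

variable {l : List ℕ} {s : ℕ → ℕ} {a : ℕ → ℕ → ℕ} {B : ℕ} {I : CTPForDep}

/-- The registers contain the tally `t` of the set `U` of paths, and the arrays the data of the
paths, where the denominators of the indices of the paths in `U` are replaced by 0. -/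
structure HasTally (I : CTPForDep) (s : ℕ → ℕ) (a : ℕ → ℕ → ℕ) (U : Finset (Fin I.numPaths))
    (t : CTPForDep.Tally) : Prop where
  y : s 19 = t.y
  x : s 20 = t.x
  q : s 21 = t.q
  v : s 22 = t.v
  numPaths : s 2 = I.numPaths
  dataC : ∀ i : Fin I.numPaths, a 0 i = (I.data i).c
  dataU : ∀ i : Fin I.numPaths, a 1 i = if i ∈ U then 0 else (I.data i).u
  dataS : ∀ i : Fin I.numPaths, a 2 i = (I.data i).s
  dataQ : ∀ i : Fin I.numPaths, a 3 i = (I.data i).q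
  dataV : ∀ i : Fin I.numPaths, a 4 i = (I.data i).v

theorem HasTally.best_eq {U : Finset (Fin I.numPaths)} {t : CTPForDep.Tally}
    (h : HasTally I s a U t) : bestUpTo (a 0) (a 1) I.numPaths = I.bestOutside U := by
  refine bestUpTo_congr (fun i hi => ?_) fun i hi => ?_
  · rw [h.dataC ⟨i, hi⟩, ← I.indexNum_eq]
  · rw [h.dataU ⟨i, hi⟩, CTPForDep.indexDen, dif_pos hi]
    by_cases hU : (⟨i, hi⟩ : Fin I.numPaths) ∈ U <;> simp [hU]

/-- A bound for the numbers in all tallies. -/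
def totalCap (I : CTPForDep) : ℕ := 2 * I.numPaths * (I.paths.map pathCap).prod

theorem prod_pathCap_le (U : Finset (Fin I.numPaths)) :
    ∏ i ∈ U, pathCap I.paths[i] ≤ (I.paths.map pathCap).prod := by
  refine (Finset.prod_le_prod_of_subset_of_one_le' (Finset.subset_univ U) fun i _ _ =>
    pathCap_pos _).trans (le_of_eq ?_)
  exact Fin.prod_univ_fun_getElem I.paths pathCap

theorem numPaths_pos : 0 < I.numPaths := List.length_pos_of_ne_nil I.paths_ne_nil

theorem tally_le {U : Finset (Fin I.numPaths)} {t : CTPForDep.Tally} (h : t.Represents I U) :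
    t.q * t.v ≤ totalCap I ∧ t.y ≤ totalCap I := by
  have hcard : U.card ≤ I.numPaths := by simpa using U.card_le_univ
  have hP := prod_pathCap_le U
  refine ⟨h.le.trans (hP.trans (Nat.le_mul_of_pos_left _ ?_)), h.y_le.trans ?_⟩
  · have := numPaths_pos (I := I); omega
  · exact Nat.mul_le_mul (Nat.mul_le_mul_left _ hcard) hP

theorem tally_q_le {U : Finset (Fin I.numPaths)} {t : CTPForDep.Tally} (h : t.Represents I U) :
    t.q ≤ totalCap I :=
  (Nat.le_mul_of_pos_right _ h.v_pos).trans (tally_le h).1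

theorem tally_v_le {U : Finset (Fin I.numPaths)} {t : CTPForDep.Tally} (h : t.Represents I U) :
    t.v ≤ totalCap I :=
  (Nat.le_mul_of_pos_left _ h.q_pos).trans (tally_le h).1

theorem runs_tallyBody {k r : ℕ} (h18 : s 18 = r + 1)
    (h : HasTally I s a (I.tryPaths k).1 (I.tryPaths k).2) (hB : totalCap I < 2 ^ B)
    (hnB : I.numPaths < 2 ^ B) :
    Runs l B tallyBody (tallyBody.units * (I.numPaths + 1)) s a fun s' a' =>
      s' 18 = r ∧ HasTally I s' a' (I.tryPaths (k + 1)).1 (I.tryPaths (k + 1)).2 := by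
  have hn := numPaths_pos (I := I)
  have hrep := I.represents_tryPaths (k + 1)
  have hend : ∀ s' a', s' 18 = r + 1 →
      HasTally I s' a' (I.tryPaths (k + 1)).1 (I.tryPaths (k + 1)).2 →
      Runs l B (block [setReg 18 (sub (reg 18) (lit 1))])
        ((block [setReg 18 (sub (reg 18) (lit 1))]).units * (I.numPaths + 1)) s' a' fun s' a' =>
        s' 18 = r ∧ HasTally I s' a' (I.tryPaths (k + 1)).1 (I.tryPaths (k + 1)).2 := by
    intro s' a' h18' h'
    refine runs_reg r (by simp [eval, eval_reg, h18']) (by norm_num)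
      (fun hb => (Nat.lt_succ_self r).trans (by have := hb.reg 18; rwa [h18'] at this)) ?_
    obtain ⟨e1, e2, e3, e4, e5, e6, e7, e8, e9, e10⟩ := h'
    exact runs_block_nil ⟨by simp, ⟨by simpa using e1, by simpa using e2, by simpa using e3,
      by simpa using e4, by simpa using e5, e6, e7, e8, e9, e10⟩⟩
  unfold tallyBody
  refine runs_block_cons ((runs_best h.numPaths hnB (by omega)).mono le_rfl ?_)
  rintro s' a ⟨rfl, h2, hbest, hfr⟩
  rw [h.best_eq] at hbest
  obtain ⟨h13, -, h15⟩ := hbest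
  have f : ∀ c, 16 ≤ c → s' c = s c := fun c hc => hfr c (Or.inl hc)
  have e15 : ∀ a, (reg 15).eval (mem l s' a) = (I.bestOutside (I.tryPaths k).1).2.2 :=
    fun a => by simp [eval_reg, h15]
  obtain ⟨e1, e2, e3, e4, e5, e6, e7, e8, e9, e10⟩ := h
  rw [CTPForDep.tryPaths] at hrep hend ⊢
  refine runs_block_if (fun hne => ?_) fun he => ?_
  · rw [e15] at hne
    rw [if_pos hne] at hrep hend ⊢
    set i := I.nextPath (I.tryPaths k).1 with hi
    set U := (I.tryPaths k).1 with hU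
    set t := (I.tryPaths k).2 with ht
    have h13' : s' 13 = i := h13
    have hle := tally_le hrep
    refine runs_reg (t.add (I.data i)).y (by
      simp [eval, eval_reg, eval_arr, h13', f, e1, e2, e4, e6, e9, e10, CTPForDep.Tally.add])
      (by norm_num) (fun _ => hle.2.trans_lt hB) ?_
    refine runs_reg (t.add (I.data i)).x (by
      simp [eval, eval_reg, eval_arr, h13', f, e2, e8, e9, CTPForDep.Tally.add])
      (by norm_num) (fun _ => (hrep.x_le.trans (tally_q_le hrep)).trans_lt hB) ?_
    refine runs_reg (t.add (I.data i)).q (by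
      simp [eval, eval_reg, eval_arr, h13', f, e3, e9, CTPForDep.Tally.add])
      (by norm_num) (fun _ => (tally_q_le hrep).trans_lt hB) ?_
    refine runs_reg (t.add (I.data i)).v (by
      simp [eval, eval_reg, eval_arr, h13', f, e4, e10, CTPForDep.Tally.add])
      (by norm_num) (fun _ => (tally_v_le hrep).trans_lt hB) ?_
    refine runs_arr i 0 (by simp [eval_reg, h13']) rfl (by norm_num)
      (fun _ => Nat.pow_pos (by norm_num)) ?_
    refine runs_block_nil (hend _ _ (by simp [f, h18]) ?_)
    refine ⟨by simp, by simp, by simp, by simp, by simp [h2],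
      fun j => by simp [updateArr_apply, e6], fun j => ?_, fun j => by simp [updateArr_apply, e8],
      fun j => by simp [updateArr_apply, e9], fun j => by simp [updateArr_apply, e10]⟩
    rw [updateArr_apply, e7]
    by_cases hj : j = i
    · simp [hj]
    · simp [hj, Fin.val_inj]
  · rw [e15] at he
    rw [if_neg (not_not.2 he)] at hrep hend ⊢
    exact runs_block_nil (hend _ _ (by rw [f 18 (by norm_num), h18])
      ⟨by rw [f 19 (by norm_num), e1], by rw [f 20 (by norm_num), e2],
        by rw [f 21 (by norm_num), e3], by rw [f 22 (by norm_num), e4], h2, e6, e7, e8, e9, e10⟩)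

/-- The loop started when the next path has been searched for `k` times. -/
theorem runs_tallyLoop (hB : totalCap I < 2 ^ B) (hnB : I.numPaths < 2 ^ B) (r : ℕ) :
    ∀ {s : ℕ → ℕ} {a : ℕ → ℕ → ℕ} {k : ℕ}, s 18 = r →
    HasTally I s a (I.tryPaths k).1 (I.tryPaths k).2 →
    Runs l B tallyLoop (tallyLoop.units * ((I.numPaths + 1) * (r + 1))) s a fun s' a' =>
      HasTally I s' a' (I.tryPaths (k + r)).1 (I.tryPaths (k + r)).2 := by
  induction r with
  | zero =>
    intro s a k h18 h
    refine (runs_while_false (by simpa [eval_reg] using h18) h).mono ?_ fun _ _ h => h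
    simp only [tallyLoop, Prog.units]
    nlinarith [Nat.zero_le I.numPaths, Nat.zero_le tallyBody.units, Nat.zero_le (reg 18).units]
  | succ r ih =>
    intro s a k h18 h
    refine (runs_while_true (n := tallyBody.units * (I.numPaths + 1))
      (m := tallyLoop.units * ((I.numPaths + 1) * (r + 1))) (by simp [eval_reg, h18])
      ((runs_tallyBody h18 h hB hnB).mono le_rfl ?_)).mono ?_ fun _ _ h => h
    · rintro s' a' ⟨h18', h'⟩
      have := ih h18' h'
      rwa [add_right_comm, add_assoc] at this
    · simp only [tallyLoop, Prog.units]
      have : (reg 18).units + 1 ≤ ((reg 18).units + 1) * (I.numPaths + 1) :=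
        Nat.le_mul_of_pos_right _ (Nat.succ_pos _)
      calc _ ≤ ((reg 18).units + 1) * (I.numPaths + 1) + (tallyBody.units * (I.numPaths + 1) +
            ((reg 18).units + 1 + tallyBody.units) * ((I.numPaths + 1) * (r + 1))) := by gcongr
        _ = _ := by ring

theorem runs_cost {N : ℕ} (hl : l = I.encode) (h2 : s 2 = 0) (hN : l.length ≤ N)
    (hnN : I.numPaths ≤ N) (hcap : ∀ es ∈ I.paths, 2 * pathCap es < 2 ^ B)
    (hB : totalCap I < 2 ^ B) (hnB : I.numPaths < 2 ^ B) (hone : 1 < 2 ^ B) :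
    Runs l B cost (cost.units * (N * N + 2 * N + 1)) s a fun s' _ =>
      s' 16 = I.costFraction.1 ∧ s' 17 = I.costFraction.2 := by
  unfold cost
  refine runs_block_cons ((runs_parse (rest := []) (by rw [hl, List.append_nil]) h2 hcap hnB
    hone).mono (Nat.mul_le_mul_left _ (by rw [← hl]; nlinarith)) ?_)
  rintro s₁ a₁ ⟨-, h2, hpath⟩
  refine runs_reg I.numPaths (by simp [eval_reg, h2]) (by norm_num) (fun _ => hnB) ?_
  refine runs_reg 0 rfl (by norm_num) (fun _ => by omega) ?_
  refine runs_reg 1 rfl (by norm_num) (fun _ => hone) ?_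
  refine runs_reg 1 rfl (by norm_num) (fun _ => hone) ?_
  refine runs_reg 1 rfl (by norm_num) (fun _ => hone) ?_
  refine runs_block_cons ((runs_tallyLoop hB hnB I.numPaths (k := 0) (by simp) ?_).mono
    (Nat.mul_le_mul_left _ ?_) ?_)
  · exact ⟨by simp [CTPForDep.tryPaths, CTPForDep.Tally.init],
      by simp [CTPForDep.tryPaths, CTPForDep.Tally.init],
      by simp [CTPForDep.tryPaths, CTPForDep.Tally.init],
      by simp [CTPForDep.tryPaths, CTPForDep.Tally.init], by simp [h2],
      fun i => (hpath i).c, fun i => (hpath i).u,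
      fun i => (hpath i).s, fun i => (hpath i).q, fun i => (hpath i).v⟩
  · calc (I.numPaths + 1) * (I.numPaths + 1) ≤ (N + 1) * (N + 1) := by gcongr
      _ = _ := by ring
  intro s₂ a₂ h
  rw [zero_add] at h
  have hrep := I.represents_tryPaths I.numPaths
  rw [CTPForDep.costFraction]
  obtain ⟨e1, e2, e3, e4, -, -, -, -, -, -⟩ := h
  generalize (I.tryPaths I.numPaths).2 = t at *
  refine runs_block_if (fun hne => ?_) fun he => ?_
  · have hx : t.x ≠ 0 := by simpa [eval_reg, e2] using hne
    rw [if_pos hx]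
    refine runs_reg 1 rfl (by norm_num) (fun _ => hone) ?_
    refine runs_reg 0 rfl (by norm_num) (fun _ => by omega) ?_
    exact runs_block_nil (runs_block_nil (by simp))
  · have hx : t.x = 0 := by simpa [eval_reg, e2] using he
    rw [if_neg (not_not.2 hx)]
    refine runs_reg t.y (by simp [eval_reg, e1]) (by norm_num)
      (fun _ => (tally_le hrep).2.trans_lt hB) ?_
    refine runs_reg (t.q * t.v) (by simp [eval, eval_reg, e3, e4]) (by norm_num)
      (fun _ => (tally_le hrep).1.trans_lt hB) ?_
    exact runs_block_nil (runs_block_nil (by simp))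

end

end RAM

namespace RAM

/-! ### The size of the input -/

theorem inputSize_append (l₁ l₂ : List ℕ) :
    inputSize (l₁ ++ l₂) = inputSize l₁ + inputSize l₂ := by
  simp [inputSize]

theorem inputSize_cons (n : ℕ) (l : List ℕ) : inputSize (n :: l) = n.size + 1 + inputSize l := by
  simp [inputSize]

theorem length_le_inputSize (l : List ℕ) : l.length ≤ inputSize l := by
  induction l with
  | nil => simp
  | cons n l ih => rw [inputSize_cons, List.length_cons]; omega

theorem lt_two_pow_inputSize {n : ℕ} {l : List ℕ} (h : n ∈ l) : n < 2 ^ inputSize l := by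
  induction l with
  | nil => simp at h
  | cons k l ih =>
    rw [inputSize_cons]
    rcases List.mem_cons.1 h with rfl | h
    · exact (Nat.lt_size_self n).trans_le (Nat.pow_le_pow_right (by norm_num) (by omega))
    · exact (ih h).trans_le (Nat.pow_le_pow_right (by norm_num) (by omega))

/-- A product of numbers has at most as many bits as the encodings of its factors together. -/
theorem prod_map_le {α : Type} {f : α → ℕ} {g : α → List ℕ} {xs : List α}
    (h : ∀ x ∈ xs, f x ≤ 2 ^ inputSize (g x)) :
    (xs.map f).prod ≤ 2 ^ inputSize (xs.flatMap g) := by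
  induction xs with
  | nil => simp [inputSize]
  | cons x xs ih =>
    rw [List.map_cons, List.prod_cons, List.flatMap_cons, inputSize_append, pow_add]
    exact Nat.mul_le_mul (h x (by simp)) (ih fun y hy => h y (by simp [hy]))

theorem cap_le {d : EdgeSpec} (hd : d.table ≠ []) : d.cap ≤ 2 ^ inputSize d.encode := by
  obtain ⟨tl, h, -⟩ := encode_eq hd
  rw [h]
  simp only [inputSize_append, inputSize_cons, EdgeSpec.cap]
  have h1 := (Nat.lt_size_self d.weight.num).le
  have h2 := (Nat.lt_size_self d.weight.den).le
  have h3 := (Nat.lt_size_self d.head.den).le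
  generalize d.weight.num.size = x at *
  generalize d.weight.den.size = y at *
  generalize d.head.den.size = z at *
  have h4 : d.weight.num + d.weight.den ≤ 2 ^ (x + y + 1) := by
    have h5 : 2 ^ x ≤ 2 ^ (x + y) := Nat.pow_le_pow_right (by norm_num) (by omega)
    have h6 : 2 ^ y ≤ 2 ^ (x + y) := Nat.pow_le_pow_right (by norm_num) (by omega)
    rw [pow_succ]
    omega
  calc d.head.den * (d.weight.num + d.weight.den) ≤ 2 ^ z * 2 ^ (x + y + 1) :=
        Nat.mul_le_mul h3 h4
    _ = 2 ^ (z + (x + y + 1)) := (pow_add _ _ _).symm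
    _ ≤ _ := Nat.pow_le_pow_right (by norm_num) (by omega)

theorem inputSize_encodeList {α : Type} (f : α → List ℕ) (l : List α) :
    inputSize (l.flatMap f) ≤ inputSize (encodeList f l) := by
  rw [encodeList, inputSize_cons]
  omega

variable (I : CTPForDep)

theorem pathCap_le {es : List EdgeSpec} (hes : es ∈ I.paths) :
    pathCap es ≤ 2 ^ inputSize (encodeList EdgeSpec.encode es) :=
  (prod_map_le fun d hd => cap_le (I.table_ne_nil es hes d hd)).trans
    (Nat.pow_le_pow_right (by norm_num) (inputSize_encodeList _ _))

theorem prod_pathCap_le_two_pow : (I.paths.map pathCap).prod ≤ 2 ^ inputSize I.encode :=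
  (prod_map_le fun es hes => pathCap_le I hes).trans
    (Nat.pow_le_pow_right (by norm_num) (inputSize_encodeList _ _))

theorem pathCap_le_two_pow {es : List EdgeSpec} (hes : es ∈ I.paths) :
    pathCap es ≤ 2 ^ inputSize I.encode := by
  refine le_trans (Nat.le_of_dvd ?_ (List.dvd_prod (List.mem_map_of_mem hes)))
    (prod_pathCap_le_two_pow I)
  refine Nat.pos_of_ne_zero (List.prod_ne_zero ?_)
  simp only [List.mem_map, not_exists, not_and]
  exact fun es _ h => (pathCap_pos es).ne' h

theorem numPaths_lt_two_pow : I.numPaths < 2 ^ inputSize I.encode :=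
  lt_two_pow_inputSize (List.mem_cons_self (a := I.numPaths))

theorem totalCap_le : totalCap I ≤ 2 ^ (2 * inputSize I.encode + 1) := by
  calc 2 * I.numPaths * (I.paths.map pathCap).prod
      ≤ 2 * 2 ^ inputSize I.encode * 2 ^ inputSize I.encode :=
        Nat.mul_le_mul (Nat.mul_le_mul_left _ (numPaths_lt_two_pow I).le)
          (prod_pathCap_le_two_pow I)
    _ = _ := by ring

theorem two_le_length_encode : 2 ≤ I.encode.length := by
  obtain ⟨es, ps, h⟩ := List.exists_cons_of_ne_nil I.paths_ne_nil
  rw [CTPForDep.encode, h]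
  simp [encodeList]

/-- The number of bits that suffice for all numbers in a computation on an input of size `N`. -/
def wordSize (N : ℕ) : ℕ := 2 * N + 2

/-- A program computes in polynomial time if it needs at most a quadratic number of elementary
operations, on numbers with a linear number of bits. -/
theorem polyTime_of_runs {α : Type} {inp : α → List ℕ} {out : α → ℕ × ℕ} {p : Prog} {c d : ℕ}
    (hc : c < 32) (hd : d < 32) (hl : ∀ x, 2 ≤ (inp x).length)
    (h : ∀ x, Runs (inp x) (wordSize (inputSize (inp x))) p
      (p.units * (inputSize (inp x) * inputSize (inp x) + 2 * inputSize (inp x) + 1))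
      (fun _ => 0) (fun _ _ => 0) fun s _ => s c = (out x).1 ∧ s d = (out x).2) :
    PolyTime inp fun x => [(out x).1, (out x).2] := by
  refine ⟨.seq p (output c d), (Polynomial.C p.units * (Polynomial.X * Polynomial.X +
    2 * Polynomial.X + 1) + Polynomial.C (outputUnits c d)) * (2 * Polynomial.X + 3),
    fun x => ?_⟩
  have hpow : ∀ n, n ≤ inputSize (inp x) → 2 ^ n ≤ 2 ^ wordSize (inputSize (inp x)) :=
    fun n hn => Nat.pow_le_pow_right (by norm_num) (by rw [wordSize]; omega)
  have hb : Bounded (inp x) (wordSize (inputSize (inp x))) (fun _ => 0) (fun _ _ => 0) :=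
    ⟨(Nat.lt_two_pow_self).trans_le (hpow _ (length_le_inputSize _)),
      fun v hv => (lt_two_pow_inputSize hv).trans_le (hpow _ le_rfl),
      fun _ => Nat.pow_pos (by norm_num), fun _ _ => Nat.pow_pos (by norm_num)⟩
  obtain ⟨s', a', ⟨h1, h2⟩, k, m, hexec, hk, hm⟩ := (h x).output hc hd (hl x) hb
  rw [← load_eq_mem] at hexec
  rw [h1, h2] at hm
  refine ⟨k, m, hexec, hk.trans (le_of_eq ?_), hm⟩
  simp [wordSize]

theorem polyTime_policy : PolyTime
    (fun x : (Σ I : CTPForDep, BeliefForm I.Vertex I.Edge) => x.1.encode ++ x.1.encodeBelief x.2)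
    (fun x => x.1.encodeEdge (x.1.policy x.2)) := by
  refine polyTime_of_runs (p := move) (c := 16) (d := 17)
    (α := Σ I : CTPForDep, BeliefForm I.Vertex I.Edge)
    (out := fun x => ((x.1.policy x.2).1, (x.1.policy x.2).2)) (by norm_num) (by norm_num)
    (fun x => ?_) fun ⟨I, b⟩ => ?_
  · have := two_le_length_encode x.1
    rw [List.length_append]
    omega
  · have hlen := length_le_inputSize (I.encode ++ I.encodeBelief b)
    have hle : inputSize I.encode ≤ inputSize (I.encode ++ I.encodeBelief b) := by
      rw [inputSize_append]; omega
    dsimp only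
    set N := inputSize (I.encode ++ I.encodeBelief b)
    have h4 : 4 * 2 ^ N ≤ 2 ^ wordSize N := by
      rw [wordSize, pow_add, mul_comm]
      exact Nat.mul_le_mul_right _ (Nat.pow_le_pow_right (by norm_num) (by omega))
    have h1 : N < 2 ^ N := Nat.lt_two_pow_self
    refine (runs_move rfl rfl (fun es hes => ?_) (by omega)).mono
      (Nat.mul_le_mul_left _ (by nlinarith)) fun _ _ h => h
    have h2 := pathCap_le_two_pow I hes
    have h3 : 2 ^ inputSize I.encode ≤ 2 ^ N := Nat.pow_le_pow_right (by norm_num) hle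
    omega

theorem polyTime_costFraction :
    PolyTime CTPForDep.encode fun I => [I.costFraction.1, I.costFraction.2] := by
  refine polyTime_of_runs (p := cost) (c := 16) (d := 17) (by norm_num) (by norm_num)
    two_le_length_encode fun I => ?_
  have hlen := length_le_inputSize I.encode
  have hn : I.numPaths ≤ inputSize I.encode := (numPaths_le_length I).trans hlen
  have hnB := numPaths_lt_two_pow I
  have hcap := fun es hes => pathCap_le_two_pow I (es := es) hes
  have htot := totalCap_le I
  set N := inputSize I.encode
  have h4 : 4 * 2 ^ N ≤ 2 ^ wordSize N := by
    rw [wordSize, pow_add, mul_comm]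
    exact Nat.mul_le_mul_right _ (Nat.pow_le_pow_right (by norm_num) (by omega))
  have h1 : 2 ^ (2 * N + 1) < 2 ^ wordSize N := Nat.pow_lt_pow_right (by norm_num) (by
    rw [wordSize]; omega)
  have h0 : 0 < 2 ^ N := Nat.pow_pos (by norm_num)
  exact runs_cost rfl rfl hlen hn (fun es hes => by have := hcap es hes; omega)
    (htot.trans_lt h1) (by omega) (by omega)

end RAM

end

theorem mainTheorem2 :
    (∃ π : (I : CTPForDep) → CTPPolicy I.Vertex I.Edge,
      (∀ I : CTPForDep, I.toCTPDep.IsOptimal (π I)) ∧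
      RAM.PolyTime
        (fun a : (Σ I : CTPForDep, BeliefForm I.Vertex I.Edge) => a.1.encode ++ a.1.encodeBelief a.2)
        (fun a => a.1.encodeEdge (π a.1 a.2))) ∧
    (∃ c : CTPForDep → ℕ × ℕ,
      (∀ I : CTPForDep, fractionValue (c I) = I.toCTPDep.optimalCost) ∧
      RAM.PolyTime CTPForDep.encode (fun I => [(c I).1, (c I).2])) :=
  ⟨⟨fun I => I.policy, fun I => I.committing_policy.isOptimal, RAM.polyTime_policy⟩,
    ⟨fun I => I.costFraction, fun I => I.fractionValue_costFraction, RAM.polyTime_costFraction⟩⟩
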